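/- **Setting.** Let $n\in\mathbb N\cup\{\infty\}$ and let $r,h,k\ge 0$ be integers with $r\le n$ and $k\le r+h$; put $m=r+h-k$. Let $V_n=\mathbb Q[X]/(X^n)$ ($V_\infty=\mathbb Q[X]$), with basis $(X^i)_{0\le i<n}$ and dual forms $\partial^j$, $0\le j<n$. For $q\ge0$ let $B_q=\mathbb Q[c_1,\dots,c_q]$, let $\sum_{j\ge 0}S_jz^j=1/(1-c_1z+\cdots+(-1)^qc_qz^q)$ ($S_j=0$ for $j<0$), and let $B_{q,n}=B_q/(S_{n-q+1},\dots,S_n)$ if $q\le n<\infty$ (the cohomology ring $H^*(G(q,n);\mathbb Q)$), $B_{q,\infty}=B_q$, and $B_{q,n}=0$ if $q>n$. Define $x_i\in B_{q,n}$ by $\sum_{i\ge1}x_iz^i=\log\sum_{j\ge 0} S_jz^j$. Let $p_i,e_i,h_i$ be the power sums, elementary and complete symmetric polynomials, and let $\mathcal P_{q,n}$ be the set of partitions $n-q\ge\lambda_1\ge\cdots\ge\lambda_q\ge0$. Write ${\bf X}^q(\lambda)=X^{q-1+\lambda_1}\wedge\cdots\wedge X^{\lambda_q}$ and $\partial^q(\mu)=\partial^{q-1+\mu_1}\cdots\partial^{\mu_q}$,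 a word acting on $\bigwedge V_n$ by successive contractions, the rightmost letter first. The ring $B_{q}$ acts on $\bigwedge^qV_n$ through symmetric functions of the $q$ operators "multiply the $i$-th factor by $X$", $c_i$ acting as their $i$-th elementary symmetric function; the action descends to $B_{q,n}$ and defines a linear map $B_{q,n}\to\bigwedge^qV_n$, $P\mapsto P\cdot{\bf X}^q(0)$. Let ${\bf z}=(z_1,\dots,z_h)$, ${\bf w}^{-1}=(w_1^{-1},\dots,w_k^{-1})$, ${\bf t}=(t_1,\dots,t_r)$ be indeterminates, and consider $$\mathcal E_{(r,h,k),n}=\sum_{\lambda\in\mathcal P_{h,n},\,\mu\in\mathcal P_{k,n}}{\bf X}^h(\lambda)\,\partial^k(\mu)\,s_\lambda({\bf z})\,s_\mu({\bf w}^{-1}),\qquad \widetilde{\mathcal E}_{(r,h,k),n}=\sum_{\lambda\in\mathcal P_{h,n}}s_\lambda({\bf z})\,{\bf X}^h(\lambda)\,\partial(w_k^{-1})\cdots\partial(w_1^{-1}),$$ where $s_\lambda$ are the Schur polynomials and $\partial(w^{-1})=\sum_{0\le j<n}\partial^jw^{-j}$. A word ${\bf X}^h(\lambda)\,\partial^{j_1}\cdots\partial^{j_k}$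 sends $u$ to ${\bf X}^h(\lambda)\wedge(\partial^{j_1}\lrcorner(\cdots(\partial^{j_k}\lrcorner u)))$; for $P\in B_{r,n}$ its value $\star P\in B_{m,n}$ is defined by $(\cdot\star P)\,{\bf X}^m(0)=(\cdot)(P\,{\bf X}^r(0))$. **Theorem.** The map $P\mapsto P\cdot{\bf X}^m(0)$ is an isomorphism of $B_{m,n}$ onto $\bigwedge^mV_n$ (so that $\star$ is well defined), and $$\prod_{1\le i<j\le k}(w_j^{-1}-w_i^{-1})\cdot\Big(\mathcal E_{(r,h,k),n}\star\exp\big(\textstyle\sum_{i\ge1}x_ip_i({\bf t})\big)\Big)=\widetilde{\mathcal E}_{(r,h,k),n}\star\exp\big(\textstyle\sum_{i\ge1}x_ip_i({\bf t})\big)$$ $$=(-1)^{hk}\prod_{i=1}^kw_i^{-r+1}\cdot\mathbb D_{(r,h,k),n}\cdot\exp\Big(\sum_{i\ge1}x_ip_i({\bf z})+\frac{p_i({\bf t})\,p_i({\bf w}^{-1})}{i}\Big)\exp\Big(\sum_{i\ge1}x_ip_i({\bf t})\Big).$$ On the left the $x_i$ are in $B_{r,n}$, on the right $x_i$ and $S_j$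 are in $B_{m,n}$. Here $\mathbb D_{(r,h,k),n}$ is the determinant of the $(r+h)\times(r+h)$ matrix whose row $a$, for $1\le a\le k$, is $$\big(0,\dots,0,\;1-y_{n-r+1}w_a^{-(n-r+1)},\;w_a(1-y_{n-r+2}w_a^{-(n-r+2)}),\;\dots,\;w_a^{r-1}(1-y_nw_a^{-n})\big)$$ ($h$ zeros; for $n=\infty$ the terms with $y$ are absent), and whose row $k+s$, for $1\le s\le m$, is $$\big(\mathbb S_{k-r+s-1}({\bf t}),\,\mathbb S_{k-r+s-2}({\bf t}),\dots,\mathbb S_{k-r+s-h}({\bf t}),\;\mathbb S_{k-h+s-1}({\bf z}),\,\mathbb S_{k-h+s-2}({\bf z}),\dots,\mathbb S_{k-h+s-r}({\bf z})\big).$$ In row $a$, $y_l=\sum_{j=0}^{r-1}U_{j,l}({\bf t})\,w_a^{-j}$ with $U_{j,l}({\bf t})=\sum_{i=0}^j(-1)^ie_i({\bf t})h_{l+j-i}({\bf t})$; and $\mathbb S_j({\bf v})=\sum_{i\ge0}(-1)^ie_i({\bf v})S_{j+i}$. The identities hold for power series in ${\bf z},{\bf w}^{-1},{\bf t}$ with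 coefficients in $B_{m,n}$, with the $w_i^{-1}$ inverted. -/

import Mathlib

namespace GrassmannFermions

open MvPolynomial Finset

noncomputable section

/-! ### The space `V_n` and its restricted dual -/

/-- The ideal of `ℚ[X]` spanned by the `X ^ i` with `n ≤ i`: it is `(X ^ n)` for finite `n`, and `0`
for `n = ∞`. -/
def truncIdeal (n : ℕ∞) : Ideal (Polynomial ℚ) :=
  Ideal.span {p | ∃ i : ℕ, n ≤ (i : ℕ∞) ∧ p = Polynomial.X ^ i}

/-- `V_n = ℚ[X] / (X ^ n)`, with `V_∞ = ℚ[X]`. -/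
abbrev V (n : ℕ∞) : Type := Polynomial ℚ ⧸ truncIdeal n

/-- The class of `X ^ i` in `V_n`. -/
def vec (n : ℕ∞) (i : ℕ) : V n := Ideal.Quotient.mk (truncIdeal n) (Polynomial.X ^ i)

theorem vec_eq_zero {n : ℕ∞} {i : ℕ} (h : n ≤ (i : ℕ∞)) : vec n i = 0 :=
  Ideal.Quotient.eq_zero_iff_mem.2 (Ideal.subset_span ⟨i, h, rfl⟩)

theorem coeff_eq_zero_of_mem {n : ℕ∞} {j : ℕ} (hj : (j : ℕ∞) < n) {p : Polynomial ℚ}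
    (hp : p ∈ truncIdeal n) : p.coeff j = 0 := by
  induction hp using Submodule.span_induction with
  | mem x hx =>
    obtain ⟨i, hi, rfl⟩ := hx
    have hlt : j < i := by exact_mod_cast lt_of_lt_of_le hj hi
    rw [Polynomial.coeff_X_pow, if_neg hlt.ne]
  | zero => simp
  | add x y _ _ hx hy => simp [hx, hy]
  | smul a x hx' _ =>
    have key : ∀ x ∈ truncIdeal n, ∀ l ≤ j, x.coeff l = 0 := by
      intro x hx
      induction hx using Submodule.span_induction with
      | mem x hx =>
        obtain ⟨i, hi, rfl⟩ := hx
        intro l hl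
        have hlt : j < i := by exact_mod_cast lt_of_lt_of_le hj hi
        rw [Polynomial.coeff_X_pow, if_neg (by omega)]
      | zero => simp
      | add x y _ _ hx hy => intro l hl; simp [hx l hl, hy l hl]
      | smul a x _ hx =>
        intro l hl
        rw [smul_eq_mul, Polynomial.coeff_mul]
        refine Finset.sum_eq_zero fun q hq => ?_
        rw [hx q.2 (by have := Finset.HasAntidiagonal.mem_antidiagonal.1 hq; omega), mul_zero]
    exact key _ (Ideal.mul_mem_left _ a hx') j le_rfl

open Classical in
/-- The linear form `∂ ^ j` of `V_n`, for `0 ≤ j < n`: the coefficient of `X ^ j`.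
(It is put equal to `0` for `j ≥ n`.) -/
def dual (n : ℕ∞) (j : ℕ) : Module.Dual ℚ (V n) :=
  if hj : (j : ℕ∞) < n then
    (Submodule.liftQ ((truncIdeal n).restrictScalars ℚ) (Polynomial.lcoeff ℚ j)
      (fun _ hp => coeff_eq_zero_of_mem hj hp)) ∘ₗ
      (Submodule.Quotient.restrictScalarsEquiv ℚ (truncIdeal n)).symm.toLinearMap
  else 0

/-- The exterior algebra of `V_n`. -/
abbrev Ext (n : ℕ∞) : Type := ExteriorAlgebra ℚ (V n)

/-! ### The ring `B_{r,n}` -/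

/-- `c_r(z) = 1 - c_1 z + ⋯ + (-1) ^ r c_r z ^ r`; the variable of index `i` is `c_{i+1}`. -/
def chern (r : ℕ) : PowerSeries (MvPolynomial (Fin r) ℚ) :=
  1 + ∑ i : Fin r, PowerSeries.monomial ((i : ℕ) + 1) ((-1) ^ ((i : ℕ) + 1) * X i)

/-- `S_j ∈ B_r = ℚ[c_1, …, c_r]`, the coefficient of `z ^ j` in `1 / c_r(z)`. -/
def segre (r : ℕ) (j : ℕ) : MvPolynomial (Fin r) ℚ :=
  PowerSeries.coeff j (PowerSeries.invOfUnit (chern r) 1)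

/-- The ideal `I_{r,n} = (S_{n-r+1}, …, S_n)` of `B_r`; it is `0` for `n = ∞`. -/
def grassIdeal (r : ℕ) (n : ℕ∞) : Ideal (MvPolynomial (Fin r) ℚ) :=
  Ideal.span {f | ∃ j : ℕ, (j : ℕ∞) ≤ n ∧ n < ((j + r : ℕ) : ℕ∞) ∧ f = segre r j}

/-- `B_{r,n} = B_r / I_{r,n}`, with `B_{r,∞} = B_r`. -/
abbrev B (r : ℕ) (n : ℕ∞) : Type := MvPolynomial (Fin r) ℚ ⧸ grassIdeal r n

/-- `S_j ∈ B_{r,n}` for `j ∈ ℤ`, with `S_j = 0` for `j < 0`. -/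
def S (r : ℕ) (n : ℕ∞) (j : ℤ) : B r n :=
  if j < 0 then 0 else Ideal.Quotient.mk (grassIdeal r n) (segre r j.toNat)

/-- The elements `x_i ∈ B_{r,n}`, defined by `∑_{i ≥ 1} x_i z ^ i = log (∑_{j ≥ 0} S_j z ^ j)`. -/
def x (r : ℕ) (n : ℕ∞) (i : ℕ) : B r n :=
  PowerSeries.coeff i (PowerSeries.logOf (PowerSeries.mk fun j : ℕ => S r n j))

/-! ### The isomorphism `B_{r,n} → ⋀ ^ r V_n`, `P ↦ P · X ^ r(0)` -/

/-- The linear map `ℚ[t_1, …, t_r] → ⋀ V_n`, `t ^ a ↦ X ^ {a_1} ∧ ⋯ ∧ X ^ {a_r}`. -/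
def wedgeMap (r : ℕ) (n : ℕ∞) : MvPolynomial (Fin r) ℚ →ₗ[ℚ] Ext n :=
  (MvPolynomial.basisMonomials (Fin r) ℚ).constr ℚ
    fun a => ExteriorAlgebra.ιMulti ℚ r fun i => vec n (a i)

/-- `t_1 ^ {r-1} t_2 ^ {r-2} ⋯ t_r ^ 0`, so that `wedgeMap` sends it to
`X ^ r(0) = X ^ {r-1} ∧ ⋯ ∧ X ^ 0`. -/
def staircase (r : ℕ) : MvPolynomial (Fin r) ℚ := ∏ i : Fin r, X i ^ (r - 1 - (i : ℕ))

/-- `c_i ↦ e_i(t_1, …, t_r)`. -/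
def toSymm (r : ℕ) : MvPolynomial (Fin r) ℚ →ₐ[ℚ] MvPolynomial (Fin r) ℚ :=
  aeval fun i : Fin r => esymm (Fin r) ℚ ((i : ℕ) + 1)

/-- `P ↦ P · X ^ r(0)` for `P ∈ B_r`.  Here `P ∈ B_r` acts on
`X ^ {a_1} ∧ ⋯ ∧ X ^ {a_r}` as the symmetric polynomial `P(e_1, …, e_r)` in the `r` operators
"multiply the `i`-th factor by `X`"; thus `c_i` acts as the coefficient of `(-z) ^ i` of
`v_1 ∧ ⋯ ∧ v_r ↦ (v_1 - X v_1 z) ∧ ⋯ ∧ (v_r - X v_r z)`, and the `i`-th power sum as the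
derivation extending the multiplication by `X ^ i`. -/
def preFermion (r : ℕ) (n : ℕ∞) : MvPolynomial (Fin r) ℚ →ₗ[ℚ] Ext n :=
  wedgeMap r n ∘ₗ LinearMap.mulRight ℚ (staircase r) ∘ₗ (toSymm r).toLinearMap

theorem wedgeMap_monomial (r : ℕ) (n : ℕ∞) (a : Fin r →₀ ℕ) (q : ℚ) :
    wedgeMap r n (monomial a q) = q • ExteriorAlgebra.ιMulti ℚ r fun i => vec n (a i) := by
  have h : (monomial a q : MvPolynomial (Fin r) ℚ)
      = q • MvPolynomial.basisMonomials (Fin r) ℚ a := by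
    simp [MvPolynomial.smul_monomial]
  rw [h, map_smul, wedgeMap, Module.Basis.constr_basis]

theorem wedgeMap_swap (r : ℕ) (n : ℕ∞) {i j : Fin r} (hij : i ≠ j) (f : MvPolynomial (Fin r) ℚ) :
    wedgeMap r n (rename (Equiv.swap i j) f) = - wedgeMap r n f := by
  induction f using MvPolynomial.induction_on' with
  | monomial a q =>
    rw [rename_monomial, wedgeMap_monomial, wedgeMap_monomial, ← smul_neg,
      ← AlternatingMap.map_swap _ _ hij]
    congr 2
    funext l
    have := Finsupp.mapDomain_apply (Equiv.swap i j).injective a (Equiv.swap i j l)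
    simp only [Equiv.swap_apply_self] at this
    simp [this]
  | add p q hp hq => rw [map_add, map_add, hp, hq, map_add, neg_add]

theorem wedgeMap_eq_zero_of_swap (r : ℕ) (n : ℕ∞) {i j : Fin r} (hij : i ≠ j)
    {f : MvPolynomial (Fin r) ℚ} (hf : rename (Equiv.swap i j) f = f) : wedgeMap r n f = 0 := by
  have h := wedgeMap_swap r n hij f
  rw [hf] at h
  have h2 : (2 : ℚ) • wedgeMap r n f = 0 := by
    rw [two_smul]
    exact eq_neg_iff_add_eq_zero.1 h
  exact (smul_eq_zero.1 h2).resolve_left (by norm_num)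

theorem wedgeMap_mul_X_pow (r : ℕ) {n : ℕ∞} {m : ℕ} (hm : n ≤ (m : ℕ∞)) (i : Fin r)
    (f : MvPolynomial (Fin r) ℚ) : wedgeMap r n (f * X i ^ m) = 0 := by
  induction f using MvPolynomial.induction_on' with
  | monomial a q =>
    rw [X_pow_eq_monomial, monomial_mul, wedgeMap_monomial]
    rw [AlternatingMap.map_coord_zero _ i, smul_zero]
    refine vec_eq_zero (hm.trans ?_)
    simp
  | add p q hp hq => rw [add_mul, map_add, hp, hq, add_zero]

/-- `∏_{l < i} (1 - t_l z)`. -/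
def partE (r i : ℕ) : PowerSeries (MvPolynomial (Fin r) ℚ) :=
  ∏ l ∈ Finset.univ.filter (fun l : Fin r => (l : ℕ) < i), (1 - PowerSeries.C (X l) * PowerSeries.X)

theorem constantCoeff_partE (r i : ℕ) : PowerSeries.constantCoeff (partE r i) = 1 := by
  simp [partE, map_prod]

/-- `1 / ∏_{l < i} (1 - t_l z)`. -/
def partH (r i : ℕ) : PowerSeries (MvPolynomial (Fin r) ℚ) := PowerSeries.invOfUnit (partE r i) 1

theorem partE_mul_partH (r i : ℕ) : partE r i * partH r i = 1 :=
  PowerSeries.mul_invOfUnit _ _ (by simp [constantCoeff_partE])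

theorem partE_succ (r : ℕ) (i : Fin r) :
    partE r (i + 1) = (1 - PowerSeries.C (X i) * PowerSeries.X) * partE r i := by
  have h : (Finset.univ.filter fun l : Fin r => (l : ℕ) < i + 1)
      = insert i (Finset.univ.filter fun l : Fin r => (l : ℕ) < i) := by
    ext l; simp [Fin.ext_iff]; omega
  rw [partE, h, Finset.prod_insert (by simp), partE]

theorem partH_succ (r : ℕ) (i : Fin r) :
    partH r i = (1 - PowerSeries.C (X i) * PowerSeries.X) * partH r (i + 1) := by
  have h1 := partE_mul_partH r i
  have h2 := partE_mul_partH r (i + 1)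
  rw [partE_succ] at h2
  calc partH r i = partH r i * ((1 - PowerSeries.C (X i) * PowerSeries.X) * partE r i
        * partH r (i + 1)) := by rw [h2, mul_one]
    _ = (partE r i * partH r i) * ((1 - PowerSeries.C (X i) * PowerSeries.X) * partH r (i + 1)) := by
        ring
    _ = _ := by rw [h1, one_mul]

theorem coeff_partH_succ (r : ℕ) (i : Fin r) (j : ℕ) :
    PowerSeries.coeff (j + 1) (partH r (i + 1))
      = PowerSeries.coeff (j + 1) (partH r i)
        + X i * PowerSeries.coeff j (partH r (i + 1)) := by
  rw [partH_succ r i, sub_mul, one_mul, map_sub, mul_assoc, PowerSeries.coeff_C_mul,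
    PowerSeries.coeff_succ_X_mul]
  ring

theorem coeff_partH_one (r : ℕ) (hr : 0 < r) (j : ℕ) :
    PowerSeries.coeff j (partH r 1) = X (⟨0, hr⟩ : Fin r) ^ j := by
  have h0 : partH r 0 = 1 := by
    have := partE_mul_partH r 0
    simpa [partE] using this
  induction j with
  | zero =>
    have := congrArg (PowerSeries.coeff 0) (partH_succ r ⟨0, hr⟩)
    simp only [h0, sub_mul, one_mul, map_sub, mul_assoc, PowerSeries.coeff_C_mul] at this
    simpa using this.symm
  | succ j ih =>
    have := coeff_partH_succ r ⟨0, hr⟩ j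
    simp only [h0, zero_add] at this
    rw [this, ih, PowerSeries.coeff_one, if_neg (by omega), zero_add, pow_succ, mul_comm]

theorem rename_partH (r i : ℕ) (σ : Equiv.Perm (Fin r))
    (hσ : ∀ l : Fin r, (l : ℕ) < i ↔ ((σ l : Fin r) : ℕ) < i) (j : ℕ) :
    rename σ (PowerSeries.coeff j (partH r i)) = PowerSeries.coeff j (partH r i) := by
  set ρ : MvPolynomial (Fin r) ℚ →+* MvPolynomial (Fin r) ℚ := (rename σ : _ →ₐ[ℚ] _).toRingHom
    with hρ
  have hE : PowerSeries.map ρ (partE r i) = partE r i := by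
    rw [partE, map_prod]
    refine Finset.prod_equiv σ (by simpa using hσ) fun l _ => ?_
    simp [hρ]
  have hH : PowerSeries.map ρ (partH r i) = partH r i := by
    have h := congrArg (PowerSeries.map ρ) (partE_mul_partH r i)
    rw [map_mul, hE, map_one] at h
    calc PowerSeries.map ρ (partH r i)
        = (partE r i * partH r i) * PowerSeries.map ρ (partH r i) := by
          rw [partE_mul_partH, one_mul]
      _ = partH r i * (partE r i * PowerSeries.map ρ (partH r i)) := by ring
      _ = _ := by rw [h, mul_one]
  have := congrArg (PowerSeries.coeff j) hH
  rw [PowerSeries.coeff_map] at this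
  exact this

theorem wedgeMap_step (r : ℕ) (n : ℕ∞) {s : MvPolynomial (Fin r) ℚ} (hs : s.IsSymmetric)
    (i : ℕ) (hi : i + 1 < r) (j : ℕ) :
    wedgeMap r n (s * PowerSeries.coeff j (partH r (i + 2)) * staircase r)
      = wedgeMap r n (s * PowerSeries.coeff j (partH r (i + 1)) * staircase r) := by
  cases j with
  | zero =>
    have h : ∀ i, PowerSeries.coeff 0 (partH r i) = 1 := by
      intro i
      rw [PowerSeries.coeff_zero_eq_constantCoeff_apply, partH,
        PowerSeries.constantCoeff_invOfUnit]
      simp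
    rw [h, h]
  | succ j =>
    have h := coeff_partH_succ r ⟨i + 1, hi⟩ j
    simp only [add_assoc, Nat.reduceAdd] at h
    rw [h, mul_add, add_mul, map_add, add_eq_left]
    have hne : (⟨i, by omega⟩ : Fin r) ≠ ⟨i + 1, hi⟩ := by simp [Fin.ext_iff]
    refine wedgeMap_eq_zero_of_swap r n hne ?_
    set a : Fin r := ⟨i, by omega⟩ with ha
    set b : Fin r := ⟨i + 1, hi⟩ with hb
    have hH := rename_partH r (i + 2) (Equiv.swap a b) (by
      intro l
      rcases eq_or_ne l a with rfl | hla
      · simp [ha, hb]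
      · rcases eq_or_ne l b with rfl | hlb
        · simp [ha, hb]
        · rw [Equiv.swap_apply_of_ne_of_ne hla hlb]) j
    have hst : staircase r = X a ^ (r - 1 - i) * X b ^ (r - 2 - i)
        * ∏ l ∈ (Finset.univ.erase a).erase b, X l ^ (r - 1 - (l : ℕ)) := by
      rw [staircase, ← Finset.mul_prod_erase _ _ (Finset.mem_univ a),
        ← Finset.mul_prod_erase _ _ (Finset.mem_erase.2 ⟨hne.symm, Finset.mem_univ b⟩), ← mul_assoc]
      rw [show r - 1 - (b : ℕ) = r - 2 - i by simp only [hb]; omega]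
    have hrest : rename (Equiv.swap a b)
        (∏ l ∈ (Finset.univ.erase a).erase b, (X l : MvPolynomial (Fin r) ℚ) ^ (r - 1 - (l : ℕ)))
        = ∏ l ∈ (Finset.univ.erase a).erase b, X l ^ (r - 1 - (l : ℕ)) := by
      rw [map_prod]
      refine Finset.prod_congr rfl fun l hl => ?_
      simp only [Finset.mem_erase] at hl
      rw [map_pow, rename_X, Equiv.swap_apply_of_ne_of_ne hl.2.1 hl.1]
    rw [hst]
    simp only [map_mul, map_pow, rename_X, Equiv.swap_apply_left, Equiv.swap_apply_right, hs _, hH,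
      hrest]
    have : r - 1 - i = (r - 2 - i) + 1 := by omega
    rw [this, pow_succ, pow_succ]
    ring

theorem wedgeMap_complete (r : ℕ) (n : ℕ∞) {s : MvPolynomial (Fin r) ℚ} (hs : s.IsSymmetric)
    {j : ℕ} (h1 : (j : ℕ∞) ≤ n) (h2 : n < ((j + r : ℕ) : ℕ∞)) :
    wedgeMap r n (s * PowerSeries.coeff j (partH r r) * staircase r) = 0 := by
  have hr : 0 < r := by
    rcases Nat.eq_zero_or_pos r with rfl | h
    · exact absurd (lt_of_le_of_lt h1 h2) (by simp)
    · exact h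
  have key : ∀ i, i < r → wedgeMap r n (s * PowerSeries.coeff j (partH r (i + 1)) * staircase r)
      = 0 := by
    intro i
    induction i with
    | zero =>
      intro _
      have hst : staircase r = (∏ l ∈ Finset.univ.erase (⟨0, hr⟩ : Fin r), X l ^ (r - 1 - (l : ℕ)))
          * X (⟨0, hr⟩ : Fin r) ^ (r - 1) := by
        rw [staircase, ← Finset.prod_erase_mul _ _ (Finset.mem_univ (⟨0, hr⟩ : Fin r))]
        simp
      rw [zero_add, coeff_partH_one r hr, hst]
      have := wedgeMap_mul_X_pow r (n := n) (m := j + (r - 1))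
        (by
          have : n < ((j + (r - 1) : ℕ) : ℕ∞) + 1 := by
            refine lt_of_lt_of_eq h2 ?_
            norm_cast
            omega
          exact Order.le_of_lt_add_one this) ⟨0, hr⟩
        (s * ∏ l ∈ Finset.univ.erase (⟨0, hr⟩ : Fin r), X l ^ (r - 1 - (l : ℕ)))
      rw [← this]
      congr 1
      rw [pow_add]
      ring
    | succ i ih =>
      intro hi
      rw [wedgeMap_step r n hs i hi j]
      exact ih (by omega)
  have := key (r - 1) (by omega)
  rwa [Nat.sub_add_cancel hr] at this

theorem map_chern (r : ℕ) : PowerSeries.map (toSymm r).toRingHom (chern r) = partE r r := by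
  have h : partE r r = ∏ l : Fin r, (1 + (-(PowerSeries.C (X l) * PowerSeries.X))) := by
    rw [partE, Finset.filter_true_of_mem (fun l _ => l.2)]
    simp [sub_eq_add_neg]
  rw [h, Finset.prod_one_add, Finset.sum_powerset]
  rw [Finset.card_univ, Fintype.card_fin, Finset.sum_range_succ', chern, map_add, map_one, map_sum,
    add_comm, Finset.sum_range]
  congr 1
  · refine Finset.sum_congr rfl fun i _ => ?_
    rw [PowerSeries.monomial_eq_C_mul_X_pow, map_mul, PowerSeries.map_C, map_pow, PowerSeries.map_X,
      ← PowerSeries.monomial_eq_C_mul_X_pow]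
    have : ∀ t ∈ powersetCard ((i : ℕ) + 1) (Finset.univ : Finset (Fin r)),
        ∏ l ∈ t, (-(PowerSeries.C (X l : MvPolynomial (Fin r) ℚ) * PowerSeries.X))
        = PowerSeries.monomial ((i : ℕ) + 1) ((-1) ^ ((i : ℕ) + 1) * ∏ l ∈ t, X l) := by
      intro t ht
      have hc := (Finset.mem_powersetCard.1 ht).2
      rw [Finset.prod_neg, Finset.prod_mul_distrib, Finset.prod_const, hc,
        PowerSeries.monomial_eq_C_mul_X_pow, map_mul, map_prod, map_pow, map_neg, map_one, mul_assoc]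
    rw [Finset.sum_congr rfl this, ← map_sum, ← Finset.mul_sum]
    congr 1
    simp [toSymm, esymm]
  · simp

theorem toSymm_segre (r j : ℕ) : toSymm r (segre r j) = PowerSeries.coeff j (partH r r) := by
  have hc : PowerSeries.constantCoeff (chern r) = ((1 : (MvPolynomial (Fin r) ℚ)ˣ) : _) := by
    rw [chern, map_add, map_one, map_sum, Units.val_one, add_eq_left]
    refine Finset.sum_eq_zero fun i _ => ?_
    rw [← PowerSeries.coeff_zero_eq_constantCoeff_apply, PowerSeries.coeff_monomial, if_neg (by omega)]
  have h := congrArg (PowerSeries.map (toSymm r).toRingHom)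
    (PowerSeries.mul_invOfUnit (chern r) 1 hc)
  rw [map_mul, map_chern, map_one] at h
  have hH : PowerSeries.map (toSymm r).toRingHom (PowerSeries.invOfUnit (chern r) 1)
      = partH r r := by
    calc _ = (partE r r * partH r r) * PowerSeries.map (toSymm r).toRingHom
          (PowerSeries.invOfUnit (chern r) 1) := by rw [partE_mul_partH, one_mul]
      _ = partH r r * (partE r r * PowerSeries.map (toSymm r).toRingHom
          (PowerSeries.invOfUnit (chern r) 1)) := by ring
      _ = _ := by rw [h, mul_one]
  have := congrArg (PowerSeries.coeff j) hH
  rw [PowerSeries.coeff_map] at this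
  exact this

theorem toSymm_isSymmetric (r : ℕ) (f : MvPolynomial (Fin r) ℚ) : (toSymm r f).IsSymmetric := by
  induction f using MvPolynomial.induction_on with
  | C a => simp [toSymm]
  | add p q hp hq => rw [map_add]; exact hp.add hq
  | mul_X p i hp =>
    rw [map_mul]
    refine hp.mul ?_
    simpa [toSymm] using esymm_isSymmetric (Fin r) ℚ _

theorem preFermion_eq_zero (r : ℕ) (n : ℕ∞) {f : MvPolynomial (Fin r) ℚ}
    (hf : f ∈ grassIdeal r n) : preFermion r n f = 0 := by
  refine Submodule.span_induction (p := fun f _ => ∀ g, preFermion r n (g * f) = 0)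
    ?_ ?_ ?_ ?_ hf 1 |> fun h => by simpa using h
  · rintro f ⟨j, h1, h2, rfl⟩ g
    have := wedgeMap_complete r n (toSymm_isSymmetric r g) h1 h2
    simpa [preFermion, toSymm_segre] using this
  · simp
  · intro f f' _ _ h h' g
    rw [mul_add, map_add, h, h', add_zero]
  · intro a f _ h g
    rw [smul_eq_mul, ← mul_assoc]
    exact h _

/-- The linear map `B_{r,n} → ⋀ V_n`, `P ↦ P · X ^ r(0)`. -/
def fermion (r : ℕ) (n : ℕ∞) : B r n →ₗ[ℚ] Ext n :=
  (Submodule.liftQ ((grassIdeal r n).restrictScalars ℚ) (preFermion r n)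
      (fun _ hf => preFermion_eq_zero r n hf)) ∘ₗ
    (Submodule.Quotient.restrictScalarsEquiv ℚ (grassIdeal r n)).symm.toLinearMap

/-! ### Schur polynomials -/

/-- The Vandermonde product `∏_{i < j} (t_i - t_j)`. -/
def vander (p : ℕ) : MvPolynomial (Fin p) ℚ :=
  ∏ i : Fin p, ∏ j ∈ Finset.Ioi i, (X i - X j)

/-- The alternant `det (t_i ^ {p - j + λ_j})` (`1 ≤ i, j ≤ p`), with indices shifted to start
from `0`. -/
def alternant (p : ℕ) (lam : Fin p → ℕ) : MvPolynomial (Fin p) ℚ :=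
  (Matrix.of fun i j : Fin p => (X i : MvPolynomial (Fin p) ℚ) ^ (p - 1 - (j : ℕ) + lam j)).det

theorem vander_dvd_alternant (p : ℕ) (lam : Fin p → ℕ) : vander p ∣ alternant p lam := by
  set q : Polynomial (MvPolynomial (Fin p) ℚ) :=
    ∏ i : Fin p, (Polynomial.X - Polynomial.C (X i)) with hq
  have hqm : q.Monic := Polynomial.monic_prod_of_monic _ _ fun i _ => Polynomial.monic_X_sub_C _
  have hdeg : q.natDegree = p := by
    rw [hq, Polynomial.natDegree_prod_of_monic _ _ fun i _ => Polynomial.monic_X_sub_C _]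
    simp
  have hroot : ∀ i : Fin p, q.eval (X i) = 0 := by
    intro i
    rw [hq, Polynomial.eval_prod]
    exact Finset.prod_eq_zero (Finset.mem_univ i) (by simp)
  have hfac : (Matrix.of fun i j : Fin p =>
        (X i : MvPolynomial (Fin p) ℚ) ^ (p - 1 - (j : ℕ) + lam j))
      = Matrix.vandermonde (fun i : Fin p => (X i : MvPolynomial (Fin p) ℚ))
        * Matrix.of fun b j : Fin p =>
          ((Polynomial.X ^ (p - 1 - (j : ℕ) + lam j)) %ₘ q).coeff b := by
    ext1 i j
    rw [Matrix.mul_apply]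
    simp only [Matrix.of_apply, Matrix.vandermonde_apply]
    set f : Polynomial (MvPolynomial (Fin p) ℚ) := Polynomial.X ^ (p - 1 - (j : ℕ) + lam j)
    have h1 : (f %ₘ q).eval (X i) = f.eval (X i) := by
      conv_rhs => rw [← Polynomial.modByMonic_add_div f q]
      simp [hroot]
    have hp : 0 < p := Fin.pos i
    have h2 : (f %ₘ q).natDegree < p := by
      have := Polynomial.natDegree_modByMonic_lt f hqm (by
        intro h; rw [h, Polynomial.natDegree_one] at hdeg; omega)
      omega
    rw [Polynomial.eval_eq_sum_range' h2, Finset.sum_range] at h1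
    rw [show (X i : MvPolynomial (Fin p) ℚ) ^ (p - 1 - (j : ℕ) + lam j) = f.eval (X i) by simp [f],
      ← h1]
    exact Finset.sum_congr rfl fun b _ => mul_comm _ _
  rw [alternant, hfac, Matrix.det_mul, Matrix.det_vandermonde]
  refine Dvd.dvd.mul_right ?_ _
  refine Finset.prod_dvd_prod_of_dvd _ _ fun i _ => Finset.prod_dvd_prod_of_dvd _ _ fun j _ => ?_
  rw [← neg_dvd, neg_sub]

/-- The Schur polynomial `s_λ(t_1, …, t_p)`, the polynomial with
`vander p * schur p λ = alternant p λ`. -/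
def schur (p : ℕ) (lam : Fin p → ℕ) : MvPolynomial (Fin p) ℚ :=
  Classical.choose (vander_dvd_alternant p lam)

theorem vander_mul_schur (p : ℕ) (lam : Fin p → ℕ) : vander p * schur p lam = alternant p lam :=
  (Classical.choose_spec (vander_dvd_alternant p lam)).symm

/-- The set `𝒫_{p,n}` of the partitions `n - p ≥ λ_1 ≥ ⋯ ≥ λ_p ≥ 0`. -/
def Part (p : ℕ) (n : ℕ∞) : Type :=
  {lam : Fin p → ℕ // Antitone lam ∧ ∀ i, ((lam i + p : ℕ) : ℕ∞) ≤ n}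

/-! ### The action of the Clifford algebra -/

/-- `X ^ h(λ) = X ^ {h - 1 + λ_1} ∧ ⋯ ∧ X ^ {λ_h}`. -/
def wedgeVec (h : ℕ) (n : ℕ∞) (lam : Fin h → ℕ) : Ext n :=
  ExteriorAlgebra.ιMulti ℚ h fun j => vec n (h - 1 - (j : ℕ) + lam j)

/-- `∂ ^ {j_1} ⌟ (∂ ^ {j_2} ⌟ ⋯ (∂ ^ {j_k} ⌟ u))`, the action of the word
`∂ ^ {j_1} ∂ ^ {j_2} ⋯ ∂ ^ {j_k}` of the Clifford algebra. -/
def contract (n : ℕ∞) (js : List ℕ) (u : Ext n) : Ext n :=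
  js.foldr
    (fun j v => CliffordAlgebra.contractLeft (Q := (0 : QuadraticForm ℚ (V n))) (dual n j) v) u

/-- The map `⋀ V_n → B_{m,n}` inverse to the bijection `B_{m,n} → ⋀ ^ m V_n`, `P ↦ P · X ^ m(0)`. -/
def boson (m : ℕ) (n : ℕ∞) : Ext n → B m n := Function.invFun (fermion m n)

/-- The map `B_{r,n} → B_{r+h-k,n}` induced by the word `X ^ h(λ) ∂ ^ k(μ)`,
`∂ ^ k(μ) = ∂ ^ {k - 1 + μ_1} ⋯ ∂ ^ {μ_k}`. -/
def wordAct (r h k : ℕ) (n : ℕ∞) (lam : Fin h → ℕ) (mu : Fin k → ℕ) (P : B r n) :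
    B (r + h - k) n :=
  boson (r + h - k) n (wedgeVec h n lam *
    contract n (List.ofFn fun j : Fin k => k - 1 - (j : ℕ) + mu j) (fermion r n P))

/-- The map `B_{r,n} → B_{r+h-k,n}` induced by
`u ↦ X ^ h(λ) ∧ (∂ ^ {j_k} ⌟ (⋯ (∂ ^ {j_1} ⌟ u)))`. -/
def contractAct (r h k : ℕ) (n : ℕ∞) (lam : Fin h → ℕ) (js : Fin k → ℕ) (P : B r n) :
    B (r + h - k) n :=
  boson (r + h - k) n (wedgeVec h n lam * contract n (List.ofFn js).reverse (fermion r n P))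

/-! ### Generating series -/

/-- The indeterminates `z_1, …, z_h`, `w_1⁻¹, …, w_k⁻¹`, `t_1, …, t_r`. -/
abbrev Vars (h k r : ℕ) : Type := Fin h ⊕ (Fin k ⊕ Fin r)

/-- The exponents of the `z_i` in a monomial. -/
def zExp {h k r : ℕ} (d : Vars h k r →₀ ℕ) : Fin h →₀ ℕ :=
  d.comapDomain Sum.inl Sum.inl_injective.injOn

/-- The exponents of the `w_i⁻¹` in a monomial. -/
def uExp {h k r : ℕ} (d : Vars h k r →₀ ℕ) : Fin k →₀ ℕ :=
  d.comapDomain (Sum.inr ∘ Sum.inl) (Sum.inr_injective.comp Sum.inl_injective).injOn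

/-- The exponents of the `t_i` in a monomial. -/
def tExp {h k r : ℕ} (d : Vars h k r →₀ ℕ) : Fin r →₀ ℕ :=
  d.comapDomain (Sum.inr ∘ Sum.inr) (Sum.inr_injective.comp Sum.inr_injective).injOn

/-- `ℰ_{(r,h,k),n}(z, w⁻¹) ⋆ F` for a series `F` in `t_1, …, t_r` with coefficients in `B_{r,n}`,
where `ℰ_{(r,h,k),n} = ∑_{λ,μ} X ^ h(λ) ∂ ^ k(μ) s_λ(z) s_μ(w⁻¹)`, the sum over
`𝒫_{h,n} × 𝒫_{k,n}`.  Only finitely many `(λ, μ)` contribute to a given coefficient. -/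
def cliffordStar (r h k : ℕ) (n : ℕ∞) (F : MvPowerSeries (Fin r) (B r n)) :
    MvPowerSeries (Vars h k r) (B (r + h - k) n) :=
  fun d => ∑ᶠ q : Part h n × Part k n,
    ((schur h q.1.1).coeff (zExp d) * (schur k q.2.1).coeff (uExp d)) •
      wordAct r h k n q.1.1 q.2.1 (MvPowerSeries.coeff (tExp d) F)

/-- The same for `∑_λ X ^ h(λ) s_λ(z) ∧ (∂(w_k⁻¹) ⌟ (⋯ ⌟ (∂(w_1⁻¹) ⌟ ·)))`, where
`∂(w⁻¹) = ∑_j ∂ ^ j w ^ {-j}`. -/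
def contractStar (r h k : ℕ) (n : ℕ∞) (F : MvPowerSeries (Fin r) (B r n)) :
    MvPowerSeries (Vars h k r) (B (r + h - k) n) :=
  fun d => ∑ᶠ lam : Part h n,
    (schur h lam.1).coeff (zExp d) •
      contractAct r h k n lam.1 (uExp d) (MvPowerSeries.coeff (tExp d) F)

/-- The sum of a family of formal power series such that each monomial occurs in finitely many
members of the family. -/
def formalSum {σ R : Type} [CommRing R] (f : ℕ → MvPowerSeries σ R) : MvPowerSeries σ R :=
  fun d => ∑ᶠ i, MvPowerSeries.coeff d (f i)

/-- `exp g`, for a formal power series `g` without constant term. -/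
def formalExp {σ R : Type} [CommRing R] [Algebra ℚ R] (g : MvPowerSeries σ R) :
    MvPowerSeries σ R :=
  (PowerSeries.exp ℚ).subst g

/-- The power sum `p_i(v_1, …, v_p)`. -/
def pow {A : Type} [CommRing A] [Algebra ℚ A] {p : ℕ} (v : Fin p → A) (i : ℕ) : A :=
  aeval v (psum (Fin p) ℚ i)

/-- The elementary symmetric polynomial `e_i(v_1, …, v_p)`. -/
def elem {A : Type} [CommRing A] [Algebra ℚ A] {p : ℕ} (v : Fin p → A) (i : ℕ) : A :=
  aeval v (esymm (Fin p) ℚ i)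

/-- The complete symmetric polynomial `h_i(v_1, …, v_p)`. -/
def compl {A : Type} [CommRing A] [Algebra ℚ A] {p : ℕ} (v : Fin p → A) (i : ℕ) : A :=
  aeval v (hsymm (Fin p) ℚ i)

/-- `U_{j,m}(v)`, the coefficient of `ζ ^ j` in
`(∑_a (-1) ^ a e_a(v) ζ ^ a) * ∑_{i ≥ 0} h_{m+i}(v) ζ ^ i`. -/
def U {A : Type} [CommRing A] [Algebra ℚ A] {p : ℕ} (v : Fin p → A) (j m : ℕ) : A :=
  ∑ a ∈ Finset.range (j + 1), (-1) ^ a * elem v a * compl v (m + (j - a))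

/-- `y_m = U_{0,m}(v) + U_{1,m}(v) ζ + ⋯ + U_{p-1,m}(v) ζ ^ {p-1}`. -/
def y {A : Type} [CommRing A] [Algebra ℚ A] {p : ℕ} (v : Fin p → A) (m : ℕ) (ζ : A) : A :=
  ∑ j ∈ Finset.range p, U v j m * ζ ^ j

/-- `exp (∑_{i ≥ 1} x_i p_i(v))`, the `x_i` in `B_{m,n}`. -/
def expX {σ : Type} (m : ℕ) (n : ℕ∞) {p : ℕ} (v : Fin p → MvPowerSeries σ (B m n)) :
    MvPowerSeries σ (B m n) :=
  formalExp (formalSum fun i => MvPowerSeries.C (x m n (i + 1)) * pow v (i + 1))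

/-- The twisted combination `𝕊_j(v) = ∑_a (-1) ^ a e_a(v) S_{j+a}`, the coefficient of `ζ ^ j` in
`∏_i (1 - v_i ζ⁻¹) * ∑_{i ≥ 0} S_i ζ ^ i`. -/
def twisted {σ : Type} (m : ℕ) (n : ℕ∞) {p : ℕ} (v : Fin p → MvPowerSeries σ (B m n)) (j : ℤ) :
    MvPowerSeries σ (B m n) :=
  ∑ a ∈ Finset.range (p + 1), (-1) ^ a * elem v a * MvPowerSeries.C (S m n (j + a))

/-! ### The right-hand side -/

/-- Power series in `z_i`, `w_i⁻¹`, `t_i` with coefficients in `B_{r+h-k,n}`. -/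
abbrev Ser (r h k : ℕ) (n : ℕ∞) : Type := MvPowerSeries (Vars h k r) (B (r + h - k) n)

/-- The indeterminates `z_i`. -/
def zv (r h k : ℕ) (n : ℕ∞) (i : Fin h) : Ser r h k n := MvPowerSeries.X (Sum.inl i)

/-- The indeterminates `w_i⁻¹`. -/
def uv (r h k : ℕ) (n : ℕ∞) (i : Fin k) : Ser r h k n := MvPowerSeries.X (Sum.inr (Sum.inl i))

/-- The indeterminates `t_i`. -/
def tv (r h k : ℕ) (n : ℕ∞) (i : Fin r) : Ser r h k n := MvPowerSeries.X (Sum.inr (Sum.inr i))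

/-- The power series ring with the `w_i⁻¹` inverted. -/
abbrev Laur (r h k : ℕ) (n : ℕ∞) : Type := Localization.Away (∏ i, uv r h k n i)

/-- The inclusion of the power series. -/
def emb (r h k : ℕ) (n : ℕ∞) : Ser r h k n →+* Laur r h k n := algebraMap _ _

theorem isUnit_emb_uv (r h k : ℕ) (n : ℕ∞) (i : Fin k) : IsUnit (emb r h k n (uv r h k n i)) :=
  isUnit_of_dvd_unit (map_dvd _ (Finset.dvd_prod_of_mem _ (Finset.mem_univ i)))
    (IsLocalization.Away.algebraMap_isUnit (∏ i, uv r h k n i))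

/-- `w_i`, the inverse of the indeterminate `w_i⁻¹`. -/
def wv (r h k : ℕ) (n : ℕ∞) (i : Fin k) : (Laur r h k n)ˣ := (isUnit_emb_uv r h k n i).unit⁻¹

/-- `1 - y_{n-r+1+j} w_i ^ {-(n-r+1+j)}`, where `y` is taken at `ζ = w_i⁻¹`; it is `1` for
`n = ∞`. -/
def yEntry (r h k : ℕ) (n : ℕ∞) (i : Fin k) (j : ℕ) : Ser r h k n :=
  match n with
  | ⊤ => 1
  | (N : ℕ) => 1 - y (tv r h k N) (N - r + 1 + j) (uv r h k N i) * uv r h k N i ^ (N - r + 1 + j)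

/-- The matrix of `𝔻_{(r,h,k),n}`, with rows and columns numbered from `0`. -/
def DMatrix (r h k : ℕ) (n : ℕ∞) : Matrix (Fin (r + h)) (Fin (r + h)) (Laur r h k n) :=
  Matrix.of fun a b =>
    if ha : (a : ℕ) < k then
      if (b : ℕ) < h then 0
      else ((wv r h k n ⟨a, ha⟩ : Laur r h k n)) ^ ((b : ℕ) - h) *
        emb r h k n (yEntry r h k n ⟨a, ha⟩ ((b : ℕ) - h))
    else
      if (b : ℕ) < h then
        emb r h k n (twisted (r + h - k) n (tv r h k n)
          ((k : ℤ) - r + ((a : ℤ) - k) - b))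
      else
        emb r h k n (twisted (r + h - k) n (zv r h k n)
          ((k : ℤ) - h + ((a : ℤ) - k) - ((b : ℤ) - h)))

/-- `exp (∑_{i ≥ 1} (x_i p_i(z) + p_i(t) p_i(w⁻¹) / i))`. -/
def expZW (r h k : ℕ) (n : ℕ∞) : Ser r h k n :=
  formalExp (formalSum fun i =>
    MvPowerSeries.C (x (r + h - k) n (i + 1)) * pow (zv r h k n) (i + 1)
      + (1 / ((i : ℚ) + 1)) • (pow (tv r h k n) (i + 1) * pow (uv r h k n) (i + 1)))

/-- `(-1) ^ {hk} ∏ w_i ^ {-r+1} 𝔻 exp (∑ (x_i p_i(z) + p_i(t) p_i(w⁻¹) / i)) exp (∑ x_i p_i(t))`. -/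
def mainRHS (r h k : ℕ) (n : ℕ∞) : Laur r h k n :=
  (-1) ^ (h * k) * (∏ i, ((wv r h k n i ^ (1 - (r : ℤ)) : (Laur r h k n)ˣ) : Laur r h k n)) *
    (DMatrix r h k n).det * emb r h k n (expZW r h k n) *
    emb r h k n (expX (r + h - k) n (tv r h k n))

/-- `exp (∑_{i ≥ 1} x_i p_i(t_1, …, t_r))`, with coefficients in `B_{r,n}`. -/
def schubertSeries (r : ℕ) (n : ℕ∞) : MvPowerSeries (Fin r) (B r n) :=
  expX r n fun i => MvPowerSeries.X i

end

end GrassmannFermions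

/-! Everything rests on the Jacobi–Trudi determinants J_a = det (S_{a_j - (r-1-i)}), defined for an
arbitrary sequence of exponents a. Multiplying J_a by the Vandermonde product gives det (t_i ^
{a_j}), so P ↦ P · X^r(0) sends J_a to X^{a_1} ∧ ⋯ ∧ X^{a_r} (`preFermion_jacobiTrudi`); hence
surjectivity. Conversely X^{a_1} ∧ ⋯ ∧ X^{a_r} ↦ J_a is well defined on ⋀ V_n, because a determinant
is alternating and S_j = 0 in B_{r,n} for j > n - r; it is a left inverse (`bosonHom_fermion`).

For the identities, multiply by the Vandermonde products in z and in t, which are not zero divisors.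
Schur polynomials become alternants, and the sum over λ collapses: the coefficient of z^a is the
action of X^{a_1} ∧ ⋯ ∧ X^{a_h}. Likewise exp (∑ x_i p_i(t)) = ∏ S(t_j), where S(z) = ∑ S_j z^j,
becomes the generating series of the J_b. So the coefficient of z^a w^{-j} t^b is a word applied to
X^{b_1} ∧ ⋯ ∧ X^{b_r}. By expansion along the rows of the contractions it is (-1)^{hk} times a
determinant with blocks 0, ⟨∂^{j_i}, X^{b_l}⟩, S, S (`preFermion_det_contractMatrix`). Since each
variable lives in a single row or a single column, these numbers are the coefficients of one
determinant of series, with blocks 0, ∑_{l<n} (t_j w_a^{-1})^l, z_j^{m-1-i} S(z_j), t_j^{m-1-i}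
S(t_j) (`coeff_det_seriesBlock`).

It remains to compare that determinant with 𝔻. Adjoin roots τ_s with S(z) = ∏ 1/(1 - τ_s z) and
multiply by the matrices of coefficients of the polynomials ∏_{j≠i} (X - v_j), for v = τ, z, t: up
to diagonal factors the lower blocks of both matrices become Cauchy matrices 1/(1 - τ_s z_i), 1/(1 -
τ_s t_i) (`block_identity`), while the y_l are made so that the upper rows become truncated
geometric series. After cancelling the Vandermonde product of τ, the identity descends from ℚ[τ] to
B_m, since c_i ↦ e_i(τ) is injective, and passes to B_{m,n}. The sum over μ collapses like the sum
over λ, by the antisymmetry of the contractions; this gives the first equality. -/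

namespace GrassmannFermions
open MvPolynomial Finset
noncomputable section

/-! ### Exponential and logarithm of formal power series -/

section ExpLog

theorem hasSubst_of_constantCoeff {σ R : Type} [CommRing R] {a : MvPowerSeries σ R}
    (ha : MvPowerSeries.constantCoeff a = 0) : PowerSeries.HasSubst a := PowerSeries.HasSubst.of_constantCoeff_zero ha

variable {σ R : Type} [CommRing R] [Algebra ℚ R]

/-- The universal case of exp (a + b) = exp a · exp b: at X^i Y^j the claim is binom(i+j, i) /
(i+j)! = 1 / (i! j!). The general case follows by substituting a and b. -/
theorem exp_subst_X_add_X :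
    (PowerSeries.exp ℚ).subst (MvPowerSeries.X 0 + MvPowerSeries.X 1 : MvPowerSeries (Fin 2) ℚ)
      = (PowerSeries.exp ℚ).subst (MvPowerSeries.X 0 : MvPowerSeries (Fin 2) ℚ)
        * (PowerSeries.exp ℚ).subst (MvPowerSeries.X 1 : MvPowerSeries (Fin 2) ℚ) := by
  ext e
  rw [PowerSeries.coeff_subst_X_zero_add_X_one, PowerSeries.coeff_subst_X_zero_subst_mul_X_one]
  simp only [PowerSeries.coeff_exp, Algebra.algebraMap_self, RingHom.id_apply]
  rw [Nat.choose_symm_add, Nat.add_choose, Nat.cast_div (Nat.factorial_mul_factorial_dvd_factorial_add _ _)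
    (by positivity)]
  push_cast
  have h1 : ((e 0 + e 1).factorial : ℚ) ≠ 0 := by positivity
  field_simp

theorem formalExp_add {a b : MvPowerSeries σ R} (ha : MvPowerSeries.constantCoeff a = 0)
    (hb : MvPowerSeries.constantCoeff b = 0) :
    formalExp (a + b) = formalExp a * formalExp b := by
  have hs : MvPowerSeries.HasSubst (![a, b] : Fin 2 → MvPowerSeries σ R) :=
    MvPowerSeries.hasSubst_of_constantCoeff_zero (by
      intro i; fin_cases i
      · exact ha
      · exact hb)
  have key : ∀ c : MvPowerSeries (Fin 2) ℚ, MvPowerSeries.constantCoeff c = 0 →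
      MvPowerSeries.subst ![a, b] ((PowerSeries.exp ℚ).subst c)
        = formalExp (MvPowerSeries.subst ![a, b] c) := by
    intro c hc
    have := MvPowerSeries.subst_comp_subst_apply
      (hasSubst_of_constantCoeff hc).const hs (PowerSeries.exp ℚ)
    exact this
  have h := congrArg (MvPowerSeries.subst ![a, b]) exp_subst_X_add_X
  rw [MvPowerSeries.subst_mul hs, key _ (by simp), key _ (by simp), key _ (by simp),
    MvPowerSeries.subst_add hs, MvPowerSeries.subst_X hs, MvPowerSeries.subst_X hs] at h
  simpa using h

theorem formalExp_zero : formalExp (0 : MvPowerSeries σ R) = 1 := by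
  rw [formalExp, PowerSeries.subst_zero_eq_C_constantCoeff]
  simp

theorem formalExp_sum {ι : Type*} (s : Finset ι) (g : ι → MvPowerSeries σ R)
    (hg : ∀ i ∈ s, MvPowerSeries.constantCoeff (g i) = 0) :
    formalExp (∑ i ∈ s, g i) = ∏ i ∈ s, formalExp (g i) := by
  classical
  induction s using Finset.induction_on with
  | empty => simp [formalExp_zero]
  | insert i s hi ih =>
    rw [Finset.sum_insert hi, Finset.prod_insert hi, formalExp_add (hg i (by simp)),
      ih fun j hj => hg j (by simp [hj])]
    rw [map_sum]
    exact Finset.sum_eq_zero fun j hj => hg j (by simp [hj])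

/-- With g = exp ∘ log and L = log' = 1 / (1 + X), one has g' = gL and L' = -L², so (gL)' = 0; as gL
has constant term 1, gL = 1. -/
theorem exp_subst_log : (PowerSeries.exp ℚ).subst (PowerSeries.log ℚ)
    = (1 + PowerSeries.X : PowerSeries ℚ) := by
  set g : PowerSeries ℚ := (PowerSeries.exp ℚ).subst (PowerSeries.log ℚ) with hg
  set L := PowerSeries.derivative ℚ (PowerSeries.log ℚ) with hL
  have hLX : (1 + PowerSeries.X) * L = 1 := by
    rw [hL, PowerSeries.deriv_log]
    ext n
    rw [add_mul, one_mul, map_add]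
    cases n with
    | zero => simp
    | succ n => rw [PowerSeries.coeff_succ_X_mul]; simp [PowerSeries.coeff_one, pow_succ]
  have hdg : PowerSeries.derivative ℚ g = g * L := by
    have := PowerSeries.derivative_subst (f := PowerSeries.exp ℚ)
      (PowerSeries.HasSubst.log (A := ℚ))
    rw [PowerSeries.derivative_exp] at this
    exact this
  have hdL : PowerSeries.derivative ℚ L = - L ^ 2 := by
    have h := congrArg (PowerSeries.derivative ℚ) hLX
    rw [Derivation.leibniz, map_add, PowerSeries.derivative_one, PowerSeries.derivative_X, zero_add,
      smul_eq_mul, smul_eq_mul, mul_one] at h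
    have h' : L * ((1 + PowerSeries.X) * PowerSeries.derivative ℚ L + L) = 0 := by rw [h, mul_zero]
    linear_combination h' - PowerSeries.derivative ℚ L * hLX
  have hc : PowerSeries.constantCoeff g = 1 := by
    have h := PowerSeries.constantCoeff_subst (PowerSeries.HasSubst.log (A := ℚ))
      (PowerSeries.exp ℚ)
    rw [finsum_eq_single _ 0] at h
    · rw [hg, PowerSeries.constantCoeff, h]
      simp
    · intro d hd
      rw [map_pow]
      have : MvPowerSeries.constantCoeff (PowerSeries.log ℚ) = 0 :=
        PowerSeries.constantCoeff_log
      rw [this, zero_pow hd, smul_zero]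
  have h1 : g * L = 1 := by
    apply PowerSeries.derivative.ext
    · rw [Derivation.leibniz, hdg, hdL, PowerSeries.derivative_one, smul_eq_mul, smul_eq_mul]
      ring
    · rw [map_mul, hc]
      have := congrArg PowerSeries.constantCoeff hLX
      simpa using this
  calc g = g * ((1 + PowerSeries.X) * L) := by rw [hLX, mul_one]
    _ = (g * L) * (1 + PowerSeries.X) := by ring
    _ = _ := by rw [h1, one_mul]

theorem formalExp_subst_logOf {f : PowerSeries R} (hf : PowerSeries.constantCoeff f = 1)
    {s : MvPowerSeries σ R} (hs : MvPowerSeries.constantCoeff s = 0) :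
    formalExp ((PowerSeries.logOf f).subst s) = f.subst s := by
  have hf1 : PowerSeries.HasSubst (f - 1) :=
    PowerSeries.HasSubst.of_constantCoeff_zero' (by rw [map_sub, hf, map_one, sub_self])
  have hs' := hasSubst_of_constantCoeff hs
  -- The logarithm is taken over R but the exponential over ℚ; both must be rational series before
  -- associativity of substitution can bring in `exp_subst_log`.
  have hlog : PowerSeries.logOf f = (PowerSeries.log ℚ).subst (f - 1) := by
    rw [PowerSeries.logOf_eq, ← PowerSeries.map_log (algebraMap ℚ R),
      PowerSeries.map_algebraMap_eq_subst_X,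
      PowerSeries.subst_comp_subst_apply PowerSeries.HasSubst.X' hf1, PowerSeries.subst_X hf1]
  have h0 : MvPowerSeries.constantCoeff ((f - 1).subst s) = 0 :=
    PowerSeries.constantCoeff_subst_eq_zero hs _ (by rw [map_sub, hf, map_one, sub_self])
  have h0' := hasSubst_of_constantCoeff h0
  rw [hlog, PowerSeries.subst_comp_subst_apply hf1 hs', formalExp,
    ← PowerSeries.subst_comp_subst_apply PowerSeries.HasSubst.log h0', exp_subst_log]
  have h1 : (1 : MvPowerSeries σ R) = MvPowerSeries.subst (fun _ : Unit => s) (1 : PowerSeries R) := by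
    rw [← MvPowerSeries.coe_substAlgHom hs'.const, map_one]
  rw [PowerSeries.subst_add h0', PowerSeries.subst_X h0', PowerSeries.subst_sub hs']
  have e1 : PowerSeries.subst (PowerSeries.subst s f - PowerSeries.subst s (1 : PowerSeries R))
      (1 : PowerSeries ℚ) = 1 := by
    rw [← PowerSeries.coe_substAlgHom (by rwa [← PowerSeries.subst_sub hs']), map_one]
  have e2 : PowerSeries.subst s (1 : PowerSeries R) = 1 := by
    rw [← PowerSeries.coe_substAlgHom hs', map_one]
  rw [e1, e2]
  ring

omit [Algebra ℚ R] in
theorem formalSum_eq_subst {s : MvPowerSeries σ R} (hs : MvPowerSeries.constantCoeff s = 0)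
    {f : PowerSeries R} (hf : PowerSeries.constantCoeff f = 0) (d : σ →₀ ℕ) :
    MvPowerSeries.coeff d (f.subst s)
      = ∑ᶠ i, PowerSeries.coeff (i + 1) f • MvPowerSeries.coeff d (s ^ (i + 1)) := by
  rw [PowerSeries.coeff_subst (hasSubst_of_constantCoeff hs)]
  have : (fun i : ℕ => PowerSeries.coeff i f • MvPowerSeries.coeff d (s ^ i)).support
      ⊆ Set.range (fun i : ℕ => i + 1) := by
    intro i hi
    cases i with
    | zero => simp [hf] at hi
    | succ i => exact ⟨i, rfl⟩
  rw [← finsum_mem_univ (f := fun i : ℕ => PowerSeries.coeff (i + 1) f • MvPowerSeries.coeff d (s ^ (i + 1))),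
    ← finsum_mem_image (f := fun i : ℕ => PowerSeries.coeff i f • MvPowerSeries.coeff d (s ^ i))
      (g := fun i : ℕ => i + 1) (s := Set.univ) (fun a _ b _ h => by simpa using h), Set.image_univ]
  classical
  refine finsum_congr fun i => ?_
  by_cases hi : i ∈ Set.range (fun i : ℕ => i + 1)
  · rw [finsum_eq_if, if_pos hi]
  · rw [finsum_eq_if, if_neg hi]
    by_contra h
    exact hi (this h)

omit [Algebra ℚ R] in
theorem formalSum_family {ι : Type*} [Fintype ι] (f : ι → PowerSeries R)
    (hf : ∀ a, PowerSeries.constantCoeff (f a) = 0) (s : ι → MvPowerSeries σ R)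
    (hs : ∀ a, MvPowerSeries.constantCoeff (s a) = 0) :
    formalSum (fun i => ∑ a, MvPowerSeries.C (PowerSeries.coeff (i + 1) (f a)) * s a ^ (i + 1))
      = ∑ a, (f a).subst (s a) := by
  ext d
  rw [map_sum]
  simp only [formalSum_eq_subst (hs _) (hf _) d]
  rw [MvPowerSeries.coeff_apply, formalSum, ← finsum_sum_comm]
  · refine finsum_congr fun i => ?_
    rw [map_sum]
    exact Finset.sum_congr rfl fun a _ => by rw [MvPowerSeries.coeff_C_mul, smul_eq_mul]
  · intro a _
    refine (((PowerSeries.coeff_subst_finite (hasSubst_of_constantCoeff (hs a)) (f a) d).preimage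
      (f := fun i : ℕ => i + 1) (fun a _ b _ h => by simpa using h))).subset ?_
    intro i hi
    exact hi

/-- The exponent splits into one series (log f_a)(s_a) for each a. This is how the x_i disappear: a
power sum is a sum of i-th powers, so exp (∑ x_i p_i(v)) becomes a product of values of ∑ S_j z^j.
-/
theorem formalExp_formalSum_logOf {ι : Type*} [Fintype ι] (f : ι → PowerSeries R)
    (hf : ∀ a, PowerSeries.constantCoeff (f a) = 1) (s : ι → MvPowerSeries σ R)
    (hs : ∀ a, MvPowerSeries.constantCoeff (s a) = 0) :
    formalExp (formalSum (fun i => ∑ a, MvPowerSeries.C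
      (PowerSeries.coeff (i + 1) (PowerSeries.logOf (f a))) * s a ^ (i + 1)))
      = ∏ a, (f a).subst (s a) := by
  rw [formalSum_family _ (fun a => PowerSeries.constantCoeff_logOf (hf a)) s hs, formalExp_sum]
  · exact Finset.prod_congr rfl fun a _ => formalExp_subst_logOf (hf a) (hs a)
  · intro a _
    exact PowerSeries.constantCoeff_subst_eq_zero (hs a) _
      (PowerSeries.constantCoeff_logOf (hf a))

/-- The logarithm of the geometric series is `∑ X ^ i / i`. -/
theorem coeff_logOf_geometric (i : ℕ) :
    PowerSeries.coeff (i + 1) (PowerSeries.logOf (PowerSeries.mk fun _ => (1 : R)))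
      = algebraMap ℚ R (1 / ((i : ℚ) + 1)) := by
  set g : PowerSeries R := PowerSeries.mk fun _ => (1 : R) with hg
  have hgX : g * (1 - PowerSeries.X) = 1 := PowerSeries.mk_one_mul_one_sub_eq_one R
  have hf1 : PowerSeries.HasSubst (g - 1) :=
    PowerSeries.HasSubst.of_constantCoeff_zero' (by
      rw [map_sub, ← PowerSeries.coeff_zero_eq_constantCoeff_apply, hg]; simp)
  set L := PowerSeries.derivative R (PowerSeries.log R) with hL
  have hLX : (1 + PowerSeries.X) * L = 1 := by
    rw [hL, PowerSeries.deriv_log]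
    ext n
    rw [add_mul, one_mul, map_add]
    cases n with
    | zero => simp
    | succ n => rw [PowerSeries.coeff_succ_X_mul]; simp [PowerSeries.coeff_one, pow_succ]
  have hLs : g * L.subst (g - 1) = 1 := by
    have h := congrArg (PowerSeries.substAlgHom hf1) hLX
    rw [map_mul, map_add, map_one, PowerSeries.substAlgHom_X, PowerSeries.coe_substAlgHom] at h
    rwa [add_sub_cancel] at h
  have hdg : PowerSeries.derivative R g = g ^ 2 := by
    have h := congrArg (PowerSeries.derivative R) hgX
    rw [Derivation.leibniz, map_sub, PowerSeries.derivative_one, PowerSeries.derivative_X, zero_sub,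
      smul_eq_mul, smul_eq_mul] at h
    linear_combination g * h - PowerSeries.derivative R g * hgX
  -- For g = 1 / (1 - X) one has g' = g², hence (log g)' = g'/g = g, all of whose coefficients are
  -- 1.
  have hd : PowerSeries.derivative R (PowerSeries.logOf g) = g := by
    rw [PowerSeries.logOf_eq, PowerSeries.derivative_subst hf1, map_sub,
      PowerSeries.derivative_one, sub_zero, hdg]
    linear_combination g * hLs
  have h := congrArg (PowerSeries.coeff i) hd
  rw [PowerSeries.coeff_derivative, hg, PowerSeries.coeff_mk] at h
  have h2 : algebraMap ℚ R ((i : ℚ) + 1) * algebraMap ℚ R (1 / ((i : ℚ) + 1)) = 1 := by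
    rw [← map_mul, mul_one_div_cancel (by positivity), map_one]
  rw [map_add, map_natCast, map_one] at h2
  calc _ = PowerSeries.coeff (i + 1) (PowerSeries.logOf g) * (((i : R) + 1)
        * algebraMap ℚ R (1 / ((i : ℚ) + 1))) := by rw [h2, mul_one]
    _ = _ := by rw [← mul_assoc, h, one_mul]

end ExpLog

/-! ### Lagrange interpolation matrices -/

section Lagrange

variable {R : Type*} [CommRing R] {p : ℕ}

/-- The coefficient of `z ^ l` in a power series, `0` for `l < 0`. -/
def coeffZ (f : PowerSeries R) (l : ℤ) : R := if l < 0 then 0 else PowerSeries.coeff l.toNat f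

theorem map_coeffZ {R' : Type*} [CommRing R'] (φ : R →+* R') (f : PowerSeries R) (l : ℤ) :
    φ (coeffZ f l) = coeffZ (PowerSeries.map φ f) l := by
  unfold coeffZ
  split_ifs <;> simp

/-- `∏_{j ≠ i} (X - v_j)`. -/
def nodal (v : Fin p → R) (i : Fin p) : Polynomial R :=
  ∏ j ∈ Finset.univ.erase i, (Polynomial.X - Polynomial.C (v j))

/-- The matrix of the coefficients of the polynomials `∏_{j ≠ i} (X - v_j)`. -/
def nodalMatrix (v : Fin p → R) : Matrix (Fin p) (Fin p) R :=
  Matrix.of fun b i => (nodal v i).coeff b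

theorem natDegree_prod_X_sub_C_le {ι : Type*} (s : Finset ι) (v : ι → R) :
    (∏ j ∈ s, (Polynomial.X - Polynomial.C (v j))).natDegree ≤ s.card := by
  refine (Polynomial.natDegree_prod_le _ _).trans ?_
  refine (Finset.sum_le_card_nsmul _ _ 1 fun j _ => Polynomial.natDegree_X_sub_C_le _).trans ?_
  simp

theorem natDegree_nodal_lt (v : Fin p → R) (i : Fin p) : (nodal v i).natDegree < p := by
  have h := natDegree_prod_X_sub_C_le (Finset.univ.erase i) v
  rw [Finset.card_erase_of_mem (Finset.mem_univ i), Finset.card_univ, Fintype.card_fin] at h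
  have : 0 < p := i.pos
  unfold nodal
  omega

theorem sum_nodal_mul_pow (v : Fin p → R) (i : Fin p) (x : R) :
    ∑ b : Fin p, nodalMatrix v b i * x ^ (b : ℕ) = ∏ j ∈ Finset.univ.erase i, (x - v j) := by
  have h := Polynomial.eval_eq_sum_range' (natDegree_nodal_lt v i) x
  rw [Finset.sum_range] at h
  simp only [nodalMatrix, Matrix.of_apply]
  rw [← h, nodal, Polynomial.eval_prod]
  simp

/-- Reversing the coefficients of ∏ (X - v_j) gives ∏ (1 - v_j X); the induction multiplies by one
linear factor at a time. -/
theorem sum_prod_X_sub_C_mul_pow {ι : Type*} (s : Finset ι) (v : ι → R) (x : R) :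
    ∑ b ∈ Finset.range (s.card + 1), (∏ j ∈ s, (Polynomial.X - Polynomial.C (v j))).coeff b
      * x ^ (s.card - b) = ∏ j ∈ s, (1 - v j * x) := by
  classical
  induction s using Finset.induction_on with
  | empty => simp
  | insert i s hi ih =>
    rw [Finset.prod_insert hi, Finset.prod_insert hi, Finset.card_insert_of_notMem hi, ← ih]
    set f := ∏ j ∈ s, (Polynomial.X - Polynomial.C (v j)) with hf
    have hdeg : f.coeff (s.card + 1) = 0 :=
      Polynomial.coeff_eq_zero_of_natDegree_lt
        (Nat.lt_succ_of_le (natDegree_prod_X_sub_C_le s v))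
    have h1 : ∑ b ∈ Finset.range (s.card + 1 + 1), (Polynomial.X * f).coeff b
        * x ^ (s.card + 1 - b) = ∑ b ∈ Finset.range (s.card + 1), f.coeff b * x ^ (s.card - b) := by
      rw [Finset.sum_range_succ']
      simp
    have h2 : ∑ b ∈ Finset.range (s.card + 1 + 1), (Polynomial.C (v i) * f).coeff b
        * x ^ (s.card + 1 - b)
        = v i * x * ∑ b ∈ Finset.range (s.card + 1), f.coeff b * x ^ (s.card - b) := by
      rw [Finset.sum_range_succ, Polynomial.coeff_C_mul, hdeg, mul_zero, zero_mul, add_zero,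
        Finset.mul_sum]
      refine Finset.sum_congr rfl fun b hb => ?_
      rw [Finset.mem_range] at hb
      rw [Polynomial.coeff_C_mul, show s.card + 1 - b = (s.card - b) + 1 by omega, pow_succ]
      ring
    simp only [sub_mul, Polynomial.coeff_sub, Finset.sum_sub_distrib, h1, h2, one_mul]

theorem sum_nodal_mul_pow_sub (v : Fin p → R) (i : Fin p) (x : R) :
    ∑ b : Fin p, nodalMatrix v b i * x ^ (p - 1 - (b : ℕ))
      = ∏ j ∈ Finset.univ.erase i, (1 - v j * x) := by
  have h := sum_prod_X_sub_C_mul_pow (Finset.univ.erase i) v x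
  have hp : 0 < p := i.pos
  rw [Finset.card_erase_of_mem (Finset.mem_univ i), Finset.card_univ, Fintype.card_fin,
    Nat.sub_add_cancel hp, Finset.sum_range] at h
  exact h

theorem nodalMatrix_map {R' : Type*} [CommRing R'] (φ : R →+* R') (v : Fin p → R) :
    nodalMatrix (fun i => φ (v i)) = (nodalMatrix v).map φ := by
  ext b i
  simp only [nodalMatrix, Matrix.of_apply, Matrix.map_apply, nodal]
  rw [← Polynomial.coeff_map, Polynomial.map_prod]
  simp

theorem prod_prod_erase (v : Fin p → R) :
    ∏ i : Fin p, ∏ j ∈ Finset.univ.erase i, (v i - v j)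
      = (∏ i : Fin p, ∏ j ∈ Finset.Ioi i, (v j - v i))
        * ∏ i : Fin p, ∏ j ∈ Finset.Ioi i, (v i - v j) := by
  have h : ∀ i : Fin p, (Finset.univ.erase i) = (Finset.Iio i).disjUnion (Finset.Ioi i)
      (Finset.disjoint_left.2 fun x h1 h2 => by
        simp only [Finset.mem_Iio, Finset.mem_Ioi] at h1 h2; exact lt_asymm h1 h2) := by
    intro i; ext j; simp [lt_or_lt_iff_ne]
  simp only [h, Finset.prod_disjUnion, Finset.prod_mul_distrib]
  congr 1
  exact Finset.prod_comm' (by simp)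

/-- The Vandermonde matrix times the nodal matrix has entries ∏_{l≠j} (v_i - v_l), so it is
diagonal, and its determinant is a product of two Vandermonde products, one of which cancels. The
cancellation needs a domain, whence the indeterminates; other points are reached by specialization.
-/
theorem det_nodalMatrix_X : (nodalMatrix (X : Fin p → MvPolynomial (Fin p) ℚ)).det = vander p := by
  set v : Fin p → MvPolynomial (Fin p) ℚ := X
  have h : Matrix.vandermonde v * nodalMatrix v
      = Matrix.diagonal fun i => ∏ j ∈ Finset.univ.erase i, (v i - v j) := by
    ext i j
    rw [Matrix.mul_apply]
    simp only [Matrix.vandermonde_apply]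
    rw [Finset.sum_congr rfl fun b _ => mul_comm _ _, sum_nodal_mul_pow]
    by_cases hij : i = j
    · subst hij; rw [Matrix.diagonal_apply_eq]
    · rw [Matrix.diagonal_apply_ne _ hij]
      exact congrArg _ (Finset.prod_eq_zero (Finset.mem_erase.2 ⟨hij, Finset.mem_univ i⟩)
        (sub_self _))
  have h2 := congrArg Matrix.det h
  rw [Matrix.det_mul, Matrix.det_diagonal, prod_prod_erase, ← Matrix.det_vandermonde] at h2
  exact mul_left_cancel₀ (Matrix.det_vandermonde_ne_zero_iff.2 (X_injective)) h2

theorem det_nodalMatrix [Algebra ℚ R] (v : Fin p → R) :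
    (nodalMatrix v).det = ∏ i : Fin p, ∏ j ∈ Finset.Ioi i, (v i - v j) := by
  have h := congrArg (aeval v) (det_nodalMatrix_X (p := p))
  rw [AlgHom.map_det, AlgHom.mapMatrix_apply] at h
  have h2 := nodalMatrix_map (aeval v : MvPolynomial (Fin p) ℚ →ₐ[ℚ] R).toRingHom X
  simp only [AlgHom.toRingHom_eq_coe, RingHom.coe_coe, aeval_X] at h2
  rw [h2]
  exact h.trans (by simp [vander, map_prod])

/-- `∑_b N_{b,i} H_{q-p+1+b} = v_i ^ q`, where `H = ∏ 1 / (1 - v_j z)`. -/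
theorem sum_nodal_mul_coeffZ (v : Fin p → R) {H : PowerSeries R}
    (hH : H * ∏ j, (1 - PowerSeries.C (v j) * PowerSeries.X) = 1) (i : Fin p) (q : ℕ) :
    ∑ b : Fin p, nodalMatrix v b i * coeffZ H ((q : ℤ) - (p - 1) + (b : ℕ)) = v i ^ q := by
  have h1 := sum_nodal_mul_pow_sub (fun j => PowerSeries.C (v j)) i
    (PowerSeries.X : PowerSeries R)
  -- All factors of H but the i-th cancel, leaving 1 / (1 - v_i z), whose coefficient of z^q is
  -- v_i^q.
  have h2 : (∏ j ∈ Finset.univ.erase i, (1 - PowerSeries.C (v j) * PowerSeries.X)) * H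
      = PowerSeries.mk fun q => v i ^ q := by
    rw [← Finset.mul_prod_erase _ _ (Finset.mem_univ i)] at hH
    have h3 : (1 - PowerSeries.C (v i) * PowerSeries.X) * PowerSeries.mk (fun q => v i ^ q) = 1 := by
      ext q
      rw [sub_mul, one_mul, map_sub, mul_assoc, PowerSeries.coeff_C_mul]
      cases q with
      | zero => simp
      | succ q =>
        rw [PowerSeries.coeff_succ_X_mul]; simp [PowerSeries.coeff_one, pow_succ, mul_comm]
    set G := PowerSeries.mk fun q => v i ^ q
    calc _ = (∏ j ∈ Finset.univ.erase i, (1 - PowerSeries.C (v j) * PowerSeries.X)) * H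
          * ((1 - PowerSeries.C (v i) * PowerSeries.X) * G) := by rw [h3, mul_one]
      _ = (H * ((1 - PowerSeries.C (v i) * PowerSeries.X)
          * ∏ j ∈ Finset.univ.erase i, (1 - PowerSeries.C (v j) * PowerSeries.X))) * G := by ring
      _ = _ := by rw [hH, one_mul]
  rw [← h1, Finset.sum_mul] at h2
  have h4 := congrArg (PowerSeries.coeff q) h2
  rw [map_sum, PowerSeries.coeff_mk] at h4
  rw [← h4]
  refine Finset.sum_congr rfl fun b _ => ?_
  have hmap := congrFun (congrFun (nodalMatrix_map PowerSeries.C v) b) i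
  rw [Matrix.map_apply] at hmap
  rw [hmap, mul_assoc, PowerSeries.coeff_C_mul,
    PowerSeries.coeff_X_pow_mul', coeffZ]
  congr 1
  have := b.2
  by_cases hq : p - 1 - (b : ℕ) ≤ q
  · rw [if_pos hq, if_neg (by omega)]
    congr 2
    omega
  · rw [if_neg hq, if_pos (by omega)]

end Lagrange

/-! ### Jacobi–Trudi determinants and the relations of the Grassmannian -/

section JacobiTrudi

/-- `∑ S_j z ^ j` with coefficients in `B_m`. -/
def segreSeries (m : ℕ) : PowerSeries (MvPolynomial (Fin m) ℚ) := PowerSeries.mk (segre m)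

/-- The Jacobi–Trudi determinant `det (S_{a_j - (m - 1 - i)})`. -/
def jacobiTrudi (m : ℕ) (a : Fin m → ℕ) : MvPolynomial (Fin m) ℚ :=
  (Matrix.of fun i j : Fin m => coeffZ (segreSeries m) ((a j : ℤ) - (m - 1) + (i : ℕ))).det

theorem map_toSymm_segreSeries (m : ℕ) :
    PowerSeries.map (toSymm m).toRingHom (segreSeries m) = partH m m := by
  ext1 j
  rw [PowerSeries.coeff_map, segreSeries, PowerSeries.coeff_mk]
  exact toSymm_segre m j

theorem partH_mul_prod (m : ℕ) :
    partH m m * ∏ j : Fin m, (1 - PowerSeries.C (X j) * PowerSeries.X) = 1 := by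
  have h := partE_mul_partH m m
  rw [partE, Finset.filter_true_of_mem (fun l _ => l.2)] at h
  rw [mul_comm]
  exact h

/-- By `sum_nodal_mul_coeffZ` the transposed nodal matrix of the variables times the Jacobi–Trudi
matrix is (t_s ^ {a_j}). No order on the a_j is needed. -/
theorem vander_mul_toSymm_jacobiTrudi (m : ℕ) (a : Fin m → ℕ) :
    vander m * toSymm m (jacobiTrudi m a)
      = (Matrix.of fun s j : Fin m => (X s : MvPolynomial (Fin m) ℚ) ^ a j).det := by
  rw [jacobiTrudi, AlgHom.map_det, ← det_nodalMatrix_X, ← Matrix.det_transpose, ← Matrix.det_mul]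
  congr 1
  ext1 s j
  rw [Matrix.mul_apply, Matrix.of_apply, ← sum_nodal_mul_coeffZ X (partH_mul_prod m) s (a j)]
  refine Finset.sum_congr rfl fun b _ => ?_
  rw [Matrix.transpose_apply, AlgHom.mapMatrix_apply, Matrix.map_apply, Matrix.of_apply,
    ← map_toSymm_segreSeries, ← map_coeffZ]
  rfl

theorem vander_ne_zero (m : ℕ) : vander m ≠ 0 := by
  rw [vander, Finset.prod_ne_zero_iff]
  intro i _
  rw [Finset.prod_ne_zero_iff]
  intro j hj h
  exact (Finset.mem_Ioi.1 hj).ne (X_injective (sub_eq_zero.1 h))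

theorem toSymm_injective (m : ℕ) : Function.Injective (toSymm m) := by
  intro f g hfg
  refine esymmAlgHom_injective (σ := Fin m) (n := m) ℚ (by simp) ?_
  apply Subtype.ext
  rw [esymmAlgHom_apply, esymmAlgHom_apply]
  exact hfg

/-- Comparing coefficients in `chern m` · ∑ S_j z^j = 1 expresses each S_{l+1} through the m
preceding ones. -/
theorem segre_recurrence (m : ℕ) (l : ℕ) :
    segre m (l + 1) ∈ Ideal.span {f | ∃ i : Fin m, (i : ℕ) ≤ l ∧ f = segre m (l - i)} := by
  have hc : PowerSeries.constantCoeff (chern m) = ((1 : (MvPolynomial (Fin m) ℚ)ˣ) : _) := by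
    rw [chern, map_add, map_one, map_sum, Units.val_one, add_eq_left]
    refine Finset.sum_eq_zero fun i _ => ?_
    rw [← PowerSeries.coeff_zero_eq_constantCoeff_apply, PowerSeries.coeff_monomial,
      if_neg (by omega)]
  have h := congrArg (PowerSeries.coeff (l + 1)) (PowerSeries.mul_invOfUnit (chern m) 1 hc)
  have hch : chern m = 1 + ∑ i : Fin m,
    PowerSeries.monomial ((i : ℕ) + 1) ((-1) ^ ((i : ℕ) + 1) * X i) := rfl
  set G := PowerSeries.invOfUnit (chern m) 1 with hG
  rw [PowerSeries.coeff_one, if_neg (by omega), hch, add_mul, one_mul, map_add, Finset.sum_mul,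
    map_sum] at h
  rw [segre, ← hG, eq_neg_of_add_eq_zero_left h]
  refine neg_mem (Ideal.sum_mem _ fun i _ => ?_)
  rw [PowerSeries.monomial_eq_C_mul_X_pow, mul_assoc, PowerSeries.coeff_C_mul,
    PowerSeries.coeff_X_pow_mul']
  split_ifs with hi
  · refine Ideal.mul_mem_left _ _ (Ideal.subset_span ⟨i, by omega, ?_⟩)
    rw [segre, show l + 1 - (i + 1) = l - i by omega]
  · simp

/-- The generators of the ideal stop at S_n. The m terms preceding an S_j with j > n all have index
above n - m (or are zero), so the recurrence propagates membership. -/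
theorem segre_mem_grassIdeal (m : ℕ) (n : ℕ∞) (j : ℕ) (hj : n < ((j + m : ℕ) : ℕ∞)) :
    segre m j ∈ grassIdeal m n := by
  induction j using Nat.strong_induction_on with
  | _ j ih =>
    by_cases hjn : (j : ℕ∞) ≤ n
    · exact Ideal.subset_span ⟨j, hjn, hj, rfl⟩
    · cases j with
      | zero => simp at hjn
      | succ l =>
        refine (Ideal.span_le.2 ?_) (segre_recurrence m l)
        rintro f ⟨i, hi, rfl⟩
        refine ih _ (by omega) ?_
        have : n < ((l + 1 : ℕ) : ℕ∞) := not_le.1 hjn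
        refine this.trans_le ?_
        have := i.2
        exact_mod_cast (by omega : l + 1 ≤ l - i + m)

/-- The entries are S_{i-j}, so the matrix is unitriangular: X^m(0) corresponds to 1. -/
theorem jacobiTrudi_staircase (m : ℕ) : jacobiTrudi m (fun j => m - 1 - (j : ℕ)) = 1 := by
  have h0 : segre m 0 = 1 := by
    rw [segre, PowerSeries.coeff_zero_eq_constantCoeff_apply, PowerSeries.constantCoeff_invOfUnit]
    simp
  have key : ∀ i j : Fin m, (((m - 1 - (j : ℕ) : ℕ) : ℤ) - (m - 1) + (i : ℕ)) = (i : ℤ) - j := by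
    intro i j; have := i.2; have := j.2; omega
  rw [jacobiTrudi, Matrix.det_of_isLowerTriangular]
  · refine Finset.prod_eq_one fun i _ => ?_
    rw [Matrix.of_apply, key, sub_self, coeffZ]
    simp [segreSeries, h0]
  · intro i j hij
    rw [Matrix.of_apply, key, coeffZ, if_pos]
    have : (i : ℕ) < j := by simpa using hij
    omega

end JacobiTrudi

/-! ### Antisymmetrization; surjectivity onto the exterior power -/

section Antisymmetry

theorem wedgeMap_rename (r : ℕ) (n : ℕ∞) (σ : Equiv.Perm (Fin r)) (f : MvPolynomial (Fin r) ℚ) :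
    wedgeMap r n (rename σ f) = (Equiv.Perm.sign σ : ℤ) • wedgeMap r n f := by
  induction σ using Equiv.Perm.swap_induction_on generalizing f with
  | one => simp
  | swap_mul σ x y hxy ih =>
    rw [Equiv.Perm.coe_mul, ← rename_rename, wedgeMap_swap r n hxy, ih, Equiv.Perm.sign_mul,
      Equiv.Perm.sign_swap hxy]
    simp

/-- The antisymmetrization `∑_σ sgn σ σ g`. -/
def antisymmetrize (r : ℕ) (g : MvPolynomial (Fin r) ℚ) : MvPolynomial (Fin r) ℚ :=
  ∑ σ : Equiv.Perm (Fin r), (Equiv.Perm.sign σ : ℤ) • rename σ g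

/-- All r! terms have the same image: permuting the variables changes the wedge by sgn σ, which
cancels the sign in the antisymmetrization, and s is invariant. -/
theorem wedgeMap_mul_antisymmetrize (r : ℕ) (n : ℕ∞) {s : MvPolynomial (Fin r) ℚ}
    (hs : s.IsSymmetric) (g : MvPolynomial (Fin r) ℚ) :
    wedgeMap r n (s * antisymmetrize r g) = (r.factorial : ℚ) • wedgeMap r n (s * g) := by
  rw [antisymmetrize, Finset.mul_sum, map_sum]
  have : ∀ σ ∈ (Finset.univ : Finset (Equiv.Perm (Fin r))),
      wedgeMap r n (s * ((Equiv.Perm.sign σ : ℤ) • rename σ g)) = wedgeMap r n (s * g) := by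
    intro σ _
    rw [mul_smul_comm, map_zsmul]
    conv_lhs => rw [← hs σ, ← map_mul, wedgeMap_rename, smul_smul]
    rw [← Units.val_mul, Int.units_mul_self, Units.val_one, one_smul]
  rw [Finset.sum_congr rfl this, Finset.sum_const, Finset.card_univ, Fintype.card_perm,
    Fintype.card_fin, Nat.cast_smul_eq_nsmul]

theorem det_pow_eq_antisymmetrize (r : ℕ) (a : Fin r → ℕ) :
    (Matrix.of fun s j : Fin r => (X s : MvPolynomial (Fin r) ℚ) ^ a j).det
      = antisymmetrize r (∏ j, X j ^ a j) := by
  rw [Matrix.det_apply, antisymmetrize]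
  refine Finset.sum_congr rfl fun σ _ => ?_
  simp [map_prod, Units.smul_def]

theorem wedgeMap_prod_pow (r : ℕ) (n : ℕ∞) (a : Fin r → ℕ) :
    wedgeMap r n (∏ j, X j ^ a j) = ExteriorAlgebra.ιMulti ℚ r fun i => vec n (a i) := by
  have h : (∏ j, X j ^ a j : MvPolynomial (Fin r) ℚ)
      = monomial (Finsupp.equivFunOnFinite.symm a) 1 := by
    rw [monomial_eq, C_1, one_mul, Finsupp.prod_fintype _ _ (by simp)]
    simp
  rw [h, wedgeMap_monomial, one_smul]
  simp

theorem vander_eq_antisymmetrize (r : ℕ) : vander r = antisymmetrize r (staircase r) := by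
  have h := vander_mul_toSymm_jacobiTrudi r fun j => r - 1 - (j : ℕ)
  rw [jacobiTrudi_staircase, map_one, mul_one, det_pow_eq_antisymmetrize] at h
  exact h

/-- The polynomials J_a(e) · t^{staircase} and ∏ t_j^{a_j} have the same antisymmetrization det (t_s
^ {a_j}), hence the same image up to the common factor r!, which is invertible. -/
theorem preFermion_jacobiTrudi (r : ℕ) (n : ℕ∞) (a : Fin r → ℕ) :
    preFermion r n (jacobiTrudi r a) = ExteriorAlgebra.ιMulti ℚ r fun i => vec n (a i) := by
  have h1 := wedgeMap_mul_antisymmetrize r n (toSymm_isSymmetric r (jacobiTrudi r a)) (staircase r)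
  rw [← vander_eq_antisymmetrize, mul_comm, vander_mul_toSymm_jacobiTrudi,
    det_pow_eq_antisymmetrize] at h1
  have h2 := wedgeMap_mul_antisymmetrize r n (s := 1) (by simp) (∏ j, X j ^ a j)
  rw [one_mul, one_mul, h1, wedgeMap_prod_pow] at h2
  exact smul_right_injective _ (by positivity : (r.factorial : ℚ) ≠ 0) h2

theorem fermion_mk (r : ℕ) (n : ℕ∞) (f : MvPolynomial (Fin r) ℚ) :
    fermion r n (Ideal.Quotient.mk _ f) = preFermion r n f := rfl

theorem span_vec (n : ℕ∞) : Submodule.span ℚ (Set.range (vec n)) = ⊤ := by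
  rw [eq_top_iff]
  rintro v -
  obtain ⟨p, rfl⟩ := Ideal.Quotient.mk_surjective v
  induction p using Polynomial.induction_on' with
  | add p q hp hq => rw [map_add]; exact add_mem hp hq
  | monomial i c =>
    have : Ideal.Quotient.mk (truncIdeal n) (Polynomial.monomial i c) = c • vec n i := by
      rw [vec, ← Polynomial.smul_X_eq_monomial]
      rfl
    rw [this]
    exact Submodule.smul_mem _ _ (Submodule.subset_span ⟨i, rfl⟩)

theorem ιMulti_mem_range_fermion (r : ℕ) (n : ℕ∞) (a : Fin r → ℕ) :
    (ExteriorAlgebra.ιMulti ℚ r fun i => vec n (a i)) ∈ LinearMap.range (fermion r n) :=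
  ⟨Ideal.Quotient.mk _ (jacobiTrudi r a), by rw [fermion_mk, preFermion_jacobiTrudi]⟩

theorem wedgeMap_mem_span (r : ℕ) (n : ℕ∞) (f : MvPolynomial (Fin r) ℚ) :
    wedgeMap r n f ∈ Submodule.span ℚ
      (Set.range fun a : Fin r → ℕ => ExteriorAlgebra.ιMulti ℚ r fun i => vec n (a i)) := by
  induction f using MvPolynomial.induction_on' with
  | monomial a q =>
    rw [wedgeMap_monomial]
    exact Submodule.smul_mem _ _ (Submodule.subset_span ⟨a, rfl⟩)
  | add p q hp hq => rw [map_add]; exact add_mem hp hq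

theorem fermion_mem_span (r : ℕ) (n : ℕ∞) (P : B r n) :
    fermion r n P ∈ Submodule.span ℚ
      (Set.range fun a : Fin r → ℕ => ExteriorAlgebra.ιMulti ℚ r fun i => vec n (a i)) := by
  obtain ⟨f, rfl⟩ := Ideal.Quotient.mk_surjective P
  exact wedgeMap_mem_span r n _

theorem range_fermion (r : ℕ) (n : ℕ∞) : LinearMap.range (fermion r n) = ⋀[ℚ]^r (V n) := by
  rw [← exteriorPower.ιMulti_span_fixedDegree_of_span_eq_top ℚ r (V n) (span_vec n)]
  apply le_antisymm
  · rintro _ ⟨P, rfl⟩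
    refine Submodule.span_mono ?_ (fermion_mem_span r n P)
    rintro _ ⟨a, rfl⟩
    exact ⟨fun i => vec n (a i), by rintro _ ⟨i, rfl⟩; exact ⟨a i, rfl⟩, rfl⟩
  · rw [Submodule.span_le]
    rintro _ ⟨v, hv, rfl⟩
    choose a ha using fun i => hv ⟨i, rfl⟩
    obtain rfl : (fun i => vec n (a i)) = v := funext ha
    exact ιMulti_mem_range_fermion r n a

end Antisymmetry

/-! ### Contractions as determinants -/

section Contraction

theorem contractLeft_ιMulti {M : Type*} [AddCommGroup M] [Module ℚ M] (d : Module.Dual ℚ M) (r : ℕ)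
    (v : Fin (r + 1) → M) :
    CliffordAlgebra.contractLeft (Q := (0 : QuadraticForm ℚ M)) d
        (ExteriorAlgebra.ιMulti ℚ (r + 1) v)
      = ∑ i : Fin (r + 1), ((-1) ^ (i : ℕ) * d (v i)) •
          ExteriorAlgebra.ιMulti ℚ r (v ∘ i.succAbove) := by
  have hstep : ∀ (s : ℕ) (w : Fin (s + 1) → M),
      CliffordAlgebra.contractLeft (Q := (0 : QuadraticForm ℚ M)) d
        (ExteriorAlgebra.ιMulti ℚ (s + 1) w) = d (w 0) • ExteriorAlgebra.ιMulti ℚ s (Matrix.vecTail w)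
        - ExteriorAlgebra.ι ℚ (w 0) * CliffordAlgebra.contractLeft (Q := (0 : QuadraticForm ℚ M)) d
          (ExteriorAlgebra.ιMulti ℚ s (Matrix.vecTail w)) := by
    intro s w
    rw [ExteriorAlgebra.ιMulti_succ_apply]
    exact CliffordAlgebra.contractLeft_ι_mul d (w 0) _
  induction r with
  | zero =>
    rw [hstep, ExteriorAlgebra.ιMulti_zero_apply, CliffordAlgebra.contractLeft_one]
    simp [ExteriorAlgebra.ιMulti_zero_apply]
  | succ r ih =>
    rw [hstep, ih, Fin.sum_univ_succ (n := r + 1), Finset.mul_sum, sub_eq_add_neg, ← Finset.sum_neg_distrib]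
    congr 1
    · simp only [Fin.val_zero, pow_zero, one_mul]
      rfl
    · refine Finset.sum_congr rfl fun i _ => ?_
      rw [mul_smul_comm, Fin.val_succ, pow_succ, mul_neg_one, neg_mul, neg_smul]
      congr 1
      rw [ExteriorAlgebra.ιMulti_succ_apply]
      congr 2
      congr 1
      ext l
      simp [Matrix.vecTail]

/-- `contract` as a linear map. -/
def contractHom (n : ℕ∞) (js : List ℕ) : Ext n →ₗ[ℚ] Ext n :=
  js.foldr (fun j f =>
    CliffordAlgebra.contractLeft (Q := (0 : QuadraticForm ℚ (V n))) (dual n j) ∘ₗ f) LinearMap.id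

theorem contractHom_apply (n : ℕ∞) (js : List ℕ) (u : Ext n) :
    contractHom n js u = contract n js u := by
  induction js with
  | nil => rfl
  | cons j js ih =>
    change CliffordAlgebra.contractLeft (Q := (0 : QuadraticForm ℚ (V n))) (dual n j)
      (contractHom n js u) = CliffordAlgebra.contractLeft (Q := (0 : QuadraticForm ℚ (V n)))
        (dual n j) (contract n js u)
    rw [ih]

theorem dual_vec (n : ℕ∞) (j i : ℕ) :
    dual n j (vec n i) = if i = j ∧ (j : ℕ∞) < n then 1 else 0 := by
  rw [dual]
  by_cases hj : (j : ℕ∞) < n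
  · rw [dif_pos hj]
    have : (Submodule.liftQ ((truncIdeal n).restrictScalars ℚ) (Polynomial.lcoeff ℚ j)
      (fun _ hp => coeff_eq_zero_of_mem hj hp) ∘ₗ
      (Submodule.Quotient.restrictScalarsEquiv ℚ (truncIdeal n)).symm.toLinearMap) (vec n i)
      = (Polynomial.X ^ i : Polynomial ℚ).coeff j := rfl
    rw [this, Polynomial.coeff_X_pow]
    simp [hj, eq_comm]
  · rw [dif_neg hj]
    simp [hj]

/-- The bijection `Fin p ⊕ Fin q ≃ Fin M` for `p + q = M`. -/
def blockEquiv {p q M : ℕ} (h : p + q = M) : Fin p ⊕ Fin q ≃ Fin M :=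
  finSumFinEquiv.trans (finCongr h)

theorem val_blockEquiv_inl {p q M : ℕ} (h : p + q = M) (i : Fin p) :
    (blockEquiv h (Sum.inl i) : ℕ) = i := rfl

theorem val_blockEquiv_inr {p q M : ℕ} (h : p + q = M) (i : Fin q) :
    (blockEquiv h (Sum.inr i) : ℕ) = p + i := rfl

/-- The matrix with the blocks `0`, `(⟨∂ ^ {j_a}, X ^ {b_i}⟩)`, `(S_{a_j - (m - 1 - i)})`,
`(S_{b_j - (m - 1 - i)})`, where `f = ∑ S_j z ^ j`. -/
def contractMatrix {A : Type*} [CommRing A] (f : PowerSeries A) (n : ℕ∞) {k h r : ℕ} (m : ℕ)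
    (a : Fin h → ℕ) (b : Fin r → ℕ) (js : Fin k → ℕ) :
    Matrix (Fin k ⊕ Fin m) (Fin h ⊕ Fin r) A :=
  open Classical in
  Matrix.fromBlocks 0 (Matrix.of fun i j => if b j = js i ∧ (js i : ℕ∞) < n then 1 else 0)
    (Matrix.of fun i j => coeffZ f ((a j : ℤ) - (m - 1) + (i : ℕ)))
    (Matrix.of fun i j => coeffZ f ((b j : ℤ) - (m - 1) + (i : ℕ)))

/-- Induction on k by expansion along row 0, the row of the innermost contraction. The entry in
column h + i has sign (-1)^{h+i}: here (-1)^i is the sign in the contraction of X^{b_i}, and (-1)^h,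
collected once for each of the k rows, makes (-1)^{hk}. For k = 0 the determinant is the
Jacobi–Trudi determinant of the concatenated sequence (a, b). -/
theorem preFermion_det_contractMatrix (m : ℕ) (n : ℕ∞) (k : ℕ) :
    ∀ {M h r : ℕ} (hM : k + m = M) (hM' : h + r = M) (a : Fin h → ℕ) (b : Fin r → ℕ)
      (js : Fin k → ℕ),
    preFermion m n ((contractMatrix (segreSeries m) n m a b js).submatrix (blockEquiv hM).symm
        (blockEquiv hM').symm).det
      = (-1 : ℚ) ^ (h * k) • ((ExteriorAlgebra.ιMulti ℚ h fun i => vec n (a i)) *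
        contract n (List.ofFn js).reverse (ExteriorAlgebra.ιMulti ℚ r fun i => vec n (b i))) := by
  induction k with
  | zero =>
    intro M h r hM hM' a b js
    subst hM'
    obtain rfl : m = h + r := by omega
    have hdet : ((contractMatrix (segreSeries (h + r)) n (h + r) a b js).submatrix
        (blockEquiv hM).symm (blockEquiv rfl).symm).det = jacobiTrudi (h + r) (Fin.append a b) := by
      rw [jacobiTrudi]
      congr 1
      ext1 i j
      obtain ⟨i, rfl⟩ := (blockEquiv hM).surjective i
      obtain ⟨j, rfl⟩ := (blockEquiv (rfl : h + r = h + r)).surjective j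
      rcases i with i | i
      · exact i.elim0
      have hi : (blockEquiv hM (Sum.inr i) : ℕ) = i := by rw [val_blockEquiv_inr]; omega
      rcases j with j | j
      · have hj : Fin.append a b (blockEquiv rfl (Sum.inl j)) = a j := Fin.append_left a b j
        simp [contractMatrix, hi, hj]
      · have hj : Fin.append a b (blockEquiv rfl (Sum.inr j)) = b j := Fin.append_right a b j
        simp [contractMatrix, hi, hj]
    rw [hdet, preFermion_jacobiTrudi]
    have : contract n (List.ofFn js).reverse (ExteriorAlgebra.ιMulti ℚ r fun i => vec n (b i))
        = ExteriorAlgebra.ιMulti ℚ r fun i => vec n (b i) := by simp [contract]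
    rw [this, ExteriorAlgebra.ιMulti_mul_ιMulti, mul_zero, pow_zero, one_smul]
    congr 1
    ext i
    refine Fin.addCases (fun i => ?_) (fun i => ?_) i <;> simp
  | succ k ih =>
    intro M h r hM hM' a b js
    have hc : ∀ u, contract n (List.ofFn js).reverse u
        = contract n (List.ofFn fun i : Fin k => js i.succ).reverse
          (CliffordAlgebra.contractLeft (Q := (0 : QuadraticForm ℚ (V n))) (dual n (js 0)) u) := by
      intro u
      rw [List.ofFn_succ, List.reverse_cons, contract, List.foldr_append]
      rfl
    rw [hc]
    cases r with
    | zero =>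
      -- With r = 0 both sides vanish: the contraction kills scalars, and row 0 has only the h zero
      -- entries.
      rw [ExteriorAlgebra.ιMulti_zero_apply, CliffordAlgebra.contractLeft_one,
        ← contractHom_apply, map_zero, mul_zero, smul_zero]
      rw [Matrix.det_eq_zero_of_row_eq_zero (blockEquiv hM (Sum.inl 0)), map_zero]
      intro j
      obtain ⟨j, rfl⟩ := (blockEquiv hM').surjective j
      rcases j with j | j
      · simp [contractMatrix]
      · exact j.elim0
    | succ r =>
      cases M with
      | zero => omega
      | succ M =>
        have hM1 : k + m = M := by omega
        have hM1' : h + r = M := by omega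
        rw [contractLeft_ιMulti, Matrix.det_succ_row_zero, map_sum, ← contractHom_apply, map_sum,
          Finset.mul_sum, Finset.smul_sum, ← (blockEquiv hM').sum_comp, Fintype.sum_sum_type]
        have hrow0 : (0 : Fin (M + 1)) = blockEquiv hM (Sum.inl 0) := by ext; rfl
        rw [Finset.sum_eq_zero, zero_add]
        · refine Finset.sum_congr rfl fun i _ => ?_
          -- The minor is again a matrix of this kind, with b_i and the first contraction removed;
          -- the lower blocks keep the same m.
          have hsub : (((contractMatrix (segreSeries m) n m a b js).submatrix (blockEquiv hM).symm
              (blockEquiv hM').symm).submatrix Fin.succ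
              (blockEquiv hM' (Sum.inr i)).succAbove)
              = (contractMatrix (segreSeries m) n m a (b ∘ i.succAbove)
                (fun i => js i.succ)).submatrix (blockEquiv hM1).symm (blockEquiv hM1').symm := by
            ext1 x y
            obtain ⟨x, rfl⟩ := (blockEquiv hM1).surjective x
            obtain ⟨y, rfl⟩ := (blockEquiv hM1').surjective y
            have hx1 : ∀ x : Fin k, (blockEquiv hM1 (Sum.inl x)).succ
                = blockEquiv hM (Sum.inl x.succ) := by intro x; ext; rfl
            have hx2 : ∀ x : Fin m, (blockEquiv hM1 (Sum.inr x)).succ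
                = blockEquiv hM (Sum.inr x) := by
              intro x; ext; rw [Fin.val_succ, val_blockEquiv_inr, val_blockEquiv_inr]; omega
            have hy1 : ∀ y : Fin h, (blockEquiv hM' (Sum.inr i)).succAbove
                (blockEquiv hM1' (Sum.inl y)) = blockEquiv hM' (Sum.inl y) := by
              intro y
              rw [Fin.succAbove_of_castSucc_lt]
              · ext; rfl
              · rw [Fin.lt_def, Fin.val_castSucc, val_blockEquiv_inl, val_blockEquiv_inr]
                omega
            have hy2 : ∀ y : Fin r, (blockEquiv hM' (Sum.inr i)).succAbove
                (blockEquiv hM1' (Sum.inr y)) = blockEquiv hM' (Sum.inr (i.succAbove y)) := by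
              intro y
              by_cases hiy : y.castSucc < i
              · rw [Fin.succAbove_of_castSucc_lt _ _ hiy, Fin.succAbove_of_castSucc_lt]
                · ext; rfl
                · rw [Fin.lt_def] at hiy ⊢
                  rw [Fin.val_castSucc] at hiy ⊢
                  rw [val_blockEquiv_inr, val_blockEquiv_inr]
                  omega
              · rw [not_lt] at hiy
                rw [Fin.succAbove_of_le_castSucc _ _ hiy, Fin.succAbove_of_le_castSucc]
                · ext; rw [Fin.val_succ, val_blockEquiv_inr, val_blockEquiv_inr, Fin.val_succ]
                  omega
                · rw [Fin.le_def] at hiy ⊢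
                  rw [Fin.val_castSucc] at hiy ⊢
                  rw [val_blockEquiv_inr, val_blockEquiv_inr]
                  omega
            simp only [Matrix.submatrix_apply, Equiv.symm_apply_apply]
            rcases x with x | x <;> rcases y with y | y <;>
              simp [hx1, hx2, hy1, hy2, contractMatrix]
          rw [hsub, hrow0]
          have hent : ((-1) ^ ((blockEquiv hM' (Sum.inr i) : Fin (M + 1)) : ℕ)
              * (contractMatrix (segreSeries m) n m a b js).submatrix (blockEquiv hM).symm
              (blockEquiv hM').symm (blockEquiv hM (Sum.inl 0)) (blockEquiv hM' (Sum.inr i))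
                : MvPolynomial (Fin m) ℚ)
              = algebraMap ℚ _ ((-1) ^ h * ((-1) ^ (i : ℕ) * dual n (js 0) (vec n (b i)))) := by
            rw [dual_vec, val_blockEquiv_inr, pow_add]
            simp only [contractMatrix, Matrix.submatrix_apply, Equiv.symm_apply_apply,
              Matrix.fromBlocks_apply₁₂, Matrix.of_apply]
            split_ifs <;> simp
          rw [hent, ← Algebra.smul_def, map_smul, ih hM1 hM1', map_smul, mul_smul_comm, smul_smul,
            smul_smul, contractHom_apply]
          congr 1
          ring
        · intro i _
          rw [hrow0]
          simp [contractMatrix]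

end Contraction

/-! ### The inverse map and injectivity -/

section LeftInverse

/-- The linear map `t ^ a ↦ J_a`, `J_a` the Jacobi–Trudi determinant. -/
def jacobiTrudiHom (r : ℕ) : MvPolynomial (Fin r) ℚ →ₗ[ℚ] MvPolynomial (Fin r) ℚ :=
  (MvPolynomial.basisMonomials (Fin r) ℚ).constr ℚ fun a => jacobiTrudi r a

theorem jacobiTrudiHom_monomial (r : ℕ) (a : Fin r →₀ ℕ) (q : ℚ) :
    jacobiTrudiHom r (monomial a q) = q • jacobiTrudi r a := by
  have h : (monomial a q : MvPolynomial (Fin r) ℚ)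
      = q • MvPolynomial.basisMonomials (Fin r) ℚ a := by
    simp [MvPolynomial.smul_monomial]
  rw [h, map_smul, jacobiTrudiHom, Module.Basis.constr_basis]

theorem antisymmetrize_add (r : ℕ) (f g : MvPolynomial (Fin r) ℚ) :
    antisymmetrize r (f + g) = antisymmetrize r f + antisymmetrize r g := by
  simp [antisymmetrize, Finset.sum_add_distrib]

theorem antisymmetrize_mul (r : ℕ) {s : MvPolynomial (Fin r) ℚ} (hs : s.IsSymmetric)
    (g : MvPolynomial (Fin r) ℚ) : antisymmetrize r (s * g) = s * antisymmetrize r g := by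
  rw [antisymmetrize, antisymmetrize, Finset.mul_sum]
  refine Finset.sum_congr rfl fun σ _ => ?_
  rw [map_mul, hs, mul_smul_comm]

theorem monomial_eq_smul_prod_pow (r : ℕ) (a : Fin r →₀ ℕ) (q : ℚ) :
    (monomial a q : MvPolynomial (Fin r) ℚ) = C q * ∏ j, X j ^ a j := by
  rw [monomial_eq, Finsupp.prod_fintype _ _ (by simp)]

theorem vander_mul_toSymm_jacobiTrudiHom (r : ℕ) (g : MvPolynomial (Fin r) ℚ) :
    vander r * toSymm r (jacobiTrudiHom r g) = antisymmetrize r g := by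
  induction g using MvPolynomial.induction_on' with
  | monomial a q =>
    rw [jacobiTrudiHom_monomial, map_smul, mul_smul_comm, vander_mul_toSymm_jacobiTrudi,
      det_pow_eq_antisymmetrize, monomial_eq_smul_prod_pow, antisymmetrize_mul r (by simp),
      MvPolynomial.smul_eq_C_mul]
  | add p q hp hq => rw [map_add, map_add, mul_add, hp, hq, antisymmetrize_add]

/-- After multiplication by the Vandermonde product the left side is the antisymmetrization of f(e)
· t^{staircase}; the symmetric factor f(e) comes out, and what remains is the Vandermonde product.
-/
theorem jacobiTrudiHom_toSymm_mul_staircase (r : ℕ) (f : MvPolynomial (Fin r) ℚ) :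
    jacobiTrudiHom r (toSymm r f * staircase r) = f := by
  apply toSymm_injective
  apply mul_left_cancel₀ (vander_ne_zero r)
  rw [vander_mul_toSymm_jacobiTrudiHom, antisymmetrize_mul r (toSymm_isSymmetric r f),
    ← vander_eq_antisymmetrize, mul_comm]

/-- The linear map `ℚ[X] → B_{r,n} ^ r`, `X ^ a ↦ (S_{a - (r - 1 - i)})_i`. -/
def segreVec (r : ℕ) (n : ℕ∞) : Polynomial ℚ →ₗ[ℚ] (Fin r → B r n) :=
  (Polynomial.basisMonomials ℚ).constr ℚ fun a i =>
    Ideal.Quotient.mk (grassIdeal r n) (coeffZ (segreSeries r) ((a : ℤ) - (r - 1) + (i : ℕ)))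

/-- For a ≥ n the indices a - (r-1) + i all exceed n - r. Thus the column of X^a in the Jacobi–Trudi
matrix vanishes in B_{r,n}, and the columns are functions on V_n. -/
theorem mk_coeffZ_eq_zero (r : ℕ) {n : ℕ∞} {a : ℕ} (ha : n ≤ (a : ℕ∞)) (i : Fin r) :
    Ideal.Quotient.mk (grassIdeal r n)
      (coeffZ (segreSeries r) ((a : ℤ) - (r - 1) + (i : ℕ))) = 0 := by
  rw [coeffZ]
  split_ifs with hneg
  · exact map_zero _
  · rw [segreSeries, PowerSeries.coeff_mk, Ideal.Quotient.eq_zero_iff_mem]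
    refine segre_mem_grassIdeal r n _ (ha.trans_lt ?_)
    have hi := i.2
    exact_mod_cast (by omega : a < ((a : ℤ) - (r - 1) + (i : ℕ)).toNat + r)

theorem segreVec_X_pow (r : ℕ) (n : ℕ∞) (a : ℕ) (i : Fin r) :
    segreVec r n (Polynomial.X ^ a) i = Ideal.Quotient.mk (grassIdeal r n)
      (coeffZ (segreSeries r) ((a : ℤ) - (r - 1) + (i : ℕ))) := by
  have h : (Polynomial.X ^ a : Polynomial ℚ) = Polynomial.basisMonomials ℚ a := by
    rw [Polynomial.coe_basisMonomials, Polynomial.X_pow_eq_monomial]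
  rw [h, segreVec, Module.Basis.constr_basis]

theorem segreVec_eq_zero (r : ℕ) {n : ℕ∞} {p : Polynomial ℚ} (hp : p ∈ truncIdeal n) :
    segreVec r n p = 0 := by
  rw [p.as_sum_range_C_mul_X_pow, map_sum]
  refine Finset.sum_eq_zero fun a _ => ?_
  rw [← Polynomial.smul_eq_C_mul, map_smul]
  by_cases ha : (a : ℕ∞) < n
  · rw [coeff_eq_zero_of_mem ha hp, zero_smul]
  · have : segreVec r n (Polynomial.X ^ a) = 0 := by
      funext i
      rw [segreVec_X_pow, mk_coeffZ_eq_zero r (not_lt.1 ha)]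
      rfl
    rw [this, smul_zero]

/-- The map induced by `segreVec` on `V_n`. -/
def segreVecQuot (r : ℕ) (n : ℕ∞) : V n →ₗ[ℚ] (Fin r → B r n) :=
  (Submodule.liftQ ((truncIdeal n).restrictScalars ℚ) (segreVec r n)
    (fun _ hp => segreVec_eq_zero r hp)) ∘ₗ
    (Submodule.Quotient.restrictScalarsEquiv ℚ (truncIdeal n)).symm.toLinearMap

theorem segreVecQuot_vec (r : ℕ) (n : ℕ∞) (a : ℕ) :
    segreVecQuot r n (vec n a) = segreVec r n (Polynomial.X ^ a) := rfl

/-- The determinant as a `ℚ`-alternating map. -/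
def detAlternating (r : ℕ) (A : Type*) [CommRing A] [Algebra ℚ A] : (Fin r → A) [⋀^Fin r]→ₗ[ℚ] A :=
  { (Matrix.detRowAlternating (n := Fin r) (R := A)).toMultilinearMap.restrictScalars ℚ with
    map_eq_zero_of_eq' := (Matrix.detRowAlternating (n := Fin r) (R := A)).map_eq_zero_of_eq' }

/-- The linear map `⋀ V_n → B_{r,n}` with `X ^ {a_1} ∧ ⋯ ∧ X ^ {a_r} ↦ J_a`, left inverse to
`fermion r n`. -/
def bosonHom (r : ℕ) (n : ℕ∞) : Ext n →ₗ[ℚ] B r n :=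
  ExteriorAlgebra.liftAlternating (Function.update 0 r
    ((detAlternating r (B r n)).compLinearMap (segreVecQuot r n)))

theorem bosonHom_ιMulti (r : ℕ) (n : ℕ∞) (a : Fin r → ℕ) :
    bosonHom r n (ExteriorAlgebra.ιMulti ℚ r fun i => vec n (a i))
      = Ideal.Quotient.mk (grassIdeal r n) (jacobiTrudi r a) := by
  rw [bosonHom, ExteriorAlgebra.liftAlternating_apply_ιMulti, Function.update_self, jacobiTrudi,
    RingHom.map_det, ← Matrix.det_transpose]
  change Matrix.det _ = _
  congr 1
  ext1 i j
  simp only [segreVecQuot_vec, Matrix.transpose_apply, RingHom.mapMatrix_apply, Matrix.map_apply,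
    Matrix.of_apply]
  exact segreVec_X_pow r n (a i) j

theorem bosonHom_wedgeMap (r : ℕ) (n : ℕ∞) (g : MvPolynomial (Fin r) ℚ) :
    bosonHom r n (wedgeMap r n g) = Ideal.Quotient.mk (grassIdeal r n) (jacobiTrudiHom r g) := by
  induction g using MvPolynomial.induction_on' with
  | monomial a q =>
    rw [wedgeMap_monomial, map_smul, bosonHom_ιMulti, jacobiTrudiHom_monomial]
    rfl
  | add p q hp hq => rw [map_add, map_add, map_add, map_add, hp, hq]

/-- The identity holds for polynomials already, before passing to the quotient. An explicit left
inverse avoids any dimension count and treats n = ∞ together with finite n. -/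
theorem bosonHom_fermion (r : ℕ) (n : ℕ∞) (P : B r n) : bosonHom r n (fermion r n P) = P := by
  obtain ⟨f, rfl⟩ := Ideal.Quotient.mk_surjective P
  have h : fermion r n (Ideal.Quotient.mk (grassIdeal r n) f)
      = wedgeMap r n (toSymm r f * staircase r) := rfl
  rw [h, bosonHom_wedgeMap, jacobiTrudiHom_toSymm_mul_staircase]

theorem fermion_injective (r : ℕ) (n : ℕ∞) : Function.Injective (fermion r n) :=
  Function.LeftInverse.injective (bosonHom_fermion r n)

/-- Off the range `boson` has arbitrary values; on it, it can be replaced by a map that is visibly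
linear. -/
theorem boson_eq_bosonHom {r : ℕ} {n : ℕ∞} {u : Ext n} (hu : u ∈ LinearMap.range (fermion r n)) :
    boson r n u = bosonHom r n u := by
  obtain ⟨P, rfl⟩ := hu
  rw [bosonHom_fermion, boson, Function.leftInverse_invFun (fermion_injective r n)]

end LeftInverse

/-! ### The action of words on B_{r,n}, and its antisymmetry -/

section WordAction

variable {r h k : ℕ}

theorem add_sub_add (hk : k ≤ r + h) : k + (r + h - k) = r + h := by omega

/-- `X ^ {a_1} ∧ ⋯ ∧ X ^ {a_h} ∧ (∂ ^ {j_k} ⌟ ⋯ (∂ ^ {j_1} ⌟ X ^ {b_1} ∧ ⋯ ∧ X ^ {b_r}))` is the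
image of a determinant. -/
theorem wedge_contract_eq_fermion (n : ℕ∞) (hk : k ≤ r + h) (a : Fin h → ℕ) (b : Fin r → ℕ)
    (js : Fin k → ℕ) :
    (ExteriorAlgebra.ιMulti ℚ h fun i => vec n (a i)) *
        contract n (List.ofFn js).reverse (ExteriorAlgebra.ιMulti ℚ r fun i => vec n (b i))
      = fermion (r + h - k) n ((-1) ^ (h * k) * Ideal.Quotient.mk _
          ((contractMatrix (segreSeries (r + h - k)) n (r + h - k) a b js).submatrix
            (blockEquiv (add_sub_add hk)).symm (blockEquiv (Nat.add_comm h r)).symm).det) := by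
  have key := preFermion_det_contractMatrix (r + h - k) n k (add_sub_add hk) (Nat.add_comm h r)
    a b js
  have hs : ((-1 : B (r + h - k) n) ^ (h * k)) = algebraMap ℚ _ ((-1) ^ (h * k)) := by simp
  rw [hs, ← Algebra.smul_def, map_smul, fermion_mk, key, smul_smul, ← mul_pow]
  simp

theorem wedge_contract_mem_range (n : ℕ∞) (hk : k ≤ r + h) (a : Fin h → ℕ) (js : Fin k → ℕ)
    (P : B r n) :
    (ExteriorAlgebra.ιMulti ℚ h fun i => vec n (a i)) *
        contract n (List.ofFn js).reverse (fermion r n P)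
      ∈ LinearMap.range (fermion (r + h - k) n) := by
  rw [← contractHom_apply]
  refine Submodule.span_induction (p := fun u _ => (ExteriorAlgebra.ιMulti ℚ h fun i => vec n (a i))
    * contractHom n (List.ofFn js).reverse u ∈ LinearMap.range (fermion (r + h - k) n))
    ?_ ?_ ?_ ?_ (fermion_mem_span r n P)
  · rintro _ ⟨b, rfl⟩
    rw [contractHom_apply, wedge_contract_eq_fermion n hk]
    exact ⟨_, rfl⟩
  · rw [map_zero, mul_zero]; exact zero_mem _
  · intro u v _ _ hu hv
    rw [map_add, mul_add]; exact add_mem hu hv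
  · intro c u _ hu
    rw [map_smul, mul_smul_comm]; exact Submodule.smul_mem _ _ hu

variable (r h k) in
/-- `P ↦ X ^ {a_1} ∧ ⋯ ∧ X ^ {a_h} ∧ (∂ ^ {j_k} ⌟ ⋯ (∂ ^ {j_1} ⌟ P))` as a linear map
`B_{r,n} → B_{r+h-k,n}`. -/
def actHom (n : ℕ∞) (a : Fin h → ℕ) (js : Fin k → ℕ) : B r n →ₗ[ℚ] B (r + h - k) n :=
  bosonHom (r + h - k) n ∘ₗ
    LinearMap.mulLeft ℚ (ExteriorAlgebra.ιMulti ℚ h fun i => vec n (a i)) ∘ₗ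
    contractHom n (List.ofFn js).reverse ∘ₗ fermion r n

theorem actHom_apply (n : ℕ∞) (a : Fin h → ℕ) (js : Fin k → ℕ) (P : B r n) :
    actHom r h k n a js P = bosonHom (r + h - k) n ((ExteriorAlgebra.ιMulti ℚ h fun i => vec n (a i))
      * contract n (List.ofFn js).reverse (fermion r n P)) := by
  rw [← contractHom_apply]; rfl

theorem actHom_jacobiTrudi (n : ℕ∞) (hk : k ≤ r + h) (a : Fin h → ℕ) (b : Fin r → ℕ)
    (js : Fin k → ℕ) :
    actHom r h k n a js (Ideal.Quotient.mk _ (jacobiTrudi r b))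
      = (-1) ^ (h * k) * Ideal.Quotient.mk _
          ((contractMatrix (segreSeries (r + h - k)) n (r + h - k) a b js).submatrix
            (blockEquiv (add_sub_add hk)).symm (blockEquiv (Nat.add_comm h r)).symm).det := by
  rw [actHom_apply, fermion_mk, preFermion_jacobiTrudi, wedge_contract_eq_fermion n hk,
    bosonHom_fermion]

theorem contractAct_eq (n : ℕ∞) (hk : k ≤ r + h) (lam : Fin h → ℕ) (js : Fin k → ℕ) (P : B r n) :
    contractAct r h k n lam js P = actHom r h k n (fun j => h - 1 - (j : ℕ) + lam j) js P := by
  rw [contractAct, wedgeVec, boson_eq_bosonHom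
    (wedge_contract_mem_range n hk (fun j => h - 1 - (j : ℕ) + lam j) js P), actHom_apply]

/-- In ∂^k(μ) the last letter acts first, whereas `actHom` applies `js 0` first. This reversal is
the source of the sign of `Fin.revPerm` later on. -/
theorem wordAct_eq (n : ℕ∞) (hk : k ≤ r + h) (lam : Fin h → ℕ) (mu : Fin k → ℕ) (P : B r n) :
    wordAct r h k n lam mu P = actHom r h k n (fun j => h - 1 - (j : ℕ) + lam j)
      (fun j => (k - 1 - (j.rev : ℕ)) + mu j.rev) P := by
  have h1 : (List.ofFn fun j : Fin k => k - 1 - (j : ℕ) + mu j)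
      = (List.ofFn fun j : Fin k => (k - 1 - (j.rev : ℕ)) + mu j.rev).reverse := by
    refine List.ext_getElem (by simp) fun i h1 h2 => ?_
    simp only [List.length_ofFn] at h1
    have : Fin.rev ⟨k - 1 - i, by omega⟩ = (⟨i, h1⟩ : Fin k) := by
      ext; rw [Fin.val_rev]; simp only; omega
    simp [this]
    omega
  rw [wordAct, h1, ← contractAct_eq n hk, contractAct]

theorem actHom_perm_left (n : ℕ∞) (a : Fin h → ℕ) (js : Fin k → ℕ) (σ : Equiv.Perm (Fin h)) :
    actHom r h k n (a ∘ σ) js = (Equiv.Perm.sign σ : ℤ) • actHom r h k n a js := by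
  refine LinearMap.ext fun P => ?_
  rw [LinearMap.smul_apply, actHom_apply, actHom_apply]
  have := AlternatingMap.map_perm (ExteriorAlgebra.ιMulti ℚ h) (fun i => vec n (a i)) σ
  rw [show (fun i => vec n ((a ∘ σ) i)) = (fun i => vec n (a i)) ∘ σ from rfl, this,
    Units.smul_def, smul_mul_assoc, map_zsmul]

/-- On a Jacobi–Trudi element the action is a determinant, and permuting the contractions permutes
its first k rows. -/
theorem actHom_perm_right (n : ℕ∞) (hk : k ≤ r + h) (a : Fin h → ℕ) (js : Fin k → ℕ)
    (σ : Equiv.Perm (Fin k)) :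
    actHom r h k n a (js ∘ σ) = (Equiv.Perm.sign σ : ℤ) • actHom r h k n a js := by
  have hJ : ∀ b : Fin r → ℕ, actHom r h k n a (js ∘ σ) (Ideal.Quotient.mk _ (jacobiTrudi r b))
      = ((Equiv.Perm.sign σ : ℤ) • actHom r h k n a js)
        (Ideal.Quotient.mk _ (jacobiTrudi r b)) := by
    intro b
    rw [LinearMap.smul_apply, actHom_jacobiTrudi n hk, actHom_jacobiTrudi n hk]
    set e := blockEquiv (add_sub_add hk)
    set N := (contractMatrix (segreSeries (r + h - k)) n (r + h - k) a b js).submatrix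
      e.symm (blockEquiv (Nat.add_comm h r)).symm with hN
    have hm : (contractMatrix (segreSeries (r + h - k)) n (r + h - k) a b (js ∘ σ)).submatrix
        e.symm (blockEquiv (Nat.add_comm h r)).symm
        = N.submatrix (e.permCongr (Equiv.Perm.sumCongr σ 1)) id := by
      ext1 x y
      obtain ⟨x, rfl⟩ := e.surjective x
      obtain ⟨y, rfl⟩ := (blockEquiv (Nat.add_comm h r)).surjective y
      rcases x with x | x <;> rcases y with y | y <;>
        simp [hN, contractMatrix, Equiv.permCongr_apply]
    rw [hm, Matrix.det_permute, Equiv.Perm.sign_permCongr, Equiv.Perm.sign_sumCongr,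
      Equiv.Perm.sign_one, mul_one, map_mul, map_intCast, zsmul_eq_mul]
    ring
  refine LinearMap.ext fun P => ?_
  obtain ⟨f, rfl⟩ := Ideal.Quotient.mk_surjective P
  -- This exhibits f as a linear combination of Jacobi–Trudi determinants, to which `hJ` applies.
  rw [← jacobiTrudiHom_toSymm_mul_staircase r f]
  induction toSymm r f * staircase r using MvPolynomial.induction_on' with
  | monomial b q =>
    rw [jacobiTrudiHom_monomial]
    have : (Ideal.Quotient.mk (grassIdeal r n)) (q • jacobiTrudi r b)
      = q • Ideal.Quotient.mk (grassIdeal r n) (jacobiTrudi r b) := rfl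
    rw [this, map_smul, map_smul, hJ]
  | add p q hp hq => rw [map_add, map_add, map_add, map_add, hp, hq]

theorem actHom_eq_zero_left (n : ℕ∞) (a : Fin h → ℕ) (js : Fin k → ℕ) (i : Fin h)
    (hi : n ≤ (a i : ℕ∞)) : actHom r h k n a js = 0 := by
  refine LinearMap.ext fun P => ?_
  rw [actHom_apply, AlternatingMap.map_coord_zero _ i (vec_eq_zero hi), zero_mul, map_zero]
  rfl

theorem contract_eq_zero (n : ℕ∞) (js : List ℕ) (j : ℕ) (hj : j ∈ js) (hn : n ≤ (j : ℕ∞))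
    (u : Ext n) : contract n js u = 0 := by
  induction js with
  | nil => simp at hj
  | cons l js ih =>
    rcases List.mem_cons.1 hj with rfl | hj
    · rw [contract, List.foldr_cons, dual, dif_neg (not_lt.2 hn), map_zero]
      rfl
    · have := ih hj
      rw [contract] at this ⊢
      rw [List.foldr_cons, this, map_zero]

theorem actHom_eq_zero_right (n : ℕ∞) (a : Fin h → ℕ) (js : Fin k → ℕ) (i : Fin k)
    (hi : n ≤ (js i : ℕ∞)) : actHom r h k n a js = 0 := by
  refine LinearMap.ext fun P => ?_
  rw [actHom_apply, contract_eq_zero n _ (js i) (by simp) hi, mul_zero, map_zero]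
  rfl

end WordAction

/-! ### Elementary and complete symmetric functions; the polynomials y_l -/

section SymmetricSeries

variable {R : Type} [CommRing R] [Algebra ℚ R] {p : ℕ}

theorem sum_elem_mul_pow (v : Fin p → R) (x : R) :
    ∑ a ∈ Finset.range (p + 1), (-1) ^ a * elem v a * x ^ a = ∏ j, (1 - v j * x) := by
  have h : ∏ j : Fin p, (1 - v j * x) = ∏ j : Fin p, (1 + (-(v j * x))) := by
    simp [sub_eq_add_neg]
  rw [h, Finset.prod_one_add, Finset.sum_powerset, Finset.card_univ, Fintype.card_fin]
  refine Finset.sum_congr rfl fun a _ => ?_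
  rw [elem, esymm, map_sum, Finset.mul_sum, Finset.sum_mul]
  refine Finset.sum_congr rfl fun s hs => ?_
  have hc := (Finset.mem_powersetCard.1 hs).2
  rw [Finset.prod_neg, Finset.prod_mul_distrib, Finset.prod_const, hc, map_prod]
  simp only [aeval_X]
  ring

theorem elem_eq_zero (v : Fin p → R) {a : ℕ} (ha : p < a) : elem v a = 0 := by
  rw [elem, esymm, Finset.powersetCard_eq_empty.2 (by simpa using ha)]
  simp

theorem elem_map {R' : Type} [CommRing R'] [Algebra ℚ R'] (φ : R →ₐ[ℚ] R') (v : Fin p → R) (a : ℕ) :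
    elem (fun i => φ (v i)) a = φ (elem v a) := by
  rw [elem, elem, ← AlgHom.comp_apply]
  congr 1
  exact MvPolynomial.algHom_ext (by simp)

theorem coeff_prod_one_sub (v : Fin p → R) (a : ℕ) :
    PowerSeries.coeff a (∏ j, (1 - PowerSeries.C (v j) * PowerSeries.X)) = (-1) ^ a * elem v a := by
  have hC : ∀ a, elem (fun j => PowerSeries.C (v j)) a = PowerSeries.C (elem v a) := fun a =>
    elem_map (IsScalarTower.toAlgHom ℚ R (PowerSeries R)) v a
  rw [← sum_elem_mul_pow (fun j => PowerSeries.C (v j)), map_sum]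
  simp only [hC, ← map_one PowerSeries.C, ← map_neg PowerSeries.C, ← map_pow PowerSeries.C,
    ← map_mul PowerSeries.C, PowerSeries.coeff_C_mul, PowerSeries.coeff_X_pow, mul_ite, mul_one,
    mul_zero]
  rw [Finset.sum_ite_eq]
  split_ifs with h
  · rfl
  · rw [elem_eq_zero v (by simpa using h), mul_zero]

omit [Algebra ℚ R] in
theorem mk_pow_mul_one_sub (x : R) :
    PowerSeries.mk (fun i => x ^ i) * (1 - PowerSeries.C x * PowerSeries.X) = 1 := by
  ext q
  rw [mul_sub, mul_one, map_sub, mul_comm, mul_assoc, PowerSeries.coeff_C_mul, mul_comm]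
  cases q with
  | zero => simp
  | succ q =>
    rw [PowerSeries.coeff_succ_X_mul]; simp [PowerSeries.coeff_one, pow_succ]

theorem prod_mk_pow_eq_hsymm (n : ℕ) :
    PowerSeries.coeff n (∏ j : Fin p, PowerSeries.mk fun i => (X j : MvPolynomial (Fin p) ℚ) ^ i)
      = hsymm (Fin p) ℚ n := by
  rw [PowerSeries.coeff_prod, hsymm]
  simp only [PowerSeries.coeff_mk]
  refine (Finset.sum_bij' (fun (s : Sym (Fin p) n) _ => Multiset.toFinsupp s.1)
    (fun d hd => ⟨Finsupp.toMultiset d, ?_⟩) ?_ ?_ ?_ ?_ ?_).symm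
  · rw [Finsupp.card_toMultiset]
    rw [Finset.mem_finsuppAntidiag] at hd
    rw [Finsupp.sum_fintype _ _ (by simp)]
    exact hd.1
  · intro s _
    rw [Finset.mem_finsuppAntidiag]
    refine ⟨?_, Finset.subset_univ _⟩
    change ∑ j, Multiset.count j s.1 = n
    rw [Multiset.sum_count_eq_card (by simp)]
    exact s.2
  · intro d _; exact Finset.mem_univ _
  · intro s _; exact Subtype.ext (by simp)
  · intro d hd; simp
  · intro s _
    rw [Finset.prod_multiset_map_count]
    simp only [Multiset.toFinsupp_apply]
    refine Finset.prod_subset (Finset.subset_univ _) fun j _ hj => ?_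
    rw [Multiset.count_eq_zero.2 (by simpa using hj), pow_zero]

theorem mk_compl_mul_prod (v : Fin p → R) :
    PowerSeries.mk (compl v) * ∏ j, (1 - PowerSeries.C (v j) * PowerSeries.X) = 1 := by
  have h : PowerSeries.mk (compl v) = ∏ j : Fin p, PowerSeries.mk fun i => v j ^ i := by
    have h2 : PowerSeries.mk (hsymm (Fin p) ℚ)
        = ∏ j : Fin p, PowerSeries.mk fun i => (X j : MvPolynomial (Fin p) ℚ) ^ i := by
      ext1 n; rw [PowerSeries.coeff_mk, prod_mk_pow_eq_hsymm]
    have h3 := congrArg (PowerSeries.map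
      ((aeval v : MvPolynomial (Fin p) ℚ →ₐ[ℚ] R) : MvPolynomial (Fin p) ℚ →+* R)) h2
    rw [map_prod] at h3
    have h4 : ∀ j, PowerSeries.map ((aeval v : MvPolynomial (Fin p) ℚ →ₐ[ℚ] R) :
        MvPolynomial (Fin p) ℚ →+* R) (PowerSeries.mk fun i => X j ^ i)
        = PowerSeries.mk fun i => v j ^ i := by
      intro j; ext1 n; simp
    simp only [h4] at h3
    rw [← h3]
    ext1 n
    simp [compl]
  rw [h, ← Finset.prod_mul_distrib]
  exact Finset.prod_eq_one fun j _ => mk_pow_mul_one_sub (v j)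

theorem U_eq_coeff (v : Fin p → R) (j l : ℕ) :
    U v j l = PowerSeries.coeff j ((∏ j, (1 - PowerSeries.C (v j) * PowerSeries.X))
      * PowerSeries.mk fun i => compl v (l + i)) := by
  rw [PowerSeries.coeff_mul, Finset.Nat.sum_antidiagonal_eq_sum_range_succ_mk, U]
  refine Finset.sum_congr rfl fun a _ => ?_
  rw [coeff_prod_one_sub, PowerSeries.coeff_mk]

/-- The nodal coefficients turn h_{N-p+1+b+l} into t_i^{N+l}. Hence the combination of the U_{j,·}
is the coefficient of ζ^j in ∏ (1 - t_j ζ) · t_i^N / (1 - t_i ζ) = t_i^N ∏_{j≠i} (1 - t_j ζ). This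
has degree below p, so the truncation j < p in y loses nothing. -/
theorem sum_nodal_mul_y (t : Fin p → R) {N : ℕ} (hN : p ≤ N) (u : R) (i : Fin p) :
    ∑ b : Fin p, nodalMatrix t b i * y t (N - p + 1 + (b : ℕ)) u
      = t i ^ N * ∏ j ∈ Finset.univ.erase i, (1 - t j * u) := by
  have hp : 0 < p := i.pos
  set P : PowerSeries R := ∏ j, (1 - PowerSeries.C (t j) * PowerSeries.X) with hP
  set Q : PowerSeries R := ∏ j ∈ Finset.univ.erase i, (1 - PowerSeries.C (t j) * PowerSeries.X)
    with hQ
  have hPQ : P = (1 - PowerSeries.C (t i) * PowerSeries.X) * Q :=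
    (Finset.mul_prod_erase _ _ (Finset.mem_univ i)).symm
  have hU : ∀ j, ∑ b : Fin p, nodalMatrix t b i * U t j (N - p + 1 + (b : ℕ))
      = t i ^ N * PowerSeries.coeff j Q := by
    intro j
    have hser : ∑ b : Fin p, PowerSeries.C (nodalMatrix t b i) *
        PowerSeries.mk (fun i => compl t (N - p + 1 + (b : ℕ) + i))
        = PowerSeries.C (t i ^ N) * PowerSeries.mk (fun l => t i ^ l) := by
      ext1 l
      rw [map_sum, PowerSeries.coeff_C_mul, PowerSeries.coeff_mk, ← pow_add,
        ← sum_nodal_mul_coeffZ t (mk_compl_mul_prod t) i (N + l)]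
      refine Finset.sum_congr rfl fun b _ => ?_
      rw [PowerSeries.coeff_C_mul, PowerSeries.coeff_mk, coeffZ, if_neg (by omega),
        PowerSeries.coeff_mk]
      congr 2
      omega
    calc _ = PowerSeries.coeff j (P * ∑ b : Fin p, PowerSeries.C (nodalMatrix t b i) *
          PowerSeries.mk (fun i => compl t (N - p + 1 + (b : ℕ) + i))) := by
          rw [Finset.mul_sum, map_sum]
          refine Finset.sum_congr rfl fun b _ => ?_
          rw [U_eq_coeff, ← PowerSeries.coeff_C_mul]
          congr 1
          ring
      _ = PowerSeries.coeff j (PowerSeries.C (t i ^ N) * (Q * (PowerSeries.mk (fun l => t i ^ l)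
          * (1 - PowerSeries.C (t i) * PowerSeries.X)))) := by
          rw [hser, hPQ]
          congr 1
          ring
      _ = _ := by rw [mk_pow_mul_one_sub, mul_one, PowerSeries.coeff_C_mul]
  have hQc : ∀ j, PowerSeries.coeff j Q
      = ∑ b : Fin p, if j = p - 1 - (b : ℕ) then nodalMatrix t b i else 0 := by
    intro j
    rw [hQ, ← sum_nodal_mul_pow_sub (fun j => PowerSeries.C (t j)), map_sum]
    refine Finset.sum_congr rfl fun b _ => ?_
    have hmap := congrFun (congrFun (nodalMatrix_map PowerSeries.C t) b) i
    rw [Matrix.map_apply] at hmap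
    rw [hmap, PowerSeries.coeff_C_mul, PowerSeries.coeff_X_pow]
    simp
  simp only [y, Finset.mul_sum]
  rw [Finset.sum_comm]
  calc _ = ∑ j ∈ Finset.range p, (t i ^ N * PowerSeries.coeff j Q) * u ^ j := by
        refine Finset.sum_congr rfl fun j _ => ?_
        rw [← hU, Finset.sum_mul]
        exact Finset.sum_congr rfl fun b _ => by ring
    _ = t i ^ N * ∑ b : Fin p, ∑ j ∈ Finset.range p,
        (if j = p - 1 - (b : ℕ) then nodalMatrix t b i * u ^ j else 0) := by
        rw [Finset.sum_comm, Finset.mul_sum]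
        refine Finset.sum_congr rfl fun j _ => ?_
        rw [hQc, mul_assoc, Finset.sum_mul]
        congr 1
        exact Finset.sum_congr rfl fun b _ => by rw [ite_mul, zero_mul]
    _ = _ := by
        rw [← sum_nodal_mul_pow_sub]
        congr 1
        refine Finset.sum_congr rfl fun b _ => ?_
        rw [Finset.sum_ite_eq', if_pos]
        rw [Finset.mem_range]
        omega

end SymmetricSeries

/-! ### Comparison of the two block matrices over the roots τ -/

section BlockIdentity

variable {R : Type} [CommRing R] [Algebra ℚ R] {k m h r : ℕ}

/-- `∑_a (-1) ^ a e_a(v) S_{j+a}`, where `f = ∑ S_j z ^ j`. -/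
def twist {p : ℕ} (f : PowerSeries R) (v : Fin p → R) (j : ℤ) : R :=
  ∑ a ∈ Finset.range (p + 1), (-1) ^ a * elem v a * coeffZ f (j + a)

variable (k m) in
/-- The block matrix of `𝔻`, with the row of index `a ≤ k` multiplied by `w_a ^ {1-r}`. -/
def twistedBlock (f : PowerSeries R) (z : Fin h → R) (t : Fin r → R) (u : Fin k → R)
    (ye : Fin k → Fin r → R) : Matrix (Fin k ⊕ Fin m) (Fin h ⊕ Fin r) R :=
  Matrix.fromBlocks 0 (Matrix.of fun a b => u a ^ (r - 1 - (b : ℕ)) * ye a b)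
    (Matrix.of fun i b => twist f t ((h : ℤ) - m + (i : ℕ) - (b : ℕ)))
    (Matrix.of fun i b => twist f z ((r : ℤ) - m + (i : ℕ) - (b : ℕ)))

variable (m) in
/-- The block matrix with blocks `0`, `g`, `z_j ^ {m-1-i} S(z_j)`, `t_j ^ {m-1-i} S(t_j)`. -/
def powerBlock (z : Fin h → R) (t : Fin r → R) (Sz : Fin h → R) (St : Fin r → R)
    (g : Fin k → Fin r → R) : Matrix (Fin k ⊕ Fin m) (Fin h ⊕ Fin r) R :=
  Matrix.fromBlocks 0 (Matrix.of g)
    (Matrix.of fun i b => z b ^ (m - 1 - (i : ℕ)) * Sz b)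
    (Matrix.of fun i b => t b ^ (m - 1 - (i : ℕ)) * St b)

/-- The nodal matrix of τ turns S_{l-(m-1)+i} into τ_s^l, so shifting the index by a multiplies by
τ_s^a, and the twist sums to ∏ (1 - v_j τ_s). -/
theorem sum_nodal_mul_twist {p q : ℕ} {f : PowerSeries R} (τ : Fin m → R)
    (hf : f * ∏ j, (1 - PowerSeries.C (τ j) * PowerSeries.X) = 1) (v : Fin p → R) (s : Fin m)
    (b : Fin q) :
    ∑ i : Fin m, nodalMatrix τ i s * twist f v ((q : ℤ) - m + (i : ℕ) - (b : ℕ))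
      = τ s ^ (q - 1 - (b : ℕ)) * ∏ j, (1 - v j * τ s) := by
  have hb := b.2
  simp only [twist, Finset.mul_sum]
  rw [Finset.sum_comm, ← sum_elem_mul_pow, Finset.mul_sum]
  refine Finset.sum_congr rfl fun a _ => ?_
  have h := sum_nodal_mul_coeffZ τ hf s (q - 1 - (b : ℕ) + a)
  calc _ = (-1) ^ a * elem v a * ∑ i : Fin m, nodalMatrix τ i s
        * coeffZ f (((q - 1 - (b : ℕ) + a : ℕ) : ℤ) - (m - 1) + (i : ℕ)) := by
        rw [Finset.mul_sum]
        refine Finset.sum_congr rfl fun i _ => ?_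
        rw [show ((q : ℤ) - m + (i : ℕ) - (b : ℕ) + a)
          = (((q - 1 - (b : ℕ) + a : ℕ) : ℤ) - (m - 1) + (i : ℕ)) by omega]
        ring
    _ = _ := by rw [h, pow_add]; ring

/-- On the left the twisted entries become τ_s^{q-1-b} ∏ (1 - v_j τ_s), and the nodal matrix of w,
with w = z or t and v the other one, then gives ∏_j (1 - v_j τ_s) ∏_{j≠i} (1 - w_j τ_s). On the
right the nodal matrix of τ gives ∏_{l≠s} (1 - τ_l w_i) · S(w_i) = 1 / (1 - τ_s w_i). The two agree
up to the diagonal factor ∏ (1 - z_j τ_s) ∏ (1 - t_j τ_s). -/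
theorem block_identity {f : PowerSeries R} {τ : Fin m → R}
    (hf : f * ∏ j, (1 - PowerSeries.C (τ j) * PowerSeries.X) = 1)
    {z : Fin h → R} {t : Fin r → R} {u : Fin k → R} {Sz : Fin h → R} {St : Fin r → R}
    (hz : ∀ i, Sz i * ∏ s, (1 - τ s * z i) = 1) (ht : ∀ i, St i * ∏ s, (1 - τ s * t i) = 1)
    {ye g : Fin k → Fin r → R}
    (hg : ∀ a i, ∑ b : Fin r, nodalMatrix t b i * (u a ^ (r - 1 - (b : ℕ)) * ye a b)
      = (∏ j, (1 - t j * u a)) * g a i) :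
    Matrix.fromBlocks (1 : Matrix (Fin k) (Fin k) R) 0 0 (nodalMatrix τ).transpose
        * twistedBlock k m f z t u ye
        * Matrix.fromBlocks (nodalMatrix z) 0 0 (nodalMatrix t)
      = Matrix.fromBlocks (Matrix.diagonal fun a => ∏ j, (1 - t j * u a)) 0 0
          (Matrix.diagonal (fun s => (∏ j, (1 - z j * τ s)) * ∏ j, (1 - t j * τ s))
            * (nodalMatrix τ).transpose)
        * powerBlock m z t Sz St g := by
  have side : ∀ {p q : ℕ} (v : Fin p → R) (w : Fin q → R) (Sw : Fin q → R)
      (_ : ∀ i, Sw i * ∏ s, (1 - τ s * w i) = 1) (s : Fin m) (i : Fin q),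
      ∑ b : Fin q, (∑ l : Fin m, nodalMatrix τ l s * twist f v ((q : ℤ) - m + (l : ℕ) - (b : ℕ)))
        * nodalMatrix w b i
      = ((∏ j, (1 - w j * τ s)) * ∏ j, (1 - v j * τ s))
        * ∑ l : Fin m, nodalMatrix τ l s * (w i ^ (m - 1 - (l : ℕ)) * Sw i) := by
    intro p q v w Sw hw s i
    simp only [sum_nodal_mul_twist τ hf]
    have h1 : ∑ l : Fin m, nodalMatrix τ l s * (w i ^ (m - 1 - (l : ℕ)) * Sw i)
        = (∏ j ∈ Finset.univ.erase s, (1 - τ j * w i)) * Sw i := by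
      rw [← sum_nodal_mul_pow_sub, Finset.sum_mul]
      exact Finset.sum_congr rfl fun b _ => by ring
    have h2 : ∑ b : Fin q, τ s ^ (q - 1 - (b : ℕ)) * (∏ j, (1 - v j * τ s)) * nodalMatrix w b i
        = (∏ j, (1 - v j * τ s)) * ∏ j ∈ Finset.univ.erase i, (1 - w j * τ s) := by
      rw [← sum_nodal_mul_pow_sub, Finset.mul_sum]
      exact Finset.sum_congr rfl fun b _ => by ring
    have h3 := hw i
    rw [← Finset.mul_prod_erase _ _ (Finset.mem_univ s)] at h3
    rw [h1, h2, ← Finset.mul_prod_erase _ (fun j => 1 - w j * τ s) (Finset.mem_univ i)]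
    linear_combination -((∏ j, (1 - v j * τ s)) * ∏ j ∈ Finset.univ.erase i, (1 - w j * τ s)) * h3
  rw [twistedBlock, powerBlock, Matrix.fromBlocks_multiply, Matrix.fromBlocks_multiply,
    Matrix.fromBlocks_multiply]
  simp only [Matrix.zero_mul, Matrix.mul_zero, add_zero, zero_add, Matrix.one_mul]
  congr 1
  · ext a i
    rw [Matrix.mul_apply, Matrix.diagonal_mul, Matrix.of_apply, ← hg]
    exact Finset.sum_congr rfl fun b _ => by rw [Matrix.of_apply, mul_comm]
  · ext s i
    rw [Matrix.mul_assoc (Matrix.diagonal _), Matrix.diagonal_mul, Matrix.mul_apply,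
      Matrix.mul_apply]
    simp only [Matrix.mul_apply, Matrix.transpose_apply, Matrix.of_apply]
    exact side t z Sz hz s i
  · ext s i
    rw [Matrix.mul_assoc (Matrix.diagonal _), Matrix.diagonal_mul, Matrix.mul_apply,
      Matrix.mul_apply]
    simp only [Matrix.mul_apply, Matrix.transpose_apply, Matrix.of_apply]
    rw [mul_comm (∏ j, (1 - z j * τ s))]
    exact side z t St ht s i

/-- Determinants of `block_identity`: det (nodal τ) occurs on both sides and is cancelled, and the
products ∏ (1 - w_j τ_s) are inverse to ∏ S(w_i). The bijections `er` and `ec` are needed because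
the row blocks k + m and the column blocks h + r have different sizes. -/
theorem det_twistedBlock {f : PowerSeries R} {τ : Fin m → R}
    (hf : f * ∏ j, (1 - PowerSeries.C (τ j) * PowerSeries.X) = 1)
    (hτ : IsLeftRegular (nodalMatrix τ).det)
    {z : Fin h → R} {t : Fin r → R} {u : Fin k → R} {Sz : Fin h → R} {St : Fin r → R}
    (hz : ∀ i, Sz i * ∏ s, (1 - τ s * z i) = 1) (ht : ∀ i, St i * ∏ s, (1 - τ s * t i) = 1)
    {ye g : Fin k → Fin r → R}
    (hg : ∀ a i, ∑ b : Fin r, nodalMatrix t b i * (u a ^ (r - 1 - (b : ℕ)) * ye a b)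
      = (∏ j, (1 - t j * u a)) * g a i)
    {ι : Type} [Fintype ι] [DecidableEq ι] (er : Fin k ⊕ Fin m ≃ ι) (ec : Fin h ⊕ Fin r ≃ ι) :
    ((twistedBlock k m f z t u ye).submatrix er.symm ec.symm).det
        * ((nodalMatrix z).det * (nodalMatrix t).det) * ((∏ i, Sz i) * ∏ i, St i)
      = (∏ a, ∏ j, (1 - t j * u a))
        * ((powerBlock m z t Sz St g).submatrix er.symm ec.symm).det := by
  have h1 := congrArg (fun N => (N.submatrix er.symm ec.symm).det)
    (block_identity hf hz ht hg)
  rw [← Matrix.submatrix_mul_equiv _ _ er.symm ec.symm ec.symm,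
    ← Matrix.submatrix_mul_equiv _ _ er.symm er.symm ec.symm,
    ← Matrix.submatrix_mul_equiv _ _ er.symm er.symm ec.symm, Matrix.det_mul, Matrix.det_mul,
    Matrix.det_mul, Matrix.det_submatrix_equiv_self, Matrix.det_submatrix_equiv_self,
    Matrix.det_submatrix_equiv_self, Matrix.det_fromBlocks_zero₂₁, Matrix.det_fromBlocks_zero₂₁,
    Matrix.det_fromBlocks_zero₂₁, Matrix.det_one, one_mul, Matrix.det_diagonal, Matrix.det_mul,
    Matrix.det_diagonal, Matrix.det_transpose] at h1
  have hS : ∀ {q : ℕ} (w Sw : Fin q → R) (_ : ∀ i, Sw i * ∏ s, (1 - τ s * w i) = 1),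
      (∏ s, ∏ j, (1 - w j * τ s)) * ∏ i, Sw i = 1 := by
    intro q w Sw hw
    rw [Finset.prod_comm, ← Finset.prod_mul_distrib]
    refine Finset.prod_eq_one fun i _ => ?_
    refine Eq.trans ?_ (hw i)
    rw [mul_comm]
    congr 1
    exact Finset.prod_congr rfl fun s _ => by rw [mul_comm (τ s)]
  have hSz := hS z Sz hz
  have hSt := hS t St ht
  rw [Finset.prod_mul_distrib] at h1
  apply hτ
  beta_reduce
  set dD := ((twistedBlock k m f z t u ye).submatrix er.symm ec.symm).det
  set dN := ((powerBlock m z t Sz St g).submatrix er.symm ec.symm).det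
  set P := ∏ a, ∏ j, (1 - t j * u a)
  set T := (nodalMatrix τ).det
  set Z1 := ∏ s, ∏ j, (1 - z j * τ s)
  set Z2 := ∏ i, Sz i
  set T1 := ∏ s, ∏ j, (1 - t j * τ s)
  set T2 := ∏ i, St i
  linear_combination Z2 * T2 * h1 + P * T * dN * (T1 * T2 * hSz + hSt)

/-- The term 1 contributes ∏_{j≠i} (1 - t_j u) and the term y contributes (t_i u)^N times the same
product; the difference carries the factor 1 - (t_i u)^N of a truncated geometric series. -/
theorem sum_nodal_mul_one_sub_y (t : Fin r → R) {N : ℕ} (hN : r ≤ N) (u : R) (i : Fin r) {g : R}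
    (hg : g * (1 - t i * u) = 1 - (t i * u) ^ N) :
    ∑ b : Fin r, nodalMatrix t b i * (u ^ (r - 1 - (b : ℕ))
        * (1 - y t (N - r + 1 + (b : ℕ)) u * u ^ (N - r + 1 + (b : ℕ))))
      = (∏ j, (1 - t j * u)) * g := by
  have h1 := sum_nodal_mul_pow_sub t i u
  have h2 := sum_nodal_mul_y t hN u i
  calc _ = ∑ b : Fin r, nodalMatrix t b i * u ^ (r - 1 - (b : ℕ))
        - u ^ N * ∑ b : Fin r, nodalMatrix t b i * y t (N - r + 1 + (b : ℕ)) u := by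
        rw [Finset.mul_sum, ← Finset.sum_sub_distrib]
        refine Finset.sum_congr rfl fun b _ => ?_
        have hb := b.2
        have : u ^ N = u ^ (r - 1 - (b : ℕ)) * u ^ (N - r + 1 + (b : ℕ)) := by
          rw [← pow_add]; congr 1; omega
        rw [this]
        ring
    _ = _ := by
        rw [h1, h2, ← Finset.mul_prod_erase _ (fun j => 1 - t j * u) (Finset.mem_univ i)]
        rw [mul_pow] at hg
        linear_combination -(∏ j ∈ Finset.univ.erase i, (1 - t j * u)) * hg

omit [Algebra ℚ R] in
theorem sum_nodal_mul_one (t : Fin r → R) (u : R) (i : Fin r) {g : R}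
    (hg : g * (1 - t i * u) = 1) :
    ∑ b : Fin r, nodalMatrix t b i * (u ^ (r - 1 - (b : ℕ)) * 1) = (∏ j, (1 - t j * u)) * g := by
  simp only [mul_one]
  rw [sum_nodal_mul_pow_sub, ← Finset.mul_prod_erase _ (fun j => 1 - t j * u) (Finset.mem_univ i)]
  linear_combination -(∏ j ∈ Finset.univ.erase i, (1 - t j * u)) * hg

end BlockIdentity

/-! ### Coefficients of products and determinants in separated variables -/

section DisjointVariables

variable {σ ι R : Type} [CommRing R]

open Classical in
-- Each variable s can occur only in the factor β s, so a monomial splits in one way among the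
-- factors.
theorem coeff_prod_of_disjoint (T : Finset ι) (F : ι → MvPowerSeries σ R) (β : σ → ι)
    (hF : ∀ i d, MvPowerSeries.coeff d (F i) ≠ 0 → ∀ s, d s ≠ 0 → β s = i) (d : σ →₀ ℕ) :
    MvPowerSeries.coeff d (∏ i ∈ T, F i) = if ∀ s, d s ≠ 0 → β s ∈ T then
      ∏ i ∈ T, MvPowerSeries.coeff (d.filter fun s => β s = i) (F i) else 0 := by
  induction T using Finset.induction_on generalizing d with
  | empty =>
    rw [Finset.prod_empty, Finset.prod_empty, MvPowerSeries.coeff_one]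
    congr 1
    simp only [Finset.notMem_empty, imp_false, not_not, eq_iff_iff]
    exact ⟨fun h s => by rw [h]; rfl, fun h => Finsupp.ext h⟩
  | insert i T hi ih =>
    rw [Finset.prod_insert hi, Finset.prod_insert hi, MvPowerSeries.coeff_mul]
    have hsplit : d.filter (fun s => β s = i) + d.filter (fun s => ¬ β s = i) = d :=
      Finsupp.filter_add_filter_not d _
    rw [Finset.sum_eq_single (d.filter (fun s => β s = i), d.filter (fun s => ¬ β s = i))]
    · simp only
      rw [ih]
      have h1 : (∀ s, (d.filter fun s => ¬ β s = i) s ≠ 0 → β s ∈ T)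
          ↔ (∀ s, d s ≠ 0 → β s ∈ insert i T) := by
        refine forall_congr' fun s => ?_
        rw [Finset.mem_insert]
        by_cases hs : β s = i
        · simp [hs]
        · simp [hs]
      rw [if_congr h1 rfl rfl]
      split_ifs
      · congr 1
        refine Finset.prod_congr rfl fun j hj => ?_
        congr 2
        ext s
        have hji : j ≠ i := fun h => hi (h ▸ hj)
        by_cases hs : β s = j
        · simp [hs, hji]
        · simp [hs]
      · rw [mul_zero]
    · rintro ⟨d1, d2⟩ hd hne
      rw [Finset.HasAntidiagonal.mem_antidiagonal] at hd
      by_contra h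
      have h1 := left_ne_zero_of_mul h
      have h2 := right_ne_zero_of_mul h
      simp only at h1 h2 hd
      rw [ih] at h2
      have h2' : ∀ s, d2 s ≠ 0 → β s ∈ T := by
        by_contra hc; rw [if_neg hc] at h2; exact h2 rfl
      apply hne
      have e1 : d1 = d.filter (fun s => β s = i) := by
        ext s
        by_cases hs : β s = i
        · rw [Finsupp.filter_apply, if_pos hs, ← hd, Finsupp.add_apply]
          by_contra hc
          exact hi (hs ▸ h2' s (by omega))
        · rw [Finsupp.filter_apply, if_neg hs]
          by_contra hc
          exact hs (hF i d1 h1 s hc)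
      have e2 : d2 = d.filter (fun s => ¬ β s = i) := by
        have := hsplit.trans hd.symm
        rw [← e1] at this
        exact (add_left_cancel this).symm
      rw [e1, e2]
    · intro h
      exact absurd (Finset.HasAntidiagonal.mem_antidiagonal.2 hsplit) h

open Classical in
-- If each variable belongs to one row or one column, it meets exactly one factor of each term of
-- the Leibniz expansion; taking coefficients therefore commutes with the determinant.
theorem coeff_det_of_disjoint [Fintype ι] [DecidableEq ι] (N : Matrix ι ι (MvPowerSeries σ R))
    (ρ : σ → ι ⊕ ι)
    (hN : ∀ i j d, MvPowerSeries.coeff d (N i j) ≠ 0 →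
      ∀ s, d s ≠ 0 → ρ s = Sum.inl i ∨ ρ s = Sum.inr j) (d : σ →₀ ℕ) :
    MvPowerSeries.coeff d N.det = (Matrix.of fun i j =>
      MvPowerSeries.coeff (d.filter fun s => ρ s = Sum.inl i ∨ ρ s = Sum.inr j) (N i j)).det := by
  rw [Matrix.det_apply, Matrix.det_apply, map_sum]
  refine Finset.sum_congr rfl fun τ _ => ?_
  rw [Units.smul_def, Units.smul_def, map_zsmul]
  congr 1
  -- Factors are indexed by columns; in the term of τ, row i is used in column τ⁻¹ i.
  set β : σ → ι := fun s => Sum.elim (fun i => τ.symm i) id (ρ s) with hβ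
  have hiff : ∀ s j, (ρ s = Sum.inl (τ j) ∨ ρ s = Sum.inr j) ↔ β s = j := by
    intro s j
    simp only [hβ]
    rcases ρ s with i | i
    · simp [Equiv.symm_apply_eq]
    · simp
  rw [coeff_prod_of_disjoint Finset.univ (fun j => N (τ j) j) β
    (fun j d hd s hs => (hiff s j).1 (hN _ _ _ hd s hs)), if_pos (by simp)]
  refine Finset.prod_congr rfl fun j _ => ?_
  simp only [Matrix.of_apply, hiff]
  congr!

theorem coeff_subst_X_ne_zero {s : σ} {f : PowerSeries R} {d : σ →₀ ℕ}
    (h : MvPowerSeries.coeff d (f.subst (MvPowerSeries.X s : MvPowerSeries σ R)) ≠ 0) :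
    ∀ s', d s' ≠ 0 → s' = s := by
  classical
  rw [PowerSeries.coeff_subst_single] at h
  intro s' hs'
  by_contra hne
  have : d = Finsupp.single s (d s) := by
    by_contra hc; rw [if_neg hc] at h; exact h rfl
  rw [this, Finsupp.single_eq_of_ne hne] at hs'
  exact hs' rfl

theorem coeff_single_subst_X (s : σ) (f : PowerSeries R) (l : ℕ) :
    MvPowerSeries.coeff (Finsupp.single s l) (f.subst (MvPowerSeries.X s : MvPowerSeries σ R))
      = PowerSeries.coeff l f := by
  classical
  rw [PowerSeries.coeff_subst_single]
  simp

theorem X_pow_mul_subst_X (s : σ) (f : PowerSeries R) (l : ℕ) :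
    (MvPowerSeries.X s : MvPowerSeries σ R) ^ l * f.subst (MvPowerSeries.X s : MvPowerSeries σ R)
      = (PowerSeries.X ^ l * f).subst (MvPowerSeries.X s : MvPowerSeries σ R) := by
  have hX := PowerSeries.HasSubst.X (S := R) s
  rw [PowerSeries.subst_mul hX, PowerSeries.subst_pow hX, PowerSeries.subst_X hX]

theorem coeff_X_pow_mul_eq_coeffZ (f : PowerSeries R) {m : ℕ} (i : Fin m) (a : ℕ) :
    PowerSeries.coeff a (PowerSeries.X ^ (m - 1 - (i : ℕ)) * f)
      = coeffZ f ((a : ℤ) - (m - 1) + (i : ℕ)) := by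
  have := i.2
  rw [PowerSeries.coeff_X_pow_mul', coeffZ]
  by_cases hq : m - 1 - (i : ℕ) ≤ a
  · rw [if_pos hq, if_neg (by omega)]
    congr 2
    omega
  · rw [if_neg hq, if_pos (by omega)]

theorem coeff_subst_X_mul_X {a b : σ} (hab : a ≠ b) (f : PowerSeries R) (d : σ →₀ ℕ) :
    open Classical in
    MvPowerSeries.coeff d (f.subst (MvPowerSeries.X a * MvPowerSeries.X b : MvPowerSeries σ R))
      = if d = Finsupp.single a (d a) + Finsupp.single b (d a) then PowerSeries.coeff (d a) f
        else 0 := by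
  classical
  have hs : PowerSeries.HasSubst (MvPowerSeries.X a * MvPowerSeries.X b : MvPowerSeries σ R) :=
    hasSubst_of_constantCoeff (by simp)
  have hpow : ∀ l : ℕ, (MvPowerSeries.X a * MvPowerSeries.X b : MvPowerSeries σ R) ^ l
      = MvPowerSeries.monomial (Finsupp.single a l + Finsupp.single b l) 1 := by
    intro l
    rw [mul_pow, MvPowerSeries.X_pow_eq, MvPowerSeries.X_pow_eq,
      MvPowerSeries.monomial_mul_monomial, one_mul]
  have hval : ∀ l : ℕ, (Finsupp.single a l + Finsupp.single b l) a = l := by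
    intro l; simp [Finsupp.single_eq_of_ne hab]
  rw [PowerSeries.coeff_subst hs, finsum_eq_single _ (d a)]
  · rw [hpow, MvPowerSeries.coeff_monomial]
    split_ifs <;> simp
  · intro l hl
    rw [hpow, MvPowerSeries.coeff_monomial, if_neg, smul_zero]
    intro h
    exact hl (by rw [h, hval])

theorem filter_eq_single_add_single {a b : σ} (hab : a ≠ b) (d : σ →₀ ℕ) (P : σ → Prop)
    [DecidablePred P] (hP : ∀ s, P s ↔ s = a ∨ s = b) :
    d.filter P = Finsupp.single a (d a) + Finsupp.single b (d b) := by
  ext s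
  by_cases hs : P s
  · rw [Finsupp.filter_apply_pos _ _ hs]
    rcases (hP s).1 hs with rfl | rfl
    · simp [Finsupp.single_eq_of_ne hab]
    · simp [Finsupp.single_eq_of_ne hab.symm]
  · rw [Finsupp.filter_apply_neg _ _ hs]
    have h := (not_congr (hP s)).1 hs
    rw [not_or] at h
    simp [Finsupp.single_eq_of_ne h.1, Finsupp.single_eq_of_ne h.2]

theorem filter_eq_single {a : σ} (d : σ →₀ ℕ) (P : σ → Prop)
    [DecidablePred P] (hP : ∀ s, P s ↔ s = a) : d.filter P = Finsupp.single a (d a) := by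
  ext s
  by_cases hs : P s
  · rw [Finsupp.filter_apply_pos _ _ hs, (hP s).1 hs]
    simp
  · rw [Finsupp.filter_apply_neg _ _ hs, Finsupp.single_eq_of_ne ((not_congr (hP s)).1 hs)]

end DisjointVariables

/-! ### Generating series of the contraction determinants -/

section PowerBlock

variable {h k r : ℕ} {R : Type} [CommRing R]

/-- `∑_{j < n} z ^ j`. -/
def truncGeom (R : Type) [CommRing R] (n : ℕ∞) : PowerSeries R :=
  open Classical in PowerSeries.mk fun j => if (j : ℕ∞) < n then 1 else 0

variable (h k r R) in
/-- The indeterminates `z_i`. -/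
def zX (i : Fin h) : MvPowerSeries (Vars h k r) R := MvPowerSeries.X (Sum.inl i)

variable (h k r R) in
/-- The indeterminates `w_i⁻¹`. -/
def uX (i : Fin k) : MvPowerSeries (Vars h k r) R := MvPowerSeries.X (Sum.inr (Sum.inl i))

variable (h k r R) in
/-- The indeterminates `t_i`. -/
def tX (i : Fin r) : MvPowerSeries (Vars h k r) R := MvPowerSeries.X (Sum.inr (Sum.inr i))

variable (h k r) in
/-- The block matrix with blocks `0`, `∑_{l < n} (t_j w_a⁻¹) ^ l`, `z_j ^ {m-1-i} f(z_j)`,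
`t_j ^ {m-1-i} f(t_j)`. -/
def seriesBlock (m : ℕ) (n : ℕ∞) (f : PowerSeries R) :
    Matrix (Fin k ⊕ Fin m) (Fin h ⊕ Fin r) (MvPowerSeries (Vars h k r) R) :=
  powerBlock m (zX h k r R) (tX h k r R) (fun i => f.subst (zX h k r R i))
    (fun i => f.subst (tX h k r R i)) fun a i =>
      (truncGeom R n).subst (uX h k r R a * tX h k r R i)

/-- The w_a belong to rows, the z_j and t_j to columns. The coefficient of w_a^{-j} t_i^b in ∑_{l<n}
(t_i w_a^{-1})^l is 1 if b = j < n and 0 otherwise, which is the pairing of ∂^j with X^b. -/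
theorem coeff_det_seriesBlock {m : ℕ} (n : ℕ∞) (f : PowerSeries R) {ι : Type} [Fintype ι]
    [DecidableEq ι] (er : Fin k ⊕ Fin m ≃ ι) (ec : Fin h ⊕ Fin r ≃ ι) (d : Vars h k r →₀ ℕ) :
    MvPowerSeries.coeff d ((seriesBlock h k r m n f).submatrix er.symm ec.symm).det
      = ((contractMatrix f n m (zExp d) (tExp d) (uExp d)).submatrix er.symm ec.symm).det := by
  classical
  set ρ : Vars h k r → ι ⊕ ι := Sum.elim (fun j => Sum.inr (ec (Sum.inl j)))
    (Sum.elim (fun a => Sum.inl (er (Sum.inl a))) fun j => Sum.inr (ec (Sum.inr j))) with hρ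
  have key := coeff_det_of_disjoint ((seriesBlock h k r m n f).submatrix er.symm ec.symm) ρ ?_ d
  · refine key.trans (congrArg Matrix.det ?_)
    ext1 x y
    obtain ⟨x, rfl⟩ := er.surjective x
    obtain ⟨y, rfl⟩ := ec.surjective y
    simp only [Matrix.submatrix_apply, Equiv.symm_apply_apply, Matrix.of_apply]
    rcases x with x | x <;> rcases y with y | y
    · simp [seriesBlock, powerBlock, contractMatrix]
    · simp only [seriesBlock, powerBlock, contractMatrix, Matrix.fromBlocks_apply₁₂,
        Matrix.of_apply, uX, tX]
      have hne : (Sum.inr (Sum.inl x) : Vars h k r) ≠ Sum.inr (Sum.inr y) := by simp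
      rw [filter_eq_single_add_single hne d _ (by
        rintro (s | s | s) <;> simp [hρ]), coeff_subst_X_mul_X hne]
      set A := d (Sum.inr (Sum.inl x)) with hA
      set T := d (Sum.inr (Sum.inr y)) with hT
      have hu : uExp d x = A := rfl
      have ht : tExp d y = T := rfl
      have hval : (Finsupp.single (Sum.inr (Sum.inl x)) A
          + Finsupp.single (Sum.inr (Sum.inr y)) T : Vars h k r →₀ ℕ) (Sum.inr (Sum.inl x)) = A := by
        simp
      rw [hval, hu, ht, truncGeom, PowerSeries.coeff_mk]
      have hiff : ((Finsupp.single (Sum.inr (Sum.inl x)) A : Vars h k r →₀ ℕ)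
          + Finsupp.single (Sum.inr (Sum.inr y)) T = Finsupp.single (Sum.inr (Sum.inl x)) A
          + Finsupp.single (Sum.inr (Sum.inr y)) A) ↔ T = A := by
        rw [add_right_inj]
        exact (Finsupp.single_injective _).eq_iff
      simp only [hiff, ite_and]
    · simp only [seriesBlock, powerBlock, contractMatrix, Matrix.fromBlocks_apply₂₁,
        Matrix.of_apply, zX]
      rw [filter_eq_single (a := Sum.inl y) d _ (by
        rintro (s | s | s) <;> simp [hρ]), X_pow_mul_subst_X, coeff_single_subst_X,
        coeff_X_pow_mul_eq_coeffZ]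
      rfl
    · simp only [seriesBlock, powerBlock, contractMatrix, Matrix.fromBlocks_apply₂₂,
        Matrix.of_apply, tX]
      rw [filter_eq_single (a := Sum.inr (Sum.inr y)) d _ (by
        rintro (s | s | s) <;> simp [hρ]), X_pow_mul_subst_X, coeff_single_subst_X,
        coeff_X_pow_mul_eq_coeffZ]
      rfl
  · intro x y d hd s hs
    obtain ⟨x, rfl⟩ := er.surjective x
    obtain ⟨y, rfl⟩ := ec.surjective y
    simp only [Matrix.submatrix_apply, Equiv.symm_apply_apply] at hd
    rcases x with x | x <;> rcases y with y | y
    · simp [seriesBlock, powerBlock] at hd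
    · simp only [seriesBlock, powerBlock, Matrix.fromBlocks_apply₁₂, Matrix.of_apply, uX, tX] at hd
      rw [coeff_subst_X_mul_X (by simp)] at hd
      have hd' : d = Finsupp.single (Sum.inr (Sum.inl x)) (d (Sum.inr (Sum.inl x)))
          + Finsupp.single (Sum.inr (Sum.inr y)) (d (Sum.inr (Sum.inl x))) := by
        by_contra hc; rw [if_neg hc] at hd; exact hd rfl
      have : s = Sum.inr (Sum.inl x) ∨ s = Sum.inr (Sum.inr y) := by
        by_contra hc
        rw [not_or] at hc
        rw [hd'] at hs
        simp [Finsupp.single_eq_of_ne hc.1, Finsupp.single_eq_of_ne hc.2] at hs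
      rcases this with rfl | rfl <;> simp [hρ]
    · simp only [seriesBlock, powerBlock, Matrix.fromBlocks_apply₂₁, Matrix.of_apply, zX] at hd
      rw [X_pow_mul_subst_X] at hd
      rw [coeff_subst_X_ne_zero hd s hs]
      simp [hρ]
    · simp only [seriesBlock, powerBlock, Matrix.fromBlocks_apply₂₂, Matrix.of_apply, tX] at hd
      rw [X_pow_mul_subst_X] at hd
      rw [coeff_subst_X_ne_zero hd s hs]
      simp [hρ]

/-- The coefficient of `t ^ b` in `∏_{i < j} (t_i - t_j) ∏ f(t_j)` is a Jacobi–Trudi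
determinant. -/
theorem coeff_det_X_pow_mul_subst (f : PowerSeries R) (d : Fin r →₀ ℕ) :
    MvPowerSeries.coeff d (Matrix.of fun i j : Fin r => (MvPowerSeries.X j : MvPowerSeries (Fin r) R)
        ^ (r - 1 - (i : ℕ)) * f.subst (MvPowerSeries.X j : MvPowerSeries (Fin r) R)).det
      = (Matrix.of fun i j : Fin r => coeffZ f ((d j : ℤ) - (r - 1) + (i : ℕ))).det := by
  classical
  have key := coeff_det_of_disjoint (Matrix.of fun i j : Fin r =>
    (MvPowerSeries.X j : MvPowerSeries (Fin r) R) ^ (r - 1 - (i : ℕ))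
      * f.subst (MvPowerSeries.X j : MvPowerSeries (Fin r) R)) (fun s => Sum.inr s) ?_ d
  · refine key.trans (congrArg Matrix.det ?_)
    ext1 i j
    simp only [Matrix.of_apply]
    rw [filter_eq_single (a := j) d _ (by simp), X_pow_mul_subst_X, coeff_single_subst_X,
      coeff_X_pow_mul_eq_coeffZ]
  · intro i j d hd s hs
    simp only [Matrix.of_apply] at hd
    rw [X_pow_mul_subst_X] at hd
    rw [coeff_subst_X_ne_zero hd s hs]
    simp

end PowerBlock

/-! ### Compatibility with ring homomorphisms -/

section Naturality

variable {R R' : Type} [CommRing R] [Algebra ℚ R] [CommRing R'] [Algebra ℚ R'] {p : ℕ}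

theorem compl_map (φ : R →ₐ[ℚ] R') (v : Fin p → R) (a : ℕ) :
    compl (fun i => φ (v i)) a = φ (compl v a) := by
  rw [compl, compl, ← AlgHom.comp_apply]
  congr 1
  exact MvPolynomial.algHom_ext (by simp)

theorem y_map (φ : R →ₐ[ℚ] R') (v : Fin p → R) (l : ℕ) (ζ : R) :
    y (fun i => φ (v i)) l (φ ζ) = φ (y v l ζ) := by
  simp [y, U, elem_map, compl_map]

/-- `1 - y_{n-p+1+b} u ^ {n-p+1+b}`, and `1` for `n = ∞`. -/
def oneSubY (n : ℕ∞) (t : Fin p → R) (u : R) (b : ℕ) : R :=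
  match n with
  | ⊤ => 1
  | (N : ℕ) => 1 - y t (N - p + 1 + b) u * u ^ (N - p + 1 + b)

theorem oneSubY_map (φ : R →ₐ[ℚ] R') (n : ℕ∞) (t : Fin p → R) (u : R) (b : ℕ) :
    oneSubY n (fun i => φ (t i)) (φ u) b = φ (oneSubY n t u b) := by
  induction n using ENat.recTopCoe with
  | top => exact (map_one φ).symm
  | coe N =>
    change 1 - y _ _ _ * _ = φ (1 - _)
    rw [y_map, map_sub, map_mul, map_pow, map_one]

theorem twist_map (φ : R →ₐ[ℚ] R') (f : PowerSeries R) (v : Fin p → R) (j : ℤ) :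
    twist (PowerSeries.map (φ : R →+* R') f) (fun i => φ (v i)) j = φ (twist f v j) := by
  rw [twist, twist, map_sum]
  refine Finset.sum_congr rfl fun a _ => ?_
  rw [elem_map, map_mul, map_mul, map_pow, map_neg, map_one]
  congr 1
  exact (map_coeffZ (φ : R →+* R') f _).symm

theorem twistedBlock_map {k m h r : ℕ} (φ : R →ₐ[ℚ] R') (f : PowerSeries R) (z : Fin h → R)
    (t : Fin r → R) (u : Fin k → R) (ye : Fin k → Fin r → R) :
    twistedBlock k m (PowerSeries.map (φ : R →+* R') f) (fun i => φ (z i)) (fun i => φ (t i))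
      (fun i => φ (u i)) (fun a b => φ (ye a b)) = (twistedBlock k m f z t u ye).map φ := by
  ext x y
  rcases x with x | x <;> rcases y with y | y <;> simp [twistedBlock, twist_map]

theorem powerBlock_map {k m h r : ℕ} (φ : R →ₐ[ℚ] R') (z Sz : Fin h → R)
    (t St : Fin r → R) (g : Fin k → Fin r → R) :
    powerBlock m (fun i => φ (z i)) (fun i => φ (t i)) (fun i => φ (Sz i)) (fun i => φ (St i))
      (fun a b => φ (g a b)) = (powerBlock m z t Sz St g).map φ := by
  ext x y
  rcases x with x | x <;> rcases y with y | y <;> simp [powerBlock]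

end Naturality

/-! ### The determinant identity over B_{m,n} -/

section SeriesIdentity

theorem truncGeom_coe_mul (R : Type) [CommRing R] (N : ℕ) :
    truncGeom R N * (1 - PowerSeries.X) = 1 - PowerSeries.X ^ N := by
  ext q
  rw [mul_sub, mul_one, map_sub, map_sub, mul_comm, truncGeom]
  cases q with
  | zero =>
    simp [PowerSeries.coeff_X_pow]
    rcases Nat.eq_zero_or_pos N with rfl | hN
    · simp
    · simp [hN, hN.ne]
  | succ q =>
    rw [PowerSeries.coeff_succ_X_mul]
    simp only [PowerSeries.coeff_mk, Nat.cast_lt, PowerSeries.coeff_one, PowerSeries.coeff_X_pow]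
    rcases lt_trichotomy (q + 1) N with h | h | h
    · simp [h, h.ne, show q < N by omega]
    · simp [h, show q < N by omega, show N ≠ 0 by omega]
    · simp [show ¬ (q + 1 < N) by omega, h.ne', show ¬ (q < N) by omega]

theorem truncGeom_top_mul (R : Type) [CommRing R] :
    truncGeom R ⊤ * (1 - PowerSeries.X) = 1 := by
  have : truncGeom R ⊤ = PowerSeries.mk 1 := by
    ext q; simp [truncGeom]
  rw [this]
  exact PowerSeries.mk_one_mul_one_sub_eq_one R

variable {A A' : Type} [CommRing A] [Algebra ℚ A] [CommRing A'] [Algebra ℚ A'] (h k r m : ℕ)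
  (n : ℕ∞)

/-- The block matrix of `𝔻_{(r,h,k),n}` with the row of index `a ≤ k` multiplied by `w_a ^ {1-r}`,
with `f` for `∑ S_j z ^ j`. -/
def seriesTwist (f : PowerSeries A) :
    Matrix (Fin k ⊕ Fin m) (Fin h ⊕ Fin r) (MvPowerSeries (Vars h k r) A) :=
  twistedBlock k m (PowerSeries.map MvPowerSeries.C f) (zX h k r A) (tX h k r A) (uX h k r A)
    fun a b => oneSubY n (tX h k r A) (uX h k r A a) b

/-- The product of the two Vandermonde products in the `z_i` and in the `t_i`. -/
def vanderZT (A : Type) [CommRing A] : MvPowerSeries (Vars h k r) A :=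
  (nodalMatrix (zX h k r A)).det * (nodalMatrix (tX h k r A)).det

/-- The relation between the two block matrices. -/
def SeriesIdentity {ι : Type} [Fintype ι] [DecidableEq ι] (er : Fin k ⊕ Fin m ≃ ι)
    (ec : Fin h ⊕ Fin r ≃ ι) (f : PowerSeries A) : Prop :=
  ((seriesTwist h k r m n f).submatrix er.symm ec.symm).det * vanderZT h k r A
      * ((∏ i, f.subst (zX h k r A i)) * ∏ i, f.subst (tX h k r A i))
    = (∏ a, ∏ j, (1 - tX h k r A j * uX h k r A a))
      * ((seriesBlock h k r m n f).submatrix er.symm ec.symm).det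

variable {h k r m n} {ι : Type} [Fintype ι] [DecidableEq ι] {er : Fin k ⊕ Fin m ≃ ι}
  {ec : Fin h ⊕ Fin r ≃ ι}

omit [Algebra ℚ A] [Algebra ℚ A'] in
theorem map_truncGeom (φ : A →+* A') : PowerSeries.map φ (truncGeom A n) = truncGeom A' n := by
  classical
  ext q
  rw [PowerSeries.coeff_map, truncGeom, truncGeom, PowerSeries.coeff_mk, PowerSeries.coeff_mk]
  split_ifs <;> simp

/-- Both sides are built from f by natural operations, so the identity can be pushed along any
homomorphism and pulled back along an injective one. -/
theorem map_seriesIdentity_sides (φ : A →+* A') (f : PowerSeries A) :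
    MvPowerSeries.map φ (((seriesTwist h k r m n f).submatrix er.symm ec.symm).det
        * vanderZT h k r A * ((∏ i, f.subst (zX h k r A i)) * ∏ i, f.subst (tX h k r A i)))
      = ((seriesTwist h k r m n (PowerSeries.map φ f)).submatrix er.symm ec.symm).det
        * vanderZT h k r A' * ((∏ i, (PowerSeries.map φ f).subst (zX h k r A' i))
          * ∏ i, (PowerSeries.map φ f).subst (tX h k r A' i))
    ∧ MvPowerSeries.map φ ((∏ a, ∏ j, (1 - tX h k r A j * uX h k r A a))
        * ((seriesBlock h k r m n f).submatrix er.symm ec.symm).det)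
      = (∏ a, ∏ j, (1 - tX h k r A' j * uX h k r A' a))
        * ((seriesBlock h k r m n (PowerSeries.map φ f)).submatrix er.symm ec.symm).det := by
  set Φ : MvPowerSeries (Vars h k r) A →ₐ[ℚ] MvPowerSeries (Vars h k r) A' :=
    (MvPowerSeries.map φ).toRatAlgHom with hΦ
  have hΦ' : (Φ : MvPowerSeries (Vars h k r) A →+* MvPowerSeries (Vars h k r) A')
      = MvPowerSeries.map φ := rfl
  have hΦa : ∀ x, MvPowerSeries.map φ x = Φ x := fun _ => rfl
  have hz : ∀ i, Φ (zX h k r A i) = zX h k r A' i := fun i => MvPowerSeries.map_X φ _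
  have ht : ∀ i, Φ (tX h k r A i) = tX h k r A' i := fun i => MvPowerSeries.map_X φ _
  have hu : ∀ i, Φ (uX h k r A i) = uX h k r A' i := fun i => MvPowerSeries.map_X φ _
  have hsub : ∀ (g : PowerSeries A) (s : MvPowerSeries (Vars h k r) A),
      MvPowerSeries.constantCoeff s = 0 → Φ (g.subst s) = (PowerSeries.map φ g).subst (Φ s) :=
    fun g s hs => PowerSeries.map_subst (hasSubst_of_constantCoeff hs) g
  have hcz : ∀ i, MvPowerSeries.constantCoeff (zX h k r A i) = 0 := by simp [zX]
  have hct : ∀ i, MvPowerSeries.constantCoeff (tX h k r A i) = 0 := by simp [tX]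
  have hcut : ∀ a i, MvPowerSeries.constantCoeff (uX h k r A a * tX h k r A i) = 0 := by
    simp [uX]
  have hC : PowerSeries.map
      (Φ : MvPowerSeries (Vars h k r) A →+* MvPowerSeries (Vars h k r) A')
      (PowerSeries.map MvPowerSeries.C f)
      = PowerSeries.map MvPowerSeries.C (PowerSeries.map φ f) := by
    ext1 j
    simp only [PowerSeries.coeff_map, hΦ', MvPowerSeries.map_C]
  have hnz := nodalMatrix_map
    (Φ : MvPowerSeries (Vars h k r) A →+* MvPowerSeries (Vars h k r) A') (zX h k r A)
  have hnt := nodalMatrix_map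
    (Φ : MvPowerSeries (Vars h k r) A →+* MvPowerSeries (Vars h k r) A') (tX h k r A)
  have htw := twistedBlock_map (k := k) (m := m) Φ (PowerSeries.map MvPowerSeries.C f)
    (zX h k r A) (tX h k r A) (uX h k r A) fun a b => oneSubY n (tX h k r A) (uX h k r A a) b
  have hpb := powerBlock_map (m := m) Φ (zX h k r A) (fun i => f.subst (zX h k r A i))
    (tX h k r A) (fun i => f.subst (tX h k r A i)) fun a i =>
      (truncGeom A n).subst (uX h k r A a * tX h k r A i)
  simp only [← oneSubY_map, hz, ht, hu, hC] at htw
  simp only [hz, ht, hsub _ _ (hcz _), hsub _ _ (hct _), hsub _ _ (hcut _ _), map_mul, hu,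
    map_truncGeom] at hpb
  simp only [RingHom.coe_coe, hz] at hnz
  simp only [RingHom.coe_coe, ht] at hnt
  rw [hΦa, hΦa]
  constructor
  · rw [map_mul, map_mul, map_mul, map_prod, map_prod, AlgHom.map_det, vanderZT, map_mul,
      AlgHom.map_det, AlgHom.map_det, AlgHom.mapMatrix_apply, AlgHom.mapMatrix_apply,
      AlgHom.mapMatrix_apply, ← Matrix.submatrix_map, seriesTwist, seriesTwist, vanderZT, ← htw]
    simp only [hsub _ _ (hcz _), hsub _ _ (hct _), hz, ht, hnz, hnt]
  · rw [map_mul, map_prod, AlgHom.map_det, AlgHom.mapMatrix_apply, ← Matrix.submatrix_map,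
      seriesBlock, seriesBlock, ← hpb]
    simp only [map_prod, map_sub, map_one, map_mul, ht, hu]

theorem SeriesIdentity.map {f : PowerSeries A} (H : SeriesIdentity h k r m n er ec f)
    (φ : A →+* A') : SeriesIdentity h k r m n er ec (PowerSeries.map φ f) := by
  obtain ⟨h1, h2⟩ := map_seriesIdentity_sides (h := h) (k := k) (r := r) (n := n) (er := er)
    (ec := ec) φ f
  rw [SeriesIdentity, ← h1, ← h2, H]

theorem SeriesIdentity.of_map {f : PowerSeries A} {φ : A →+* A'} (hφ : Function.Injective φ)
    (H : SeriesIdentity h k r m n er ec (PowerSeries.map φ f)) :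
    SeriesIdentity h k r m n er ec f := by
  obtain ⟨h1, h2⟩ := map_seriesIdentity_sides (h := h) (k := k) (r := r) (n := n) (er := er)
    (ec := ec) φ f
  rw [SeriesIdentity, ← h1, ← h2] at H
  ext d
  apply hφ
  have := congrArg (MvPowerSeries.coeff d) H
  rwa [MvPowerSeries.coeff_map, MvPowerSeries.coeff_map] at this

/-- Over ℚ[τ_1, …, τ_m] the series S splits as ∏ 1 / (1 - τ_s z), and the Vandermonde product of τ
is cancellable because the coefficients form a domain. -/
theorem seriesIdentity_partH (hr : (r : ℕ∞) ≤ n) :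
    SeriesIdentity h k r m n er ec (partH m m) := by
  set A := MvPolynomial (Fin m) ℚ with hA
  set τ : Fin m → MvPowerSeries (Vars h k r) A := fun i => MvPowerSeries.C (X i) with hτ
  have hf : PowerSeries.map MvPowerSeries.C (partH m m)
      * ∏ j, (1 - PowerSeries.C (τ j) * PowerSeries.X) = 1 := by
    have := congrArg (PowerSeries.map (MvPowerSeries.C : A →+* MvPowerSeries (Vars h k r) A))
      (partH_mul_prod m)
    rw [map_mul, map_prod, map_one] at this
    simpa [hτ] using this
  have hreg : IsLeftRegular (nodalMatrix τ).det := by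
    have h1 := nodalMatrix_map (MvPowerSeries.C : A →+* MvPowerSeries (Vars h k r) A)
      (X : Fin m → A)
    have h2 : (nodalMatrix τ).det = MvPowerSeries.C (vander m) := by
      rw [← det_nodalMatrix_X, RingHom.map_det, RingHom.mapMatrix_apply, ← h1]
    refine IsLeftCancelMulZero.mul_left_cancel_of_ne_zero ?_
    rw [h2]
    intro hc
    have := congrArg (MvPowerSeries.coeff 0) hc
    rw [MvPowerSeries.coeff_zero_C] at this
    exact vander_ne_zero m this
  have hsub : ∀ s : MvPowerSeries (Vars h k r) A, MvPowerSeries.constantCoeff s = 0 →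
      (partH m m).subst s * ∏ j, (1 - τ j * s) = 1 := by
    intro s hs
    have hs' := hasSubst_of_constantCoeff hs
    have := congrArg (PowerSeries.substAlgHom hs') (partH_mul_prod m)
    rw [map_mul, map_prod, map_one] at this
    simpa only [map_sub, map_one, map_mul, PowerSeries.substAlgHom_X, PowerSeries.coe_substAlgHom,
      PowerSeries.subst_C] using this
  refine det_twistedBlock hf hreg (fun i => hsub _ (by simp [zX])) (fun i => hsub _ (by simp [tX]))
    ?_ er ec
  intro a i
  have hs : PowerSeries.HasSubst (uX h k r A a * tX h k r A i) :=
    hasSubst_of_constantCoeff (by simp [uX])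
  induction n using ENat.recTopCoe with
  | top =>
    refine sum_nodal_mul_one _ _ _ ?_
    have := congrArg (PowerSeries.substAlgHom hs) (truncGeom_top_mul A)
    rw [map_mul, map_sub, map_one, PowerSeries.substAlgHom_X, PowerSeries.coe_substAlgHom] at this
    rw [mul_comm (tX h k r A i)]
    exact this
  | coe N =>
    refine sum_nodal_mul_one_sub_y _ (by exact_mod_cast hr) _ _ ?_
    have := congrArg (PowerSeries.substAlgHom hs) (truncGeom_coe_mul A N)
    rw [map_mul, map_sub, map_sub, map_one, map_pow, PowerSeries.substAlgHom_X,
      PowerSeries.coe_substAlgHom] at this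
    rw [mul_comm (tX h k r A i)]
    exact this

/-- Descent from ℚ[τ] to ℚ[c] along the injection c_i ↦ e_i(τ), then passage to the quotient; the
roots are used only before the quotient is taken. -/
theorem seriesIdentity_mk (n' : ℕ∞) (hr : (r : ℕ∞) ≤ n) : SeriesIdentity h k r m n er ec
    (PowerSeries.map (Ideal.Quotient.mk (grassIdeal m n')) (segreSeries m)) := by
  have h1 := seriesIdentity_partH (h := h) (k := k) (m := m) (er := er) (ec := ec) hr
  rw [← map_toSymm_segreSeries] at h1
  exact (h1.of_map (toSymm_injective m)).map _

end SeriesIdentity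

/-! ### The exponentials as products -/

section Exponentials

/-- `∑ S_j z ^ j` with coefficients in `B_{m,n}`. -/
def segreQuot (m : ℕ) (n : ℕ∞) : PowerSeries (B m n) :=
  PowerSeries.map (Ideal.Quotient.mk (grassIdeal m n)) (segreSeries m)

theorem S_eq_coeffZ (m : ℕ) (n : ℕ∞) (j : ℤ) : S m n j = coeffZ (segreQuot m n) j := by
  rw [S, coeffZ]
  split_ifs
  · rfl
  · rw [segreQuot, PowerSeries.coeff_map, segreSeries, PowerSeries.coeff_mk]

theorem mk_S (m : ℕ) (n : ℕ∞) : PowerSeries.mk (fun j : ℕ => S m n j) = segreQuot m n := by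
  ext1 j
  rw [PowerSeries.coeff_mk, S_eq_coeffZ, coeffZ, if_neg (by omega), Int.toNat_natCast]

theorem constantCoeff_segreQuot (m : ℕ) (n : ℕ∞) :
    PowerSeries.constantCoeff (segreQuot m n) = 1 := by
  rw [← PowerSeries.coeff_zero_eq_constantCoeff_apply, segreQuot, PowerSeries.coeff_map,
    segreSeries, PowerSeries.coeff_mk, segre, PowerSeries.coeff_zero_eq_constantCoeff_apply,
    PowerSeries.constantCoeff_invOfUnit]
  simp

theorem pow_eq_sum {A : Type} [CommRing A] [Algebra ℚ A] {p : ℕ} (v : Fin p → A) (i : ℕ) :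
    pow v i = ∑ j, v j ^ i := by
  simp [pow, psum]

theorem expX_eq_prod {σ : Type} (m : ℕ) (n : ℕ∞) {p : ℕ} (v : Fin p → MvPowerSeries σ (B m n))
    (hv : ∀ i, MvPowerSeries.constantCoeff (v i) = 0) :
    expX m n v = ∏ i, (segreQuot m n).subst (v i) := by
  rw [expX, ← formalExp_formalSum_logOf (fun _ => segreQuot m n)
    (fun _ => constantCoeff_segreQuot m n) v hv]
  congr 2
  funext i
  rw [pow_eq_sum, Finset.mul_sum]
  simp only [x, mk_S]

/-- Since p_i(t) p_i(w⁻¹) is the sum of the (t_j w_a⁻¹)^i, the exponent is a sum of logarithms, of S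
at each z_i and of 1 / (1 - X) at each product t_j w_a⁻¹. -/
theorem expZW_eq_prod (r h k : ℕ) (n : ℕ∞) :
    expZW r h k n = (∏ i, (segreQuot (r + h - k) n).subst (zX h k r (B (r + h - k) n) i))
      * ∏ a, ∏ j, (PowerSeries.mk fun _ => (1 : B (r + h - k) n)).subst
        (tX h k r (B (r + h - k) n) j * uX h k r (B (r + h - k) n) a) := by
  set A := B (r + h - k) n with hA
  set f : Fin h ⊕ (Fin k × Fin r) → PowerSeries A :=
    Sum.elim (fun _ => segreQuot (r + h - k) n) fun _ => PowerSeries.mk fun _ => (1 : A) with hf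
  set s : Fin h ⊕ (Fin k × Fin r) → MvPowerSeries (Vars h k r) A :=
    Sum.elim (fun i => zX h k r A i) fun q => tX h k r A q.2 * uX h k r A q.1 with hs
  have key := formalExp_formalSum_logOf f (by
    rintro (i | q)
    · exact constantCoeff_segreQuot _ _
    · rw [← PowerSeries.coeff_zero_eq_constantCoeff_apply]; simp [hf]) s (by
    rintro (i | q) <;> simp [hs, zX, tX])
  rw [Fintype.prod_sum_type, Fintype.prod_prod_type] at key
  refine Eq.trans ?_ key
  rw [expZW]
  congr 2
  funext i
  rw [Fintype.sum_sum_type, Fintype.sum_prod_type]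
  congr 1
  · rw [pow_eq_sum, Finset.mul_sum]
    simp only [x, mk_S]
    rfl
  · simp only [hf, hs, Sum.elim_inr, coeff_logOf_geometric, pow_eq_sum]
    rw [Finset.sum_mul_sum, Finset.sum_comm, Finset.smul_sum]
    refine Finset.sum_congr rfl fun a _ => ?_
    rw [Finset.smul_sum]
    refine Finset.sum_congr rfl fun j _ => ?_
    rw [mul_pow]
    ext1 d
    rw [MvPowerSeries.coeff_C_mul, ← Algebra.smul_def]
    rfl

theorem geometric_subst_mul {σ R : Type} [CommRing R] {s : MvPowerSeries σ R}
    (hs : MvPowerSeries.constantCoeff s = 0) :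
    (PowerSeries.mk fun _ => (1 : R)).subst s * (1 - s) = 1 := by
  have hs' := hasSubst_of_constantCoeff hs
  have := congrArg (PowerSeries.substAlgHom hs') (PowerSeries.mk_one_mul_one_sub_eq_one R)
  rw [map_mul, map_sub, map_one, PowerSeries.substAlgHom_X, PowerSeries.coe_substAlgHom] at this
  exact this

end Exponentials

/-! ### The right-hand side and its coefficients -/

section RightHandSide

theorem emb_yEntry (r h k : ℕ) (n : ℕ∞) (a : Fin k) (b : ℕ) :
    yEntry r h k n a b = oneSubY n (tX h k r (B (r + h - k) n)) (uX h k r (B (r + h - k) n) a) b := by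
  induction n using ENat.recTopCoe with
  | top => rfl
  | coe N => rfl

theorem twisted_eq_twist {σ : Type} (m : ℕ) (n : ℕ∞) {p : ℕ} (v : Fin p → MvPowerSeries σ (B m n))
    (j : ℤ) : twisted m n v j = twist (PowerSeries.map MvPowerSeries.C (segreQuot m n)) v j := by
  rw [twisted, twist]
  refine Finset.sum_congr rfl fun a _ => ?_
  rw [S_eq_coeffZ, map_coeffZ]

theorem wv_zpow_mul_pow (r h k : ℕ) (n : ℕ∞) (a : Fin k) {c : ℕ} (hc : c < r) :
    ((wv r h k n a ^ (1 - (r : ℤ)) : (Laur r h k n)ˣ) : Laur r h k n)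
      * ((wv r h k n a : Laur r h k n)) ^ c
      = emb r h k n (uX h k r (B (r + h - k) n) a ^ (r - 1 - c)) := by
  have h1 : ((wv r h k n a)⁻¹ : (Laur r h k n)ˣ) = (isUnit_emb_uv r h k n a).unit := by
    rw [wv, inv_inv]
  have h2 : emb r h k n (uX h k r (B (r + h - k) n) a)
      = (((wv r h k n a)⁻¹ : (Laur r h k n)ˣ) : Laur r h k n) := by
    rw [h1]; rfl
  rw [map_pow, h2, ← Units.val_pow_eq_pow_val, ← Units.val_pow_eq_pow_val, ← Units.val_mul,
    ← zpow_natCast, ← zpow_natCast, inv_zpow', ← zpow_add]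
  congr 2
  omega

/-- Giving each of the first k rows its factor w_a^{1-r} turns w_a^b into (w_a⁻¹)^{r-1-b}, with
nonnegative exponent, so the determinant already lies in the power series ring. -/
theorem prod_wv_mul_det_DMatrix (r h k : ℕ) (n : ℕ∞) (hk : k ≤ r + h) :
    (∏ i, ((wv r h k n i ^ (1 - (r : ℤ)) : (Laur r h k n)ˣ) : Laur r h k n)) *
      (DMatrix r h k n).det = emb r h k n ((seriesTwist h k r (r + h - k) n
        (segreQuot (r + h - k) n)).submatrix (blockEquiv (add_sub_add hk)).symm
          (blockEquiv (Nat.add_comm h r)).symm).det := by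
  set er := blockEquiv (add_sub_add hk) with her
  set ec := blockEquiv (Nat.add_comm h r) with hec
  set v : Fin (r + h) → Laur r h k n := fun a =>
    Sum.elim (fun i => ((wv r h k n i ^ (1 - (r : ℤ)) : (Laur r h k n)ˣ) : Laur r h k n))
      (fun _ => 1) (er.symm a) with hv
  have hprod : ∏ i, ((wv r h k n i ^ (1 - (r : ℤ)) : (Laur r h k n)ˣ) : Laur r h k n)
      = ∏ a, v a := by
    rw [← er.prod_comp, Fintype.prod_sum_type]
    simp [hv]
  rw [hprod, ← Matrix.det_mul_column, RingHom.map_det, RingHom.mapMatrix_apply]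
  congr 1
  ext1 a b
  obtain ⟨a, rfl⟩ := er.surjective a
  obtain ⟨b, rfl⟩ := ec.surjective b
  simp only [Matrix.of_apply, Matrix.map_apply, Matrix.submatrix_apply, Equiv.symm_apply_apply, hv,
    DMatrix]
  rcases a with a | a <;> rcases b with b | b
  · have h1 : (er (Sum.inl a) : ℕ) < k := a.2
    have h2 : (ec (Sum.inl b) : ℕ) < h := b.2
    rw [dif_pos h1, if_pos h2]
    simp [seriesTwist, twistedBlock]
  · have h1 : (er (Sum.inl a) : ℕ) < k := a.2
    have h2 : (ec (Sum.inr b) : ℕ) = h + b := val_blockEquiv_inr _ b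
    have h3 : (⟨(er (Sum.inl a) : ℕ), h1⟩ : Fin k) = a := rfl
    rw [dif_pos h1, if_neg (by omega), h3, h2, Nat.add_sub_cancel_left, ← mul_assoc,
      Sum.elim_inl, wv_zpow_mul_pow r h k n a b.2, emb_yEntry, ← map_mul]
    rfl
  · have h1 : (er (Sum.inr a) : ℕ) = k + a := val_blockEquiv_inr _ a
    have h2 : (ec (Sum.inl b) : ℕ) = b := rfl
    rw [dif_neg (by omega), if_pos (by omega), Sum.elim_inr, one_mul, h1, h2, twisted_eq_twist]
    simp only [seriesTwist, twistedBlock, Matrix.fromBlocks_apply₂₁, Matrix.of_apply]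
    -- The indices agree because k - r = h - m, as m = r + h - k.
    congr 2
    omega
  · have h1 : (er (Sum.inr a) : ℕ) = k + a := val_blockEquiv_inr _ a
    have h2 : (ec (Sum.inr b) : ℕ) = h + b := val_blockEquiv_inr _ b
    rw [dif_neg (by omega), if_neg (by omega), Sum.elim_inr, one_mul, h1, h2, twisted_eq_twist]
    simp only [seriesTwist, twistedBlock, Matrix.fromBlocks_apply₂₂, Matrix.of_apply]
    congr 2
    omega

/-- The power series of which `mainRHS` is the image. -/
def rhsSeries (r h k : ℕ) (n : ℕ∞) (hk : k ≤ r + h) : Ser r h k n :=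
  (-1) ^ (h * k) * ((seriesTwist h k r (r + h - k) n (segreQuot (r + h - k) n)).submatrix
    (blockEquiv (add_sub_add hk)).symm (blockEquiv (Nat.add_comm h r)).symm).det *
    expZW r h k n * expX (r + h - k) n (tv r h k n)

theorem mainRHS_eq_emb (r h k : ℕ) (n : ℕ∞) (hk : k ≤ r + h) :
    mainRHS r h k n = emb r h k n (rhsSeries r h k n hk) := by
  rw [mainRHS, rhsSeries, map_mul, map_mul, map_mul, ← prod_wv_mul_det_DMatrix r h k n hk, map_pow,
    map_neg, map_one]
  simp only [mul_assoc]

/-- The exponentials are ∏ S(z_i), ∏ S(t_i) and ∏ 1 / (1 - t_j w_a⁻¹): the first two are the factors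
on the left of `SeriesIdentity`, and the last cancels the product on its right. -/
theorem vanderZT_mul_rhsSeries (r h k : ℕ) (n : ℕ∞) (hr : (r : ℕ∞) ≤ n) (hk : k ≤ r + h) :
    vanderZT h k r (B (r + h - k) n) * rhsSeries r h k n hk
      = (-1) ^ (h * k) * ((seriesBlock h k r (r + h - k) n (segreQuot (r + h - k) n)).submatrix
    (blockEquiv (add_sub_add hk)).symm (blockEquiv (Nat.add_comm h r)).symm).det := by
  have key : SeriesIdentity h k r (r + h - k) n (blockEquiv (add_sub_add hk))
    (blockEquiv (Nat.add_comm h r)) (segreQuot (r + h - k) n) := seriesIdentity_mk n hr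
  rw [SeriesIdentity] at key
  have hgeom : (∏ a, ∏ j, (PowerSeries.mk fun _ => (1 : B (r + h - k) n)).subst
        (tX h k r (B (r + h - k) n) j * uX h k r (B (r + h - k) n) a))
      * ∏ a, ∏ j, (1 - tX h k r (B (r + h - k) n) j * uX h k r (B (r + h - k) n) a) = 1 := by
    simp only [← Finset.prod_mul_distrib]
    refine Finset.prod_eq_one fun a _ => Finset.prod_eq_one fun j _ => ?_
    exact geometric_subst_mul (by simp [tX])
  rw [rhsSeries, expZW_eq_prod, expX_eq_prod _ _ _ (by simp [tv])]
  have htv : tv r h k n = tX h k r (B (r + h - k) n) := rfl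
  rw [htv]
  set T := ((seriesTwist h k r (r + h - k) n (segreQuot (r + h - k) n)).submatrix
    (blockEquiv (add_sub_add hk)).symm (blockEquiv (Nat.add_comm h r)).symm).det
  set D := ((seriesBlock h k r (r + h - k) n (segreQuot (r + h - k) n)).submatrix
    (blockEquiv (add_sub_add hk)).symm (blockEquiv (Nat.add_comm h r)).symm).det
  set G := ∏ a, ∏ j, (PowerSeries.mk fun _ => (1 : B (r + h - k) n)).subst
        (tX h k r (B (r + h - k) n) j * uX h k r (B (r + h - k) n) a)
  linear_combination (-1) ^ (h * k) * G * key + (-1) ^ (h * k) * D * hgeom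

/-- The meeting point of the two sides: the same block determinant is a coefficient of the series
determinant and the value of a word on a Jacobi–Trudi element. -/
theorem coeff_vanderZT_mul_rhsSeries (r h k : ℕ) (n : ℕ∞) (hr : (r : ℕ∞) ≤ n) (hk : k ≤ r + h)
    (d : Vars h k r →₀ ℕ) :
    MvPowerSeries.coeff d (vanderZT h k r (B (r + h - k) n) * rhsSeries r h k n hk)
      = actHom r h k n (zExp d) (uExp d) (Ideal.Quotient.mk _ (jacobiTrudi r (tExp d))) := by
  rw [vanderZT_mul_rhsSeries r h k n hr hk, actHom_jacobiTrudi n hk]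
  have hC : ((-1) ^ (h * k) : Ser r h k n) = MvPowerSeries.C ((-1) ^ (h * k)) := by
    rw [map_pow, map_neg, map_one]
  rw [hC, MvPowerSeries.coeff_C_mul, coeff_det_seriesBlock, RingHom.map_det,
    RingHom.mapMatrix_apply, ← Matrix.submatrix_map]
  congr 4
  ext1 x y
  rcases x with x | x <;> rcases y with y | y
  · simp [contractMatrix]
  · simp only [contractMatrix, Matrix.fromBlocks_apply₁₂, Matrix.of_apply, Matrix.map_apply]
    split_ifs <;> simp
  · simp [contractMatrix, segreQuot, map_coeffZ]
  · simp [contractMatrix, segreQuot, map_coeffZ]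

end RightHandSide

/-! ### Alternating functions and sums over partitions -/

section Sorting

theorem strictAnti_add_le {p : ℕ} {f : Fin p → ℕ} (hf : StrictAnti f) {i j : Fin p} (hij : i ≤ j) :
    f j + ((j : ℕ) - i) ≤ f i := by
  obtain ⟨c, hc⟩ : ∃ c : ℕ, (j : ℕ) = i + c := ⟨_, (Nat.add_sub_of_le hij).symm⟩
  induction c generalizing j with
  | zero => have : j = i := Fin.ext hc
            simp [this]
  | succ c ih =>
    have h1 := ih (j := ⟨i + c, by omega⟩) (by simp [Fin.le_def]) rfl
    have h2 : f j < f ⟨i + c, by omega⟩ := hf (by simp [Fin.lt_def, hc])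
    simp only at h1
    omega

theorem exists_perm_strictAnti {p : ℕ} {e : Fin p → ℕ} (he : Function.Injective e) :
    ∃ τ : Equiv.Perm (Fin p), StrictAnti (e ∘ τ) := by
  have h : StrictMono (e ∘ Tuple.sort e) :=
    (Tuple.monotone_sort e).strictMono_of_injective (he.comp (Equiv.injective _))
  exact ⟨Fin.revPerm.trans (Tuple.sort e), fun i j hij => h (Fin.rev_lt_rev.2 hij)⟩

/-- The exponents `p - j + λ_j` of a partition. -/
def shifted {p : ℕ} (lam : Fin p → ℕ) (j : Fin p) : ℕ := p - 1 - (j : ℕ) + lam j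

theorem shifted_injective {p : ℕ} : Function.Injective (shifted (p := p)) := by
  intro a b h
  funext j
  have := congrFun h j
  simp only [shifted] at this
  omega

theorem strictAnti_shifted {p : ℕ} {lam : Fin p → ℕ} (hl : Antitone lam) :
    StrictAnti (shifted lam) := by
  intro i j hij
  have := hl hij.le
  have h1 : (i : ℕ) < j := hij
  simp only [shifted]
  omega

/-- Subtracting the staircase from a strictly decreasing sequence leaves a partition, and f_0 < n
says exactly that its largest part is at most n - p. -/
theorem exists_part_shifted {p : ℕ} {n : ℕ∞} {f : Fin p → ℕ} (hf : StrictAnti f)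
    (hn : ∀ i, (f i : ℕ∞) < n) : ∃ lam : Part p n, shifted lam.1 = f := by
  have hlow : ∀ j : Fin p, p - 1 - (j : ℕ) ≤ f j := by
    intro j
    have hp := j.pos
    have hj := j.2
    have := strictAnti_add_le hf (i := j) (j := ⟨p - 1, by omega⟩) (by simp [Fin.le_def]; omega)
    simp only at this
    omega
  refine ⟨⟨fun j => f j - (p - 1 - (j : ℕ)), ?_, ?_⟩, ?_⟩
  · intro i j hij
    have := strictAnti_add_le hf hij
    have h1 := hlow i
    have h2 := hlow j
    have h3 : (i : ℕ) ≤ j := hij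
    simp only
    omega
  · intro i
    have hp := i.pos
    have h0 := strictAnti_add_le hf (i := ⟨0, hp⟩) (j := i) (by simp [Fin.le_def])
    simp only at h0
    have h1 := hlow i
    have h2 : f i - (p - 1 - (i : ℕ)) + p ≤ f ⟨0, hp⟩ + 1 := by omega
    have h3 : ((f ⟨0, hp⟩ + 1 : ℕ) : ℕ∞) ≤ n := by
      rw [Nat.cast_add, Nat.cast_one]
      exact Order.add_one_le_of_lt (hn _)
    exact le_trans (by exact_mod_cast h2) h3
  · funext j
    have := hlow j
    simp only [shifted]
    omega

theorem coeff_alternant {p : ℕ} (lam : Fin p → ℕ) (e : Fin p →₀ ℕ) :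
    (alternant p lam).coeff e = ∑ σ : Equiv.Perm (Fin p),
      if (shifted lam ∘ σ : Fin p → ℕ) = e then ((Equiv.Perm.sign σ : ℤ) : ℚ) else 0 := by
  classical
  rw [alternant, ← Matrix.det_transpose, Matrix.det_apply', coeff_sum]
  refine Finset.sum_congr rfl fun σ _ => ?_
  have h : ∏ i, (Matrix.of fun i j : Fin p => (X i : MvPolynomial (Fin p) ℚ)
      ^ (p - 1 - (j : ℕ) + lam j)).transpose (σ i) i
      = monomial (Finsupp.equivFunOnFinite.symm (shifted lam ∘ σ)) 1 := by
    rw [monomial_eq, map_one, one_mul, Finsupp.prod_fintype _ _ (by simp)]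
    rfl
  rw [h, ← map_intCast (C : ℚ →+* MvPolynomial (Fin p) ℚ), coeff_C_mul, coeff_monomial, mul_ite,
    mul_one, mul_zero]
  congr 1
  rw [Equiv.symm_apply_eq]
  rfl

/-- The sum over the partitions `λ` of the coefficients of the alternants, against the values at
`λ` of an alternating function. -/
theorem finsum_coeff_alternant_smul {p : ℕ} {n : ℕ∞} {M : Type} [AddCommGroup M] [Module ℚ M]
    (g : (Fin p → ℕ) → M)
    (hg : ∀ (e : Fin p → ℕ) (σ : Equiv.Perm (Fin p)), g (e ∘ σ) = (Equiv.Perm.sign σ : ℤ) • g e)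
    (hn : ∀ (e : Fin p → ℕ) i, n ≤ (e i : ℕ∞) → g e = 0) (e : Fin p →₀ ℕ) :
    ∑ᶠ lam : Part p n, (alternant p lam.1).coeff e • g (shifted lam.1) = g e := by
  classical
  have hterm : ∀ lam : Fin p → ℕ, (alternant p lam).coeff e • g (shifted lam)
      = ∑ σ : Equiv.Perm (Fin p), if (shifted lam ∘ σ : Fin p → ℕ) = e then g e else 0 := by
    intro lam
    rw [coeff_alternant, Finset.sum_smul]
    refine Finset.sum_congr rfl fun σ _ => ?_
    split_ifs with h
    · rw [← h, hg, Int.cast_smul_eq_zsmul]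
    · rw [zero_smul]
  simp only [hterm]
  by_cases h0 : g e = 0
  · simp [h0]
  -- A repeated exponent would be fixed by a transposition, forcing g e = -g e.
  have hinj : Function.Injective e := by
    intro i j hij
    by_contra hne
    apply h0
    have h1 : (e ∘ Equiv.swap i j : Fin p → ℕ) = e := by
      funext l
      rcases eq_or_ne l i with rfl | hi
      · simp [hij]
      · rcases eq_or_ne l j with rfl | hj
        · simp [hij]
        · simp [Equiv.swap_apply_of_ne_of_ne hi hj]
    have h2 := hg e (Equiv.swap i j)
    rw [h1, Equiv.Perm.sign_swap hne] at h2
    have h3 : (2 : ℚ) • g e = 0 := by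
      rw [two_smul]
      nth_rewrite 2 [h2]
      simp
    exact (smul_eq_zero.1 h3).resolve_left (by norm_num)
  have hlt : ∀ i, (e i : ℕ∞) < n := fun i => by
    by_contra h
    exact h0 (hn e i (not_lt.1 h))
  obtain ⟨τ, hτ⟩ := exists_perm_strictAnti hinj
  obtain ⟨lam, hlam⟩ := exists_part_shifted hτ fun i => hlt _
  -- The sorted sequence e ∘ τ is the shift of exactly one partition, and σ = τ⁻¹ is the only
  -- permutation recovering e from it.
  rw [finsum_eq_single _ lam]
  · rw [Finset.sum_eq_single τ⁻¹]
    · rw [if_pos]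
      rw [hlam]
      funext i
      simp
    · intro σ _ hσ
      rw [if_neg]
      intro h
      apply hσ
      rw [hlam] at h
      ext1 i
      have := hinj (congrFun h i)
      rw [Equiv.Perm.inv_def, Equiv.eq_symm_apply]
      exact this
    · simp
  · intro mu hmu
    refine Finset.sum_eq_zero fun σ _ => if_neg fun h => hmu ?_
    refine Subtype.ext (shifted_injective ?_)
    rw [hlam]
    refine ((strictAnti_shifted mu.2.1).range_inj hτ).1 ?_
    rw [τ.surjective.range_comp, ← h, σ.surjective.range_comp]

end Sorting

/-! ### Local finiteness of the family of Schur polynomials -/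

section LocallyFinite

variable {p : ℕ}

theorem isHomogeneous_vander (p : ℕ) :
    (vander p).IsHomogeneous (∑ i : Fin p, ∑ _j ∈ Finset.Ioi i, 1) :=
  IsHomogeneous.prod _ _ _ fun i _ => IsHomogeneous.prod _ _ _ fun j _ =>
    (isHomogeneous_X ℚ i).sub (isHomogeneous_X ℚ j)

theorem homogeneousComponent_mul_left {D : ℕ} {f : MvPolynomial (Fin p) ℚ} (hf : f.IsHomogeneous D)
    (g : MvPolynomial (Fin p) ℚ) (l : ℕ) :
    homogeneousComponent (D + l) (f * g) = f * homogeneousComponent l g := by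
  conv_lhs => rw [← sum_homogeneousComponent g]
  rw [Finset.mul_sum, map_sum]
  have h : ∀ i, homogeneousComponent (D + l) (f * homogeneousComponent i g)
      = if i = l then f * homogeneousComponent l g else 0 := by
    intro i
    rw [homogeneousComponent_of_mem (hf.mul (homogeneousComponent_isHomogeneous i g))]
    rcases eq_or_ne i l with rfl | hi
    · simp
    · simp [hi, hi.symm]
  simp only [h]
  rw [Finset.sum_ite_eq']
  split_ifs with hl
  · rfl
  · rw [homogeneousComponent_eq_zero, mul_zero]
    simpa using hl

/-- The Schur polynomial is a quotient of homogeneous polynomials: a component of any other degree,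
multiplied by the Vandermonde product, would be a zero component of the alternant. -/
theorem degree_eq_of_coeff_schur_ne_zero {lam : Fin p → ℕ} {e : Fin p →₀ ℕ}
    (he : (schur p lam).coeff e ≠ 0) :
    (∑ i : Fin p, ∑ _j ∈ Finset.Ioi i, 1) + e.degree = ∑ j, shifted lam j := by
  by_contra hne
  have h1 := homogeneousComponent_mul_left (isHomogeneous_vander p) (schur p lam) e.degree
  have h2 : (alternant p lam).IsHomogeneous (∑ j, shifted lam j) := by
    rw [alternant, Matrix.det_apply]
    refine IsHomogeneous.sum _ _ _ fun σ _ => ?_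
    rw [Units.smul_def, zsmul_eq_mul, ← map_intCast (C : ℚ →+* MvPolynomial (Fin p) ℚ)]
    refine IsHomogeneous.C_mul (IsHomogeneous.prod _ _ _ fun j _ => ?_) _
    have := (isHomogeneous_X ℚ (σ j)).pow (shifted lam j)
    rwa [one_mul] at this
  rw [vander_mul_schur, homogeneousComponent_of_mem h2, if_neg hne] at h1
  have h3 := (mul_eq_zero.1 h1.symm).resolve_left (vander_ne_zero p)
  apply he
  have h4 := congrArg (coeff e) h3
  rwa [coeff_homogeneousComponent, if_pos rfl, coeff_zero] at h4

/-- Each monomial occurs in finitely many members of the family. -/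
def LocallyFiniteCoeff {ι : Type} (f : ι → MvPolynomial (Fin p) ℚ) : Prop :=
  ∀ e, {i | (f i).coeff e ≠ 0}.Finite

/-- The degree of a monomial bounds every part of λ. For n = ∞ there can be infinitely many
partitions, and `finsum` would silently be 0 without this. -/
theorem locallyFiniteCoeff_schur (p : ℕ) (n : ℕ∞) :
    LocallyFiniteCoeff fun lam : Part p n => schur p lam.1 := by
  intro e
  set N := (∑ i : Fin p, ∑ _j ∈ Finset.Ioi i, 1) + e.degree with hN
  refine Set.Finite.of_finite_image (f := Subtype.val) ?_ Subtype.val_injective.injOn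
  refine (Set.finite_Iic (fun _ : Fin p => N)).subset ?_
  rintro _ ⟨lam, hlam, rfl⟩
  have h := degree_eq_of_coeff_schur_ne_zero hlam
  intro i
  have h1 : shifted lam.1 i ≤ ∑ j, shifted lam.1 j :=
    Finset.single_le_sum (f := shifted lam.1) (fun _ _ => Nat.zero_le _) (Finset.mem_univ i)
  have h2 : lam.1 i ≤ shifted lam.1 i := Nat.le_add_left _ _
  exact h2.trans (h1.trans (h.ge.trans le_rfl))

theorem LocallyFiniteCoeff.X_mul {ι : Type} {f : ι → MvPolynomial (Fin p) ℚ}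
    (hf : LocallyFiniteCoeff f) (s : Fin p) : LocallyFiniteCoeff fun i => X s * f i := by
  intro e
  refine (hf (e - Finsupp.single s 1)).subset fun i hi => ?_
  rw [Set.mem_ofPred_eq, coeff_X_mul'] at hi
  rw [Set.mem_ofPred_eq]
  split_ifs at hi with h
  · exact hi
  · exact absurd rfl hi

end LocallyFinite

/-! ### Multiplication by polynomials inside sums and linear maps -/

section FamilySeries

variable {p : ℕ} {σ ι R : Type} [CommRing R]

theorem coeff_X_mul_ite (s : σ) (G : MvPowerSeries σ R) (d : σ →₀ ℕ) :
    MvPowerSeries.coeff d (MvPowerSeries.X s * G)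
      = if d s = 0 then 0 else MvPowerSeries.coeff (d - Finsupp.single s 1) G := by
  classical
  rw [MvPowerSeries.X_def, MvPowerSeries.coeff_monomial_mul, one_mul]
  have : Finsupp.single s 1 ≤ d ↔ ¬ d s = 0 := by
    rw [Finsupp.single_le_iff]; omega
  by_cases h : d s = 0
  · rw [if_neg (by simpa [this] using h), if_pos h]
  · rw [if_pos (this.2 h), if_neg h]

variable [Algebra ℚ R]

/-- The series `∑_i f_i Ψ_i`, with the `f_i` polynomials in some of the variables, and the `Ψ_i`
series in the others, given by their coefficients. -/
def familySeries (v : Fin p ↪ σ) (f : ι → MvPolynomial (Fin p) ℚ) (Ψ : ι → (σ →₀ ℕ) → R) :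
    MvPowerSeries σ R :=
  fun d => ∑ᶠ i, (f i).coeff (d.comapDomain v v.injective.injOn) • Ψ i d

theorem coeff_familySeries (v : Fin p ↪ σ) (f : ι → MvPolynomial (Fin p) ℚ)
    (Ψ : ι → (σ →₀ ℕ) → R) (d : σ →₀ ℕ) : MvPowerSeries.coeff d (familySeries v f Ψ)
      = ∑ᶠ i, (f i).coeff (d.comapDomain v v.injective.injOn) • Ψ i d := rfl

/-- By `hΨ` the Ψ_i do not involve the variables of Q, so Q acts on the f_i alone. Local finiteness
is proved in the same induction, because additivity of `finsum` requires it. -/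
theorem aeval_mul_familySeries (v : Fin p ↪ σ) (Ψ : ι → (σ →₀ ℕ) → R)
    (hΨ : ∀ i s d, d (v s) ≠ 0 → Ψ i (d - Finsupp.single (v s) 1) = Ψ i d)
    (Q : MvPolynomial (Fin p) ℚ) {f : ι → MvPolynomial (Fin p) ℚ} (hf : LocallyFiniteCoeff f) :
    aeval (fun s => (MvPowerSeries.X (v s) : MvPowerSeries σ R)) Q * familySeries v f Ψ
      = familySeries v (fun i => Q * f i) Ψ ∧ LocallyFiniteCoeff fun i => Q * f i := by
  induction Q using MvPolynomial.induction_on generalizing f with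
  | C a =>
    constructor
    · ext d
      rw [aeval_C, MvPowerSeries.algebraMap_apply, MvPowerSeries.coeff_C_mul, ← Algebra.smul_def,
        coeff_familySeries, coeff_familySeries, smul_finsum]
      refine finsum_congr fun i => ?_
      rw [coeff_C_mul, mul_smul]
    · intro e
      refine (hf e).subset fun i hi h => hi ?_
      rw [coeff_C_mul, h, mul_zero]
  | add P Q hP hQ =>
    obtain ⟨hP1, hP2⟩ := hP hf
    obtain ⟨hQ1, hQ2⟩ := hQ hf
    constructor
    · rw [map_add, add_mul, hP1, hQ1]
      ext d
      rw [map_add, coeff_familySeries, coeff_familySeries, coeff_familySeries,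
        ← finsum_add_distrib]
      · refine finsum_congr fun i => ?_
        rw [add_mul, coeff_add, add_smul]
      · exact (hP2 _).subset fun i hi h => hi (by beta_reduce at h ⊢; rw [h, zero_smul])
      · exact (hQ2 _).subset fun i hi h => hi (by beta_reduce at h ⊢; rw [h, zero_smul])
    · intro e
      refine ((hP2 e).union (hQ2 e)).subset fun i hi => ?_
      by_contra h
      simp only [Set.mem_union, Set.mem_ofPred_eq, not_or, not_not] at h
      apply hi
      beta_reduce
      rw [add_mul, coeff_add, h.1, h.2, add_zero]
  | mul_X Q s hQ =>
    obtain ⟨h1, h2⟩ := hQ (hf.X_mul s)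
    simp only [← mul_assoc] at h1 h2
    refine ⟨?_, h2⟩
    rw [← h1, map_mul, aeval_X, mul_assoc]
    congr 1
    ext d
    rw [coeff_X_mul_ite, coeff_familySeries, coeff_familySeries]
    simp only [coeff_X_mul', Finsupp.mem_support_iff, Finsupp.comapDomain_apply]
    by_cases h : d (v s) = 0
    · simp [h]
    · rw [if_neg h]
      refine finsum_congr fun i => ?_
      rw [if_pos h, hΨ i s d h]
      have : (d - Finsupp.single (v s) 1).comapDomain v v.injective.injOn
          = d.comapDomain v v.injective.injOn - Finsupp.single s 1 := by
        classical
        ext j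
        simp [Finsupp.single_apply, v.injective.eq_iff]
      rw [this]

/-- The series with coefficients the images of the coefficients of a series in some of the
variables, under linear maps depending on the exponents of the other variables. -/
def mapSeries {A : Type} [CommRing A] [Algebra ℚ A] (v : Fin p ↪ σ) (L : (σ →₀ ℕ) → A →ₗ[ℚ] R)
    (F : MvPowerSeries (Fin p) A) : MvPowerSeries σ R :=
  fun d => L d (MvPowerSeries.coeff (d.comapDomain v v.injective.injOn) F)

theorem coeff_mapSeries {A : Type} [CommRing A] [Algebra ℚ A] (v : Fin p ↪ σ)
    (L : (σ →₀ ℕ) → A →ₗ[ℚ] R) (F : MvPowerSeries (Fin p) A) (d : σ →₀ ℕ) :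
    MvPowerSeries.coeff d (mapSeries v L F)
      = L d (MvPowerSeries.coeff (d.comapDomain v v.injective.injOn) F) := rfl

theorem aeval_mul_mapSeries {A : Type} [CommRing A] [Algebra ℚ A] (v : Fin p ↪ σ)
    (L : (σ →₀ ℕ) → A →ₗ[ℚ] R)
    (hL : ∀ s d, d (v s) ≠ 0 → L (d - Finsupp.single (v s) 1) = L d)
    (Q : MvPolynomial (Fin p) ℚ) (F : MvPowerSeries (Fin p) A) :
    aeval (fun s => (MvPowerSeries.X (v s) : MvPowerSeries σ R)) Q * mapSeries v L F
      = mapSeries v L (aeval (fun s => (MvPowerSeries.X s : MvPowerSeries (Fin p) A)) Q * F) := by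
  induction Q using MvPolynomial.induction_on generalizing F with
  | C a =>
    ext d
    rw [aeval_C, aeval_C, MvPowerSeries.algebraMap_apply, MvPowerSeries.algebraMap_apply,
      MvPowerSeries.coeff_C_mul, coeff_mapSeries, coeff_mapSeries, MvPowerSeries.coeff_C_mul,
      ← Algebra.smul_def, ← Algebra.smul_def, map_smul]
  | add P Q hP hQ =>
    rw [map_add, add_mul, hP, hQ, map_add, add_mul]
    ext d
    simp only [map_add, coeff_mapSeries]
  | mul_X Q s hQ =>
    rw [map_mul, map_mul, mul_assoc, mul_assoc, aeval_X, aeval_X, ← hQ]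
    congr 1
    ext d
    rw [coeff_X_mul_ite]
    rw [coeff_mapSeries, coeff_mapSeries, coeff_X_mul_ite, Finsupp.comapDomain_apply]
    split_ifs with h
    · rw [map_zero]
    · rw [hL s d h]
      have : (d - Finsupp.single (v s) 1).comapDomain v v.injective.injOn
          = d.comapDomain v v.injective.injOn - Finsupp.single s 1 := by
        classical
        ext j
        simp [Finsupp.single_apply, v.injective.eq_iff]
      rw [this]

end FamilySeries

/-! ### Vandermonde products are not zero divisors -/

section Regular

variable {σ R : Type} [CommRing R]

/-- If X_a G = X_b G, the coefficient of G at d equals the one at d + e_a - e_b, and is 0 when b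
does not occur in d; so descend on the exponent of b. The coefficient ring need not be a domain, as
is the case for B_{m,n}. -/
theorem isLeftRegular_X_sub_X {a b : σ} (hab : a ≠ b) :
    IsLeftRegular (MvPowerSeries.X a - MvPowerSeries.X b : MvPowerSeries σ R) := by
  rw [isLeftRegular_iff_right_eq_zero_of_mul]
  intro G hG
  rw [sub_mul, sub_eq_zero] at hG
  have key : ∀ N (d : σ →₀ ℕ), d b = N → MvPowerSeries.coeff d G = 0 := by
    intro N
    induction N with
    | zero =>
      intro d hd
      have := congrArg (MvPowerSeries.coeff (d + Finsupp.single a 1)) hG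
      rw [coeff_X_mul_ite, coeff_X_mul_ite, if_neg (by simp), if_pos (by
        simp [hd, Finsupp.single_eq_of_ne hab.symm]), add_tsub_cancel_right] at this
      exact this
    | succ N ih =>
      intro d hd
      have := congrArg (MvPowerSeries.coeff (d + Finsupp.single a 1)) hG
      rw [coeff_X_mul_ite, coeff_X_mul_ite, if_neg (by simp), if_neg (by
        simp [hd]), add_tsub_cancel_right] at this
      rw [this]
      refine ih _ ?_
      simp [hd, Finsupp.single_eq_of_ne hab.symm]
  ext d
  rw [key _ d rfl, map_zero]

theorem isLeftRegular_det_nodalMatrix_X [Algebra ℚ R] {p : ℕ} (v : Fin p ↪ σ) :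
    IsLeftRegular (nodalMatrix fun i => (MvPowerSeries.X (v i) : MvPowerSeries σ R)).det := by
  rw [det_nodalMatrix]
  have hprod : ∀ {ι : Type} (s : Finset ι) (f : ι → MvPowerSeries σ R),
      (∀ i ∈ s, IsLeftRegular (f i)) → IsLeftRegular (∏ i ∈ s, f i) := by
    intro ι s f hf
    exact Finset.prod_induction f IsLeftRegular (fun _ _ => IsLeftRegular.mul)
      isRegular_one.left hf
  refine hprod _ _ fun i _ => hprod _ _ fun j hj => isLeftRegular_X_sub_X ?_
  exact v.injective.ne (Finset.mem_Ioi.1 hj).ne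

end Regular

/-! ### Vandermonde products and exp (∑ x_i p_i(t)) -/

section Vandermonde

theorem aeval_vander {A : Type} [CommRing A] [Algebra ℚ A] {p : ℕ} (v : Fin p → A) :
    aeval v (vander p) = ∏ i, ∏ j ∈ Finset.Ioi i, (v i - v j) := by
  simp [vander, map_prod]

theorem vander_eq_det (p : ℕ) :
    vander p = (Matrix.of fun s j : Fin p => (X s : MvPolynomial (Fin p) ℚ) ^ (p - 1 - (j : ℕ))).det := by
  have := vander_mul_toSymm_jacobiTrudi p fun j => p - 1 - (j : ℕ)
  rwa [jacobiTrudi_staircase, map_one, mul_one] at this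

/-- The two products are Vandermonde determinants with increasing and with decreasing powers, which
differ by the reversal of the columns. -/
theorem prod_sub_eq_sign_mul {A : Type} [CommRing A] [Algebra ℚ A] {p : ℕ} (v : Fin p → A) :
    ∏ i, ∏ j ∈ Finset.Ioi i, (v j - v i)
      = ((Equiv.Perm.sign (Fin.revPerm : Equiv.Perm (Fin p)) : ℤ) : A) * aeval v (vander p) := by
  rw [← Matrix.det_vandermonde, vander_eq_det, AlgHom.map_det, AlgHom.mapMatrix_apply,
    ← Matrix.det_permute' Fin.revPerm]
  congr 1
  ext1 s j
  have : p - 1 - ((Fin.rev j : Fin p) : ℕ) = j := by rw [Fin.val_rev]; omega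
  simp only [Matrix.vandermonde_apply, Matrix.submatrix_apply, id, Matrix.map_apply,
    Matrix.of_apply, map_pow, aeval_X, Fin.revPerm_apply, this]

/-- The coefficients of `∏_{i < j} (t_i - t_j) exp (∑ x_i p_i(t))` are Jacobi–Trudi determinants. -/
theorem coeff_vander_mul_schubertSeries (r : ℕ) (n : ℕ∞) (e : Fin r →₀ ℕ) :
    MvPowerSeries.coeff e (aeval (fun s => (MvPowerSeries.X s : MvPowerSeries (Fin r) (B r n)))
      (vander r) * schubertSeries r n) = Ideal.Quotient.mk _ (jacobiTrudi r e) := by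
  rw [schubertSeries, expX_eq_prod _ _ _ (by simp), vander_eq_det, AlgHom.map_det,
    AlgHom.mapMatrix_apply, ← Matrix.det_transpose, mul_comm, ← Matrix.det_mul_row, jacobiTrudi,
    RingHom.map_det, RingHom.mapMatrix_apply]
  -- The exponential is ∏ S(t_j); its factors are absorbed into the columns of the Vandermonde
  -- matrix, one variable per column.
  have h1 := coeff_det_X_pow_mul_subst (segreQuot r n) e
  refine Eq.trans ?_ (h1.trans ?_)
  · congr 2
    ext1 i j
    simp [mul_comm]
  · congr 1
    ext1 i j
    simp [segreQuot, map_coeffZ]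

end Vandermonde

/-! ### The left-hand sides -/

section LeftHandSide

variable {h k r : ℕ} {n : ℕ∞}

variable (h k r) in
/-- The inclusion of the `z_i` into the indeterminates. -/
def zEmb : Fin h ↪ Vars h k r := ⟨Sum.inl, Sum.inl_injective⟩

variable (h k r) in
/-- The inclusion of the `w_i⁻¹` into the indeterminates. -/
def uEmb : Fin k ↪ Vars h k r := ⟨Sum.inr ∘ Sum.inl, Sum.inr_injective.comp Sum.inl_injective⟩

variable (h k r) in
/-- The inclusion of the `t_i` into the indeterminates. -/
def tEmb : Fin r ↪ Vars h k r := ⟨Sum.inr ∘ Sum.inr, Sum.inr_injective.comp Sum.inr_injective⟩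

theorem vanderZT_eq (A : Type) [CommRing A] [Algebra ℚ A] : vanderZT h k r A
    = aeval (fun s => (MvPowerSeries.X (zEmb h k r s) : MvPowerSeries (Vars h k r) A)) (vander h)
      * aeval (fun s => (MvPowerSeries.X (tEmb h k r s) : MvPowerSeries (Vars h k r) A))
        (vander r) := by
  rw [aeval_vander, aeval_vander, vanderZT, det_nodalMatrix, det_nodalMatrix]
  rfl

theorem isLeftRegular_vanderZT (A : Type) [CommRing A] [Algebra ℚ A] :
    IsLeftRegular (vanderZT h k r A) :=
  (isLeftRegular_det_nodalMatrix_X (zEmb h k r)).mul (isLeftRegular_det_nodalMatrix_X (tEmb h k r))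

theorem zExp_sub_single (d : Vars h k r →₀ ℕ) (s : Fin k ⊕ Fin r) :
    zExp (d - Finsupp.single (Sum.inr s) 1) = zExp d := by
  ext i
  change (d - Finsupp.single (Sum.inr s) 1 : Vars h k r →₀ ℕ) (Sum.inl i) = d (Sum.inl i)
  simp

theorem uExp_sub_single (d : Vars h k r →₀ ℕ) (s : Vars h k r) (hs : ∀ i, s ≠ Sum.inr (Sum.inl i)) :
    uExp (d - Finsupp.single s 1) = uExp d := by
  ext i
  change (d - Finsupp.single s 1 : Vars h k r →₀ ℕ) (Sum.inr (Sum.inl i)) = d (Sum.inr (Sum.inl i))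
  simp [Finsupp.single_eq_of_ne (hs i).symm]

theorem tExp_sub_single (d : Vars h k r →₀ ℕ) (s : Vars h k r) (hs : ∀ i, s ≠ Sum.inr (Sum.inr i)) :
    tExp (d - Finsupp.single s 1) = tExp d := by
  ext i
  change (d - Finsupp.single s 1 : Vars h k r →₀ ℕ) (Sum.inr (Sum.inr i)) = d (Sum.inr (Sum.inr i))
  simp [Finsupp.single_eq_of_ne (hs i).symm]

/-- Multiplying by the Vandermonde product replaces s_λ by an alternant, and the action is
alternating in the exponents of the wedge, so the sum over λ collapses to a single word. -/
theorem vander_mul_contractStar (hk : k ≤ r + h) (F : MvPowerSeries (Fin r) (B r n)) :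
    aeval (fun s => (MvPowerSeries.X (zEmb h k r s) : Ser r h k n)) (vander h)
        * contractStar r h k n F
      = mapSeries (tEmb h k r) (fun d => actHom r h k n (zExp d) (uExp d)) F := by
  have h1 : contractStar r h k n F = familySeries (zEmb h k r)
      (fun lam : Part h n => schur h lam.1) fun lam d =>
        actHom r h k n (shifted lam.1) (uExp d) (MvPowerSeries.coeff (tExp d) F) := by
    ext d
    change (∑ᶠ lam : Part h n, _) = ∑ᶠ lam : Part h n, _
    refine finsum_congr fun lam => ?_
    rw [contractAct_eq n hk]
    rfl
  rw [h1, (aeval_mul_familySeries _ _ ?_ _ (locallyFiniteCoeff_schur h n)).1]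
  · ext d
    rw [coeff_familySeries, coeff_mapSeries]
    simp only [vander_mul_schur]
    refine finsum_coeff_alternant_smul
      (fun e => actHom r h k n e (uExp d) (MvPowerSeries.coeff (tExp d) F)) ?_ ?_ _
    · intro e σ
      rw [actHom_perm_left, LinearMap.smul_apply]
    · intro e i hi
      rw [actHom_eq_zero_left n e _ i hi, LinearMap.zero_apply]
  · intro lam s d _
    rw [uExp_sub_single _ _ (by simp [zEmb]), tExp_sub_single _ _ (by simp [zEmb])]

/-- After multiplication by the Vandermonde products in z and t, both sides have as coefficients the
values of the words on the Jacobi–Trudi elements. -/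
theorem contractStar_schubertSeries (hr : (r : ℕ∞) ≤ n) (hk : k ≤ r + h) :
    contractStar r h k n (schubertSeries r n) = rhsSeries r h k n hk := by
  refine isLeftRegular_vanderZT (h := h) (k := k) (r := r) (B (r + h - k) n) ?_
  beta_reduce
  ext d
  rw [coeff_vanderZT_mul_rhsSeries r h k n hr hk, vanderZT_eq, mul_right_comm,
    vander_mul_contractStar hk, mul_comm, aeval_mul_mapSeries, coeff_mapSeries]
  · exact congrArg _ (coeff_vander_mul_schubertSeries r n _)
  · intro s d _
    rw [uExp_sub_single _ _ (by simp [tEmb])]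
    exact congrArg (fun e : Fin h →₀ ℕ => actHom r h k n e (uExp d)) (zExp_sub_single d (Sum.inr s))

/-- The sum over μ collapses by antisymmetry of the contractions; the exponents of the w_i⁻¹ come
out in reversed order, which costs the sign of the reversal. -/
theorem vander_mul_cliffordStar (hk : k ≤ r + h) (F : MvPowerSeries (Fin r) (B r n)) :
    aeval (fun s => (MvPowerSeries.X (uEmb h k r s) : Ser r h k n)) (vander k)
        * cliffordStar r h k n F
      = ((Equiv.Perm.sign (Fin.revPerm : Equiv.Perm (Fin k)) : ℤ) : Ser r h k n)
        * contractStar r h k n F := by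
  set Φ : (Vars h k r →₀ ℕ) → (Fin k → ℕ) → B (r + h - k) n := fun d e =>
    ∑ᶠ lam : Part h n, (schur h lam.1).coeff (zExp d) •
      actHom r h k n (shifted lam.1) (e ∘ Fin.rev) (MvPowerSeries.coeff (tExp d) F) with hΦ
  have h1 : cliffordStar r h k n F = familySeries (uEmb h k r)
      (fun mu : Part k n => schur k mu.1) fun mu d => Φ d (shifted mu.1) := by
    ext d
    rw [coeff_familySeries]
    change (∑ᶠ q : Part h n × Part k n, _) = _
    -- Iterating the sum requires finite support on pairs, supplied by local finiteness in λ and in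
    -- μ.
    rw [← finsum_comp_equiv (Equiv.prodComm (Part k n) (Part h n)), finsum_curry]
    · refine finsum_congr fun mu => ?_
      rw [hΦ, smul_finsum]
      refine finsum_congr fun lam => ?_
      rw [wordAct_eq n hk, smul_smul, mul_comm]
      rfl
    · refine ((locallyFiniteCoeff_schur k n (uExp d)).prod
        (locallyFiniteCoeff_schur h n (zExp d))).subset ?_
      rintro ⟨mu, lam⟩ hq
      rw [Function.mem_support] at hq
      constructor
      · intro h0
        apply hq
        simp only at h0
        simp [h0]
      · intro h0
        apply hq
        simp only at h0
        simp [h0]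
  rw [h1, (aeval_mul_familySeries _ _ ?_ _ (locallyFiniteCoeff_schur k n)).1]
  · ext d
    rw [coeff_familySeries, ← map_intCast (MvPowerSeries.C : B (r + h - k) n →+* _),
      MvPowerSeries.coeff_C_mul]
    simp only [vander_mul_schur]
    rw [finsum_coeff_alternant_smul (Φ d) ?_ ?_]
    · change _ = _ * ∑ᶠ lam : Part h n, _
      rw [← zsmul_eq_mul, ← Int.cast_smul_eq_zsmul ℚ, smul_finsum]
      refine finsum_congr fun lam => ?_
      have := actHom_perm_right n hk (shifted lam.1) (uExp d) (Fin.revPerm : Equiv.Perm (Fin k))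
      rw [Int.cast_smul_eq_zsmul, contractAct_eq n hk, smul_comm, ← LinearMap.smul_apply]
      exact congrArg (fun L => (schur h lam.1).coeff (zExp d) •
        L (MvPowerSeries.coeff (tExp d) F)) this
    · intro e σ
      rw [hΦ]
      beta_reduce
      rw [← Int.cast_smul_eq_zsmul ℚ, smul_finsum]
      refine finsum_congr fun lam => ?_
      -- Conjugating σ by the reversal does not change its sign.
      have h2 : (e ∘ σ) ∘ Fin.rev = (e ∘ Fin.rev) ∘ (Fin.revPerm.permCongr σ) := by
        funext i
        simp
      rw [h2, actHom_perm_right n hk, Equiv.Perm.sign_permCongr, LinearMap.smul_apply, smul_comm,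
        Int.cast_smul_eq_zsmul]
    · intro e i hi
      rw [hΦ]
      beta_reduce
      rw [finsum_eq_zero_of_forall_eq_zero]
      intro lam
      rw [actHom_eq_zero_right n _ (e ∘ Fin.rev) i.rev (by simpa using hi), LinearMap.zero_apply,
        smul_zero]
  · intro mu s d _
    have hz : zExp (d - Finsupp.single (uEmb h k r s) 1) = zExp d := zExp_sub_single d (Sum.inl s)
    rw [hΦ]
    beta_reduce
    rw [hz, tExp_sub_single _ _ (by simp [uEmb])]

theorem prod_mul_cliffordStar (hk : k ≤ r + h) (F : MvPowerSeries (Fin r) (B r n)) :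
    (∏ i : Fin k, ∏ j ∈ Finset.Ioi i, (uv r h k n j - uv r h k n i)) * cliffordStar r h k n F
      = contractStar r h k n F := by
  have h1 : aeval (uv r h k n) (vander k) * cliffordStar r h k n F
      = ((Equiv.Perm.sign (Fin.revPerm : Equiv.Perm (Fin k)) : ℤ) : Ser r h k n)
        * contractStar r h k n F := vander_mul_cliffordStar hk F
  rw [prod_sub_eq_sign_mul, mul_assoc, h1, ← mul_assoc, ← Int.cast_mul, ← Units.val_mul,
    Int.units_mul_self, Units.val_one, Int.cast_one, one_mul]

end LeftHandSide

end
end GrassmannFermions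

open GrassmannFermions in
theorem theorem4 (n : ℕ∞) (r h k : ℕ) (hr : (r : ℕ∞) ≤ n) (hk : k ≤ r + h) :
    (Function.Injective (fermion (r + h - k) n) ∧
      LinearMap.range (fermion (r + h - k) n) = ⋀[ℚ]^(r + h - k) (V n)) ∧
    (∏ i : Fin k, ∏ j ∈ Finset.Ioi i,
        emb r h k n (uv r h k n j - uv r h k n i)) *
      emb r h k n (cliffordStar r h k n (schubertSeries r n)) = mainRHS r h k n ∧
    emb r h k n (contractStar r h k n (schubertSeries r n)) = mainRHS r h k n := by
  have h2 : emb r h k n (contractStar r h k n (schubertSeries r n)) = mainRHS r h k n := by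
    rw [contractStar_schubertSeries hr hk, mainRHS_eq_emb r h k n hk]
  refine ⟨⟨fermion_injective _ n, range_fermion _ n⟩, ?_, h2⟩
  rw [← h2, ← prod_mul_cliffordStar hk (schubertSeries r n), map_mul, map_prod]
  simp only [map_prod]
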